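/- Theorem. Let $n\in\mathbb N$ and let $p_H:\mathbb{R}^n\to[0,\infty)$ be a probability density with finite second moment $\int\|x\|^2p_H(x)\,dx<\infty$. For $t>0$ let $$p_t(x)=\int_{\mathbb{R}^n}p_H(y)\,\bigl(2\pi\sigma^2(t)\bigr)^{-n/2}\exp\Bigl(-\tfrac{\|x-a(t)y\|^2}{2\sigma^2(t)}\Bigr)\,dy,\qquad a(t)=e^{-t/2},\quad \sigma^2(t)=1-e^{-t},$$ let $s_t=\nabla\log p_t$ be the score and $v_t(x)=-\tfrac12x-\tfrac12s_t(x)$. Let $p_Z$ denote the standard Gaussian density on $\mathbb{R}^n$. Suppose there is a function $L$ such that (i) $\sup_{x\in\mathbb{R}^n}\|\nabla s_t(x)\|\le L(t)<\infty$ for all $t>0$ (operator norm), and (ii) $\int_\delta^T(1+L(t))\,dt<\infty$ for all $0<\delta<T<\infty$. Then $p_t$ is, for every $t>0$, the density of the time-$t$ marginal of the variance-preserving (VP) process, i.e. of $X_t$ for every solution $X$ of $dX_t=-\tfrac12X_t\,dt+dW_t$, $X_0\sim p_H$, with $W$ a standard Brownian motion in $\mathbb{R}^n$ independent of $X_0$.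 Moreover, the probability-flow ODE $\frac{dx}{dt}=v_t(x)$ has a unique flow $\varphi_{\delta\to T}:\mathbb{R}^n\to\mathbb{R}^n$, $0<\delta\le T<\infty$ (mapping the value of a solution at time $\delta$ to its value at time $T$), and I. for all $0<\delta<T<\infty$, $\varphi_{\delta\to T}$ is a bi-Lipschitz $C^1$-diffeomorphism of $\mathbb{R}^n$; II. for every $\delta>0$, $\lim_{T\to\infty}\mathrm{KL}\bigl((\varphi_{\delta\to T})_\#p_\delta\,\|\,p_Z\bigr)=0$; III. for all $0<\delta<T<\infty$ the pushforward $(\varphi_{\delta\to T}^{-1})_\#p_Z$ has a Lebesgue density, for every $\delta>0$ the limit of $\|p_H-(\varphi_{\delta\to T}^{-1})_\#p_Z\|_{L^1(\mathbb{R}^n)}$ as $T\to\infty$ exists, and $\lim_{\delta\to0}\lim_{T\to\infty}\|p_H-(\varphi_{\delta\to T}^{-1})_\#p_Z\|_{L^1(\mathbb{R}^n)}=0$. -/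

import Mathlib

open MeasureTheory ProbabilityTheory Filter Set
open scoped Topology ENNReal NNReal

noncomputable section

namespace VPFlow

variable {n : ℕ}

/-- The density `φ_{σ², μ}` of the Gaussian `N(μ, σ² I_n)` on `ℝⁿ`; `v` is the variance `σ² > 0`. -/
def gaussianDensity (v : ℝ) (μ x : EuclideanSpace ℝ (Fin n)) : ℝ :=
  (2 * Real.pi * v) ^ (-(n : ℝ) / 2) * Real.exp (-‖x - μ‖ ^ 2 / (2 * v))

/-- `a(t) = exp (-t/2)`. -/
def coeffA (t : ℝ) : ℝ := Real.exp (-t / 2)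

/-- `σ²(t) = 1 - exp (-t)`. -/
def sigmaSq (t : ℝ) : ℝ := 1 - Real.exp (-t)

/-- The measure on `ℝⁿ` with Lebesgue density `p`. -/
def densityMeasure (p : EuclideanSpace ℝ (Fin n) → ℝ) : Measure (EuclideanSpace ℝ (Fin n)) :=
  volume.withDensity fun x => ENNReal.ofReal (p x)

/-- `W` is a standard Brownian motion in `ℝⁿ`: its coordinates are independent standard real
Brownian motions. -/
structure IsBrownianMotion {Ω : Type*} [MeasurableSpace Ω]
    (W : ℝ≥0 → Ω → EuclideanSpace ℝ (Fin n)) (P : Measure Ω) : Prop where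
  measurable : ∀ t, Measurable (W t)
  isBrownianReal : ∀ i, IsBrownianReal (fun t ω => W t ω i) P
  indep : iIndepFun (fun (i : Fin n) (ω : Ω) (t : ℝ≥0) => W t ω i) P

/-- `X` is a solution of the variance-preserving SDE `dX_t = -½ X_t dt + dW_t`, with initial
density `pH`, driven by the Brownian motion `W`, which is independent of `X_0`. (The noise is
additive, so the stochastic integral of the SDE is `W_t - W_0 = W_t`.) -/
structure IsVPProcess {Ω : Type*} [MeasurableSpace Ω] (pH : EuclideanSpace ℝ (Fin n) → ℝ)
    (W X : ℝ≥0 → Ω → EuclideanSpace ℝ (Fin n)) (P : Measure Ω) : Prop where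
  brownian : IsBrownianMotion W P
  measurable : ∀ t, Measurable (X t)
  initial : P.map (X 0) = densityMeasure pH
  indep : IndepFun (X 0) (fun (ω : Ω) (t : ℝ≥0) => W t ω) P
  continuous_paths : ∀ᵐ ω ∂P, Continuous fun t => X t ω
  sde : ∀ᵐ ω ∂P, ∀ t : ℝ≥0,
    X t ω = X 0 ω - (1 / 2 : ℝ) • (∫ s in (0 : ℝ)..t, X s.toNNReal ω) + W t ω

/-- The marginal density `p_t`, `t > 0`, of the variance-preserving process with initial
density `pH`: `p_t(x) = ∫ pH(y) φ_{σ²(t), a(t) y}(x) dy`. -/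
def marginal (pH : EuclideanSpace ℝ (Fin n) → ℝ) (t : ℝ) (x : EuclideanSpace ℝ (Fin n)) : ℝ :=
  ∫ y, pH y * gaussianDensity (sigmaSq t) (coeffA t • y) x

/-- The score `s_t = ∇ log p_t`. -/
def score (pH : EuclideanSpace ℝ (Fin n) → ℝ) (t : ℝ) (x : EuclideanSpace ℝ (Fin n)) :
    EuclideanSpace ℝ (Fin n) :=
  gradient (fun z => Real.log (marginal pH t z)) x

/-- The velocity `v_t(x) = -½ x - ½ s_t(x)` of the probability-flow ODE. -/
def velocity (pH : EuclideanSpace ℝ (Fin n) → ℝ) (t : ℝ) (x : EuclideanSpace ℝ (Fin n)) :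
    EuclideanSpace ℝ (Fin n) :=
  -((1 / 2 : ℝ) • x) - (1 / 2 : ℝ) • score pH t x

/-- `φ δ T` (for `0 < δ ≤ T`) is the flow of the probability-flow ODE `dx/dt = v_t(x)`: for every
`δ > 0` and `x`, the curve `t ↦ φ δ t x` on `[δ, ∞)` solves the ODE and starts from `x` at time
`δ`. -/
def IsFlow (pH : EuclideanSpace ℝ (Fin n) → ℝ)
    (φ : ℝ → ℝ → EuclideanSpace ℝ (Fin n) → EuclideanSpace ℝ (Fin n)) : Prop :=
  ∀ δ : ℝ, 0 < δ → ∀ x, φ δ δ x = x ∧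
    ∀ t : ℝ, δ ≤ t →
      HasDerivWithinAt (fun τ => φ δ τ x) (velocity pH t (φ δ t x)) (Ici δ) t

/-- A bi-Lipschitz `C¹`-diffeomorphism of `ℝⁿ`: a bijection that is `C¹` and Lipschitz and has a
`C¹` and Lipschitz inverse. -/
def IsBiLipschitzDiffeo (f : EuclideanSpace ℝ (Fin n) → EuclideanSpace ℝ (Fin n)) : Prop :=
  ∃ g : EuclideanSpace ℝ (Fin n) → EuclideanSpace ℝ (Fin n),
    Function.LeftInverse g f ∧ Function.RightInverse g f ∧
    ContDiff ℝ 1 f ∧ ContDiff ℝ 1 g ∧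
    (∃ K : ℝ≥0, LipschitzWith K f) ∧ ∃ K : ℝ≥0, LipschitzWith K g

/-- The Gaussian pullback `(f⁻¹)_# p_Z`, for a bijection `f`. -/
def gaussianPullback (f : EuclideanSpace ℝ (Fin n) → EuclideanSpace ℝ (Fin n)) :
    Measure (EuclideanSpace ℝ (Fin n)) :=
  (stdGaussian (EuclideanSpace ℝ (Fin n))).map (Function.invFun f)

/-- The `L¹` distance between a density `p` and the Lebesgue density of a measure `μ`
(for `μ` absolutely continuous). -/
def l1Dist (p : EuclideanSpace ℝ (Fin n) → ℝ) (μ : Measure (EuclideanSpace ℝ (Fin n))) : ℝ≥0∞ :=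
  eLpNorm (fun x => p x - (μ.rnDeriv volume x).toReal) 1 volume

end VPFlow

end

noncomputable section

namespace VPFlow

set_option linter.unusedSectionVars false

open scoped RealInnerProductSpace

/-! The conceptual core is conservation of mass. Expanding the Gaussian kernel expresses `marginal`,
`score` and `velocity` through exponential moments of `pH` (`expMoment`), which may be
differentiated under the integral for `t > 0`. A direct computation then gives the continuity
equation in Lagrangian form: along an integral curve of the velocity, `log p_t` has derivative `-div
v_t`.

The bound on the derivative of the score makes `v_t` Lipschitz with constant `½ (1 + L t)`,
integrable on compact subintervals of `(0, ∞)`. Picard–Lindelöf for a truncated field and Grönwall's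
inequality give a global, unique, bi-Lipschitz flow. The variational equation shows that it is `C¹`,
and Liouville's formula says that the logarithm of its Jacobian determinant has derivative `div
v_t`. The two derivatives cancel, so `p_T(φ x) det Dφ(x) = p_δ(x)` (`marginal_mul_det_eq`): the flow
transports `p_δ` exactly to `p_T`.

II therefore reduces to `KL(p_T ‖ p_Z) → 0`. Relative entropy does not increase under projection, so
it suffices to bound the entropy of the joint law of `(X_0, X_T)` relative to the product of `pH`
and the standard Gaussian; there the density ratio is explicit, and the finite second moment
controls its logarithm.

For III, pulling densities back by the flow preserves `L¹` distances, so the pullback of `p_Z` is as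
far from `p_δ` as `p_Z` is from `p_T`. That distance tends to zero by Scheffé's lemma, so the inner
limit is `‖pH - p_δ‖`. It vanishes as `δ → 0` because `p ↦ p_t` contracts `L¹` and converges to the
identity on compactly supported continuous densities.

The identification of `p_t` with the law of `X_t` uses variation of constants along each path:
`e^{t/2} X_t - X_0` is a limit of weighted sums of Brownian increments, whose characteristic
functions are explicit. -/

/-! ### Grönwall inequalities with an integrable coefficient -/

/-- **Grönwall's inequality** in integral form, with an integrable coefficient. -/
theorem le_mul_exp_integral_of_le_add_integral {u l : ℝ → ℝ} {a b c : ℝ} (hab : a ≤ b)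
    (hu : ContinuousOn u (Icc a b)) (hu0 : ∀ t ∈ Icc a b, 0 ≤ u t)
    (hl : IntervalIntegrable l volume a b) (hl0 : ∀ t ∈ Icc a b, 0 ≤ l t) (hc : 0 ≤ c)
    (h : ∀ t ∈ Icc a b, u t ≤ c + ∫ s in a..t, l s * u s) {t : ℝ} (ht : t ∈ Icc a b) :
    u t ≤ c * Real.exp (∫ s in a..t, l s) := by
  have hu' : ContinuousOn u (uIcc a b) := by rwa [uIcc_of_le hab]
  have hlu : IntervalIntegrable (fun s => l s * u s) volume a b := hl.mul_continuousOn hu'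
  have hsub : ∀ {x y : ℝ}, x ∈ Icc a b → y ∈ Icc a b → uIcc x y ⊆ uIcc a b := fun hx hy => by
    rw [uIcc_of_le hab]; exact uIcc_subset_Icc hx hy
  have haI : a ∈ Icc a b := left_mem_Icc.2 hab
  -- Since `l` is merely integrable, the right side need not be differentiable everywhere, so
  -- continuous induction on a closed set replaces differentiation. The slack `ε` makes `u x < F x`
  -- strict, hence `u < F x` slightly beyond `x`, and `1 + r ≤ exp r` propagates the bound.
  have key : ∀ ε : ℝ, 0 < ε → ∀ t ∈ Icc a b,
      c + ε + ∫ s in a..t, l s * u s ≤ (c + ε) * Real.exp (∫ s in a..t, l s) := by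
    intro ε hε
    have hcl : ContinuousOn (fun t => c + ε + ∫ s in a..t, l s * u s) (Icc a b) := by
      have := intervalIntegral.continuousOn_primitive_interval' hlu left_mem_uIcc
      rw [uIcc_of_le hab] at this
      exact continuousOn_const.add this
    have hcr : ContinuousOn (fun t => (c + ε) * Real.exp (∫ s in a..t, l s)) (Icc a b) := by
      have := intervalIntegral.continuousOn_primitive_interval' hl left_mem_uIcc
      rw [uIcc_of_le hab] at this
      exact continuousOn_const.mul this.rexp
    have hclosed : IsClosed ({t | c + ε + ∫ s in a..t, l s * u s ≤
        (c + ε) * Real.exp (∫ s in a..t, l s)} ∩ Icc a b) := by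
      have := isClosed_Icc.isClosed_le hcl hcr
      rwa [ofPred_and, inter_comm] at this
    refine hclosed.Icc_subset_of_forall_exists_gt (by simp) ?_
    rintro x ⟨hx, hxI⟩ y hy
    have hxI' : x ∈ Icc a b := Ico_subset_Icc_self hxI
    set F : ℝ → ℝ := fun t => c + ε + ∫ s in a..t, l s * u s with hF
    have hFpos : 0 < F x := by
      have : 0 ≤ ∫ s in a..x, l s * u s := intervalIntegral.integral_nonneg hxI.1 fun s hs =>
        mul_nonneg (hl0 s ⟨hs.1, hs.2.trans hxI'.2⟩) (hu0 s ⟨hs.1, hs.2.trans hxI'.2⟩)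
      simp only [hF]; linarith
    have hux : u x < F x := by have := h x hxI'; simp only [hF]; linarith
    have hnear : ∀ᶠ s in 𝓝[Icc a b] x, u s < F x := (hu x hxI').eventually_lt_const hux
    obtain ⟨η, hη, hball⟩ := Metric.mem_nhdsWithin_iff.1 hnear
    set z := min (x + η / 2) (min y b) with hz
    have hxz : x < z := by
      simp only [hz, lt_min_iff]; exact ⟨by linarith, hy, hxI.2⟩
    have hzb : z ≤ b := (min_le_right _ _).trans (min_le_right _ _)
    have hzI : z ∈ Icc a b := ⟨hxI.1.trans hxz.le, hzb⟩
    refine ⟨z, ?_, hxz, (min_le_right _ _).trans (min_le_left _ _)⟩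
    have i1 : ∫ s in a..z, l s * u s = (∫ s in a..x, l s * u s) + ∫ s in x..z, l s * u s :=
      (intervalIntegral.integral_add_adjacent_intervals (hlu.mono_set (hsub haI hxI'))
        (hlu.mono_set (hsub hxI' hzI))).symm
    have i2 : ∫ s in a..z, l s = (∫ s in a..x, l s) + ∫ s in x..z, l s :=
      (intervalIntegral.integral_add_adjacent_intervals (hl.mono_set (hsub haI hxI'))
        (hl.mono_set (hsub hxI' hzI))).symm
    have i3 : ∫ s in x..z, l s * u s ≤ ∫ s in x..z, l s * F x := by
      refine intervalIntegral.integral_mono_on hxz.le (hlu.mono_set (hsub hxI' hzI))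
        ((hl.mono_set (hsub hxI' hzI)).mul_const _) fun s hs => ?_
      have hsI : s ∈ Icc a b := ⟨hxI.1.trans hs.1, hs.2.trans hzb⟩
      refine mul_le_mul_of_nonneg_left (hball ⟨?_, hsI⟩).le (hl0 s hsI)
      have : s ≤ x + η / 2 := hs.2.trans (min_le_left _ _)
      rw [Metric.mem_ball, Real.dist_eq, abs_of_nonneg (by linarith [hs.1])]
      linarith
    rw [intervalIntegral.integral_mul_const] at i3
    simp only [mem_ofPred_eq] at hx ⊢
    rw [i1, i2, Real.exp_add, ← mul_assoc, ← add_assoc]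
    calc F x + ∫ s in x..z, l s * u s ≤ F x * ((∫ s in x..z, l s) + 1) := by linarith
      _ ≤ F x * Real.exp (∫ s in x..z, l s) :=
          mul_le_mul_of_nonneg_left (Real.add_one_le_exp _) hFpos.le
      _ ≤ _ := mul_le_mul_of_nonneg_right hx (Real.exp_pos _).le
  refine le_of_forall_pos_le_add fun ε hε => ?_
  have hE := Real.exp_pos (∫ s in a..t, l s)
  have h1 := key (ε / Real.exp (∫ s in a..t, l s)) (by positivity) t ht
  have h2 := h t ht
  have h3 : 0 < ε / Real.exp (∫ s in a..t, l s) := by positivity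
  rw [add_mul, div_mul_cancel₀ _ hE.ne'] at h1
  linarith

section
variable {E : Type*} [NormedAddCommGroup E] [NormedSpace ℝ E] [CompleteSpace E]

/-- The fundamental theorem of calculus reduces this to the integral form. The error `e` lets one
estimate serve for uniqueness (`e = 0`), for a priori bounds, and for the remainders in the spatial
derivative of a flow. -/
theorem norm_le_mul_exp_of_norm_deriv_le_left {f f' : ℝ → E} {l : ℝ → ℝ} {a b e : ℝ}
    (hf : ∀ t ∈ Icc a b, HasDerivWithinAt f (f' t) (Icc a b) t)
    (hf' : ContinuousOn f' (Icc a b)) (hl : IntervalIntegrable l volume a b)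
    (hl0 : ∀ t ∈ Icc a b, 0 ≤ l t) (he : 0 ≤ e)
    (h : ∀ t ∈ Icc a b, ‖f' t‖ ≤ l t * ‖f t‖ + e) {t : ℝ} (ht : t ∈ Icc a b) :
    ‖f t‖ ≤ (‖f a‖ + e * (b - a)) * Real.exp (∫ s in a..b, l s) := by
  have hab : a ≤ b := ht.1.trans ht.2
  have hfc : ContinuousOn f (Icc a b) := fun t ht => (hf t ht).continuousWithinAt
  have hc0 : 0 ≤ ‖f a‖ + e * (b - a) := by have := sub_nonneg.2 hab; positivity
  have hint : ∀ t ∈ Icc a b, IntervalIntegrable l volume a t := fun t ht =>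
    hl.mono_set (by rw [uIcc_of_le hab, uIcc_of_le ht.1]; exact Icc_subset_Icc_right ht.2)
  have h1 : ∀ t ∈ Icc a b, ‖f t‖ ≤ ‖f a‖ + e * (b - a) + ∫ s in a..t, l s * ‖f s‖ := by
    intro t ht
    have hst : Icc a t ⊆ Icc a b := Icc_subset_Icc_right ht.2
    have hftc : ∫ s in a..t, f' s = f t - f a := by
      refine intervalIntegral.integral_eq_sub_of_hasDerivAt_of_le ht.1 (hfc.mono hst)
        (fun x hx => (hf x (hst (Ioo_subset_Icc_self hx))).hasDerivAt
          (Icc_mem_nhds hx.1 (hx.2.trans_le ht.2))) ?_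
      exact ContinuousOn.intervalIntegrable (by rw [uIcc_of_le ht.1]; exact hf'.mono hst)
    have hlf : IntervalIntegrable (fun s => l s * ‖f s‖) volume a t :=
      (hint t ht).mul_continuousOn (by rw [uIcc_of_le ht.1]; exact (hfc.mono hst).norm)
    have h2 : ‖∫ s in a..t, f' s‖ ≤ ∫ s in a..t, (l s * ‖f s‖ + e) :=
      intervalIntegral.norm_integral_le_of_norm_le ht.1
        (Eventually.of_forall fun s hs => h s (hst (Ioc_subset_Icc_self hs)))
        (hlf.add intervalIntegrable_const)
    rw [intervalIntegral.integral_add hlf intervalIntegrable_const,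
      intervalIntegral.integral_const, smul_eq_mul, hftc] at h2
    have h3 : ‖f t‖ ≤ ‖f a‖ + ‖f t - f a‖ := by
      simpa using norm_add_le (f a) (f t - f a)
    nlinarith [mul_le_mul_of_nonneg_right (sub_le_sub_right ht.2 a) he]
  refine (le_mul_exp_integral_of_le_add_integral hab hfc.norm (fun t _ => norm_nonneg _) hl hl0
    hc0 h1 ht).trans ?_
  refine mul_le_mul_of_nonneg_left (Real.exp_le_exp.2 ?_) hc0
  refine intervalIntegral.integral_mono_interval le_rfl ht.1 ht.2 ?_ hl
  exact (ae_restrict_iff' measurableSet_Ioc).2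
    (Eventually.of_forall fun s hs => hl0 s (Ioc_subset_Icc_self hs))

/-- **Grönwall's inequality** with an integrable coefficient, in both directions of time. -/
theorem norm_le_mul_exp_of_norm_deriv_le {f f' : ℝ → E} {l : ℝ → ℝ} {a b e : ℝ}
    (hf : ∀ t ∈ Icc a b, HasDerivWithinAt f (f' t) (Icc a b) t)
    (hf' : ContinuousOn f' (Icc a b)) (hl : IntervalIntegrable l volume a b)
    (hl0 : ∀ t ∈ Icc a b, 0 ≤ l t) (he : 0 ≤ e)
    (h : ∀ t ∈ Icc a b, ‖f' t‖ ≤ l t * ‖f t‖ + e) {s t : ℝ} (hs : s ∈ Icc a b)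
    (ht : t ∈ Icc a b) :
    ‖f t‖ ≤ (‖f s‖ + e * (b - a)) * Real.exp (∫ s in a..b, l s) := by
  have hab : a ≤ b := ht.1.trans ht.2
  have aux : ∀ s' t', s' ∈ Icc a b → t' ∈ Icc a b → s' ≤ t' →
      (‖f s'‖ + e * (t' - s')) * Real.exp (∫ s in s'..t', l s) ≤
      (‖f s'‖ + e * (b - a)) * Real.exp (∫ s in a..b, l s) ∧
      (‖f t'‖ + e * (t' - s')) * Real.exp (∫ s in s'..t', l s) ≤
      (‖f t'‖ + e * (b - a)) * Real.exp (∫ s in a..b, l s) := by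
    intro s' t' hs' ht' hst
    have h1 : Real.exp (∫ s in s'..t', l s) ≤ Real.exp (∫ s in a..b, l s) := by
      refine Real.exp_le_exp.2 (intervalIntegral.integral_mono_interval hs'.1 hst ht'.2 ?_ hl)
      exact (ae_restrict_iff' measurableSet_Ioc).2
        (Eventually.of_forall fun s hs => hl0 s (Ioc_subset_Icc_self hs))
    have h2 : e * (t' - s') ≤ e * (b - a) :=
      mul_le_mul_of_nonneg_left (by linarith [hs'.1, ht'.2]) he
    have h3 : 0 ≤ e * (t' - s') := mul_nonneg he (sub_nonneg.2 hst)
    constructor <;> gcongr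
  rcases le_total s t with hst | hst
  · have hsub : Icc s t ⊆ Icc a b := Icc_subset_Icc hs.1 ht.2
    exact (norm_le_mul_exp_of_norm_deriv_le_left (fun x hx => (hf x (hsub hx)).mono hsub)
      (hf'.mono hsub) (hl.mono_set (by rwa [uIcc_of_le hab, uIcc_of_le hst]))
      (fun x hx => hl0 x (hsub hx)) he (fun x hx => h x (hsub hx)) (right_mem_Icc.2 hst)).trans
      (aux s t hs ht hst).1
  · have hsub : Icc t s ⊆ Icc a b := Icc_subset_Icc ht.1 hs.2
    -- Backward in time: the forward estimate is applied to `x ↦ f (-x)` on `[-s, -t]`.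
    have hneg : MapsTo (fun x : ℝ => -x) (Icc (-s) (-t)) (Icc t s) := fun x hx =>
      ⟨by linarith [hx.2], by linarith [hx.1]⟩
    have hl' : IntervalIntegrable l volume s t :=
      (hl.mono_set (by rwa [uIcc_of_le hab, uIcc_of_ge hst]))
    have hl'' : IntervalIntegrable (fun x => l (-x)) volume (-s) (-t) := by
      exact (IntervalIntegrable.iff_comp_neg (by simp)).1 hl'
    have := norm_le_mul_exp_of_norm_deriv_le_left (f := fun x => f (-x)) (f' := fun x => -f' (-x))
      (l := fun x => l (-x)) (a := -s) (b := -t) (e := e) (t := -t)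
      (fun x hx => by
        have h1 := (hf (-x) (hsub (hneg hx))).mono hsub
        have := h1.scomp x (hasDerivAt_neg x).hasDerivWithinAt hneg
        simpa [Function.comp_def] using this)
      ((hf'.mono hsub).comp continuous_neg.continuousOn hneg).neg hl''
      (fun x hx => hl0 _ (hsub (hneg hx))) he
      (fun x hx => by simpa using h _ (hsub (hneg hx))) (right_mem_Icc.2 (by linarith))
    simp only [neg_neg, intervalIntegral.integral_comp_neg] at this
    refine this.trans ?_
    have := (aux t s ht hs hst).2
    rwa [show -t - -s = s - t by ring]
end

/-! ### Global solutions of differential equations with an integrable Lipschitz coefficient -/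

section
variable {E : Type*} [NormedAddCommGroup E] [NormedSpace ℝ E]

/-- The radial retraction of a normed space onto the closed ball of radius `R > 0`. -/
def radialRetraction (R : ℝ) (x : E) : E := (R / max R ‖x‖) • x

theorem norm_radialRetraction_le_norm {R : ℝ} (hR : 0 < R) (x : E) :
    ‖radialRetraction R x‖ ≤ ‖x‖ := by
  have hm : 0 < max R ‖x‖ := hR.trans_le (le_max_left _ _)
  rw [radialRetraction, norm_smul, Real.norm_of_nonneg (by positivity)]
  exact mul_le_of_le_one_left (norm_nonneg _) ((div_le_one hm).2 (le_max_left _ _))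

theorem norm_radialRetraction_le {R : ℝ} (hR : 0 < R) (x : E) : ‖radialRetraction R x‖ ≤ R := by
  have hm : 0 < max R ‖x‖ := hR.trans_le (le_max_left _ _)
  rw [radialRetraction, norm_smul, Real.norm_of_nonneg (by positivity), div_mul_eq_mul_div,
    div_le_iff₀ hm]
  exact mul_le_mul_of_nonneg_left (le_max_right _ _) hR.le

theorem radialRetraction_eq_self {R : ℝ} (hR : 0 < R) {x : E} (hx : ‖x‖ ≤ R) :
    radialRetraction R x = x := by
  rw [radialRetraction, max_eq_left hx, div_self hR.ne', one_smul]

/-- The difference splits into a displacement of the point and a change of the scaling factor, each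
at most `‖x - y‖`. No inner product is available here, since `E` will also be a space of operators
with the operator norm. -/
theorem lipschitzWith_radialRetraction {R : ℝ} (hR : 0 < R) :
    LipschitzWith 2 (radialRetraction R : E → E) := by
  refine LipschitzWith.of_dist_le_mul fun x y => ?_
  have hx : 0 < max R ‖x‖ := hR.trans_le (le_max_left _ _)
  have hy : 0 < max R ‖y‖ := hR.trans_le (le_max_left _ _)
  rw [dist_eq_norm, dist_eq_norm, show radialRetraction R x - radialRetraction R y =
    (R / max R ‖x‖) • (x - y) + (R / max R ‖x‖ - R / max R ‖y‖) • y by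
      simp only [radialRetraction]; module]
  have h1 : ‖(R / max R ‖x‖) • (x - y)‖ ≤ ‖x - y‖ := by
    rw [norm_smul, Real.norm_of_nonneg (by positivity)]
    exact mul_le_of_le_one_left (norm_nonneg _) ((div_le_one hx).2 (le_max_left _ _))
  have h2 : ‖(R / max R ‖x‖ - R / max R ‖y‖) • y‖ ≤ ‖x - y‖ := by
    have e : R / max R ‖x‖ - R / max R ‖y‖ =
        R / max R ‖x‖ * ((max R ‖y‖ - max R ‖x‖) / max R ‖y‖) := by
      field_simp
    rw [e, norm_smul, norm_mul, Real.norm_of_nonneg (by positivity : 0 ≤ R / max R ‖x‖), norm_div,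
      Real.norm_of_nonneg hy.le, mul_assoc]
    have h3 : ‖max R ‖y‖ - max R ‖x‖‖ ≤ ‖x - y‖ := by
      refine (abs_max_sub_max_le_max _ _ _ _).trans ?_
      rw [sub_self, abs_zero, max_eq_right (abs_nonneg _), norm_sub_rev]
      exact abs_norm_sub_norm_le _ _
    have h4 : ‖max R ‖y‖ - max R ‖x‖‖ / max R ‖y‖ * ‖y‖ ≤ ‖x - y‖ := by
      rw [div_mul_eq_mul_div, div_le_iff₀ hy]
      exact mul_le_mul h3 (le_max_right _ _) (norm_nonneg _) (norm_nonneg _)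
    exact (mul_le_of_le_one_left (by positivity) ((div_le_one hx).2 (le_max_left _ _))).trans h4
  refine (norm_add_le _ _).trans ?_
  push_cast
  linarith

/-- A time-dependent vector field on `E`, continuous on `[a, b] × E`, whose spatial derivative `A`
is continuous there and bounded at each time `t` by `l t`, with `l` integrable on `[a, b]`. -/
structure IsC1Field (a b : ℝ) (v : ℝ → E → E) (A : ℝ → E → E →L[ℝ] E) (l : ℝ → ℝ) : Prop where
  continuousOn : ContinuousOn (Function.uncurry v) (Icc a b ×ˢ univ)
  hasFDerivAt : ∀ t ∈ Icc a b, ∀ x, HasFDerivAt (v t) (A t x) x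
  continuousOn_deriv : ContinuousOn (Function.uncurry A) (Icc a b ×ˢ univ)
  norm_deriv_le : ∀ t ∈ Icc a b, ∀ x, ‖A t x‖ ≤ l t
  integrable : IntervalIntegrable l volume a b

namespace IsC1Field
variable {a b : ℝ} {v : ℝ → E → E} {A : ℝ → E → E →L[ℝ] E} {l : ℝ → ℝ}

theorem coeff_nonneg (h : IsC1Field a b v A l) : ∀ t ∈ Icc a b, 0 ≤ l t := fun t ht =>
  (norm_nonneg _).trans (h.norm_deriv_le t ht 0)

theorem norm_sub_le (h : IsC1Field a b v A l) {t : ℝ} (ht : t ∈ Icc a b) (x y : E) :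
    ‖v t x - v t y‖ ≤ l t * ‖x - y‖ :=
  convex_univ.norm_image_sub_le_of_norm_hasFDerivWithin_le
    (fun z _ => (h.hasFDerivAt t ht z).hasFDerivWithinAt) (fun z _ => h.norm_deriv_le t ht z)
    (mem_univ y) (mem_univ x)

theorem continuousOn_comp (h : IsC1Field a b v A l) {γ : ℝ → E} (hγ : ContinuousOn γ (Icc a b)) :
    ContinuousOn (fun t => v t (γ t)) (Icc a b) :=
  h.continuousOn.comp (continuousOn_id.prodMk hγ) fun _ ht => ⟨ht, mem_univ _⟩

theorem continuousOn_deriv_comp (h : IsC1Field a b v A l) {γ : ℝ → E}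
    (hγ : ContinuousOn γ (Icc a b)) : ContinuousOn (fun t => A t (γ t)) (Icc a b) :=
  h.continuousOn_deriv.comp (continuousOn_id.prodMk hγ) fun _ ht => ⟨ht, mem_univ _⟩

theorem norm_sub_le_of_isIntegralCurveOn [CompleteSpace E] (h : IsC1Field a b v A l)
    {γ₁ γ₂ : ℝ → E} (h₁ : IsIntegralCurveOn γ₁ v (Icc a b)) (h₂ : IsIntegralCurveOn γ₂ v (Icc a b))
    {s t : ℝ} (hs : s ∈ Icc a b) (ht : t ∈ Icc a b) :
    ‖γ₁ t - γ₂ t‖ ≤ Real.exp (∫ s in a..b, l s) * ‖γ₁ s - γ₂ s‖ := by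
  have := norm_le_mul_exp_of_norm_deriv_le (f := fun t => γ₁ t - γ₂ t)
    (f' := fun t => v t (γ₁ t) - v t (γ₂ t)) (e := 0) (fun t ht => (h₁ t ht).sub (h₂ t ht))
    ((h.continuousOn_comp h₁.continuousOn).sub (h.continuousOn_comp h₂.continuousOn))
    h.integrable h.coeff_nonneg le_rfl (fun t ht => by simpa using h.norm_sub_le ht _ _) hs ht
  rw [mul_comm]
  simpa using this

/-- Composed with the retraction onto a large ball, the field becomes bounded and globally Lipschitz
uniformly in time, by compactness and even if `l` is unbounded, so Picard–Lindelöf works on all of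
`[a, b]`. The truncated field still satisfies `‖v t (r y)‖ ≤ l t * ‖y‖ + C`, so Grönwall keeps its
solution inside the ball, where truncation changes nothing. -/
theorem exists_isIntegralCurveOn [FiniteDimensional ℝ E] (h : IsC1Field a b v A l) {t₀ : ℝ}
    (ht₀ : t₀ ∈ Icc a b) (x : E) : ∃ γ : ℝ → E, γ t₀ = x ∧ IsIntegralCurveOn γ v (Icc a b) := by
  have : CompleteSpace E := FiniteDimensional.complete ℝ E
  have : ProperSpace E := FiniteDimensional.proper ℝ E
  have hab : a ≤ b := ht₀.1.trans ht₀.2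
  obtain ⟨C, hC⟩ := isCompact_Icc.exists_bound_of_continuousOn
    (h.continuousOn_comp (continuousOn_const (c := (0 : E))))
  have hC0 : 0 ≤ C := (norm_nonneg _).trans (hC t₀ ht₀)
  -- `B` is the Grönwall bound for any solution starting at `x`; it does not depend on the
  -- truncation radius `R` and can be fixed beforehand.
  set B : ℝ := (‖x‖ + C * (b - a)) * Real.exp (∫ s in a..b, l s) with hB
  have hB0 : 0 ≤ B := by have := sub_nonneg.2 hab; positivity
  set R : ℝ := B + 1 with hR
  have hR0 : 0 < R := by linarith
  have hK : IsCompact (Icc a b ×ˢ Metric.closedBall (0 : E) R) :=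
    isCompact_Icc.prod (isCompact_closedBall _ _)
  have hKs : Icc a b ×ˢ Metric.closedBall (0 : E) R ⊆ Icc a b ×ˢ univ :=
    prod_mono_right (subset_univ _)
  obtain ⟨V, hV⟩ := hK.exists_bound_of_continuousOn (h.continuousOn.mono hKs)
  obtain ⟨D, hD⟩ := hK.exists_bound_of_continuousOn (h.continuousOn_deriv.mono hKs)
  have hr : ∀ y : E, radialRetraction R y ∈ Metric.closedBall (0 : E) R := fun y => by
    simpa using norm_radialRetraction_le hR0 y
  have hpl : IsPicardLindelof (fun t y => v t (radialRetraction R y)) (⟨t₀, ht₀⟩ : Icc a b) x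
      (V.toNNReal * (b - a).toNNReal) 0 V.toNNReal (D.toNNReal * 2) := by
    refine ⟨fun t ht => LipschitzWith.lipschitzOnWith ?_, fun y _ => ?_, fun t ht y _ => ?_, ?_⟩
    · have h1 : LipschitzOnWith D.toNNReal (v t) (Metric.closedBall (0 : E) R) :=
        (convex_closedBall _ _).lipschitzOnWith_of_nnnorm_hasFDerivWithin_le
          (fun z _ => (h.hasFDerivAt t ht z).hasFDerivWithinAt) fun z hz =>
          (Real.le_toNNReal_iff_coe_le ((norm_nonneg _).trans (hD (t, z) ⟨ht, hz⟩))).2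
            (hD (t, z) ⟨ht, hz⟩)
      have := h1.comp ((lipschitzWith_radialRetraction (E := E) hR0).lipschitzOnWith
        (s := univ)) fun y _ => hr y
      exact lipschitzOnWith_univ.1 this
    · exact h.continuousOn_comp continuousOn_const
    · rw [Real.coe_toNNReal']
      exact (hV (t, radialRetraction R y) ⟨ht, hr y⟩).trans (le_max_left _ _)
    · rw [NNReal.coe_mul, NNReal.coe_zero, sub_zero, Real.coe_toNNReal (b - a) (sub_nonneg.2 hab)]
      refine mul_le_mul_of_nonneg_left (max_le ?_ ?_) (NNReal.coe_nonneg _)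
      · exact sub_le_sub_left ht₀.1 b
      · exact sub_le_sub_right ht₀.2 a
  obtain ⟨γ, hγ0, hγ⟩ := hpl.exists_eq_forall_mem_Icc_hasDerivWithinAt₀
  have hγc : ContinuousOn γ (Icc a b) := fun t ht => (hγ t ht).continuousWithinAt
  have hbound : ∀ t ∈ Icc a b, ‖γ t‖ ≤ R := by
    intro t ht
    have := norm_le_mul_exp_of_norm_deriv_le (e := C) hγ
      (h.continuousOn_comp ((lipschitzWith_radialRetraction hR0).continuous.comp_continuousOn hγc))
      h.integrable h.coeff_nonneg hC0 (fun t ht => by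
        have h1 := h.norm_sub_le ht (radialRetraction R (γ t)) 0
        rw [sub_zero] at h1
        have h2 := norm_sub_norm_le (v t (radialRetraction R (γ t))) (v t 0)
        have h3 := mul_le_mul_of_nonneg_left (norm_radialRetraction_le_norm hR0 (γ t))
          (h.coeff_nonneg t ht)
        linarith [hC t ht]) ht₀ ht
    simp only [hγ0] at this
    linarith
  refine ⟨γ, hγ0, fun t ht => ?_⟩
  have := hγ t ht
  rwa [radialRetraction_eq_self hR0 (hbound t ht)] at this

end IsC1Field

end

/-! ### The flow, its variational equation and its smoothness -/

section
variable {E : Type*} [NormedAddCommGroup E] [NormedSpace ℝ E]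
namespace IsC1Field
variable {a b : ℝ} {v : ℝ → E → E} {A : ℝ → E → E →L[ℝ] E} {l : ℝ → ℝ}

/-- The linearization of a vector field along a curve, acting on operators by composition. -/
theorem linearization (h : IsC1Field a b v A l) {γ : ℝ → E} (hγ : ContinuousOn γ (Icc a b)) :
    IsC1Field a b (fun t J => (A t (γ t)).comp J)
      (fun t _ => ContinuousLinearMap.compL ℝ E E E (A t (γ t))) l where
  continuousOn := by
    have h1 : ContinuousOn (fun p : ℝ × (E →L[ℝ] E) => A p.1 (γ p.1)) (Icc a b ×ˢ univ) :=
      (h.continuousOn_deriv_comp hγ).comp continuousOn_fst fun p hp => hp.1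
    exact h1.clm_comp continuousOn_snd
  hasFDerivAt t ht J := (ContinuousLinearMap.compL ℝ E E E (A t (γ t))).hasFDerivAt
  continuousOn_deriv :=
    (ContinuousLinearMap.compL ℝ E E E).continuous.comp_continuousOn
      ((h.continuousOn_deriv_comp hγ).comp continuousOn_fst fun p hp => hp.1)
  norm_deriv_le t ht J := by
    refine (ContinuousLinearMap.opNorm_le_bound _ (norm_nonneg (A t (γ t))) fun J => ?_).trans
      (h.norm_deriv_le t ht (γ t))
    exact ContinuousLinearMap.opNorm_comp_le _ _
  integrable := h.integrable

/-- Uniform continuity of `A` on a compact neighbourhood of the curve: a ball of radius `R + 1`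
contains every `y` within distance `1` of it. -/
theorem eventually_norm_deriv_sub_le [FiniteDimensional ℝ E] (h : IsC1Field a b v A l)
    {γ : ℝ → E} (hγ : ContinuousOn γ (Icc a b)) {ε : ℝ} (hε : 0 < ε) :
    ∃ η > 0, ∀ t ∈ Icc a b, ∀ y, ‖y - γ t‖ ≤ η → ‖A t y - A t (γ t)‖ ≤ ε := by
  have : ProperSpace E := FiniteDimensional.proper ℝ E
  obtain ⟨R, hR⟩ := isCompact_Icc.exists_bound_of_continuousOn hγ
  have hK : IsCompact (Icc a b ×ˢ Metric.closedBall (0 : E) (R + 1)) :=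
    isCompact_Icc.prod (isCompact_closedBall _ _)
  have hu := hK.uniformContinuousOn_of_continuous
    (h.continuousOn_deriv.mono (prod_mono_right (subset_univ _)))
  obtain ⟨η, hη, hη'⟩ := Metric.uniformContinuousOn_iff_le.1 hu ε hε
  refine ⟨min η 1, lt_min hη one_pos, fun t ht y hy => ?_⟩
  have := hη' (t, y) ⟨ht, ?_⟩ (t, γ t) ⟨ht, ?_⟩ ?_
  · simpa [dist_eq_norm] using this
  · rw [mem_closedBall_zero_iff]
    have h1 := hy.trans (min_le_right _ _)
    have h2 := norm_sub_norm_le y (γ t)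
    linarith [hR t ht]
  · rw [mem_closedBall_zero_iff]; linarith [hR t ht]
  · simpa [Prod.dist_eq, dist_eq_norm, hη.le] using hy.trans (min_le_left _ _)

/-- The flow of a `C¹` vector field, together with the solution `J` of the variational equation,
which is the spatial derivative of the flow. -/
structure IsFlowOn (a b t₀ : ℝ) (v : ℝ → E → E) (A : ℝ → E → E →L[ℝ] E)
    (Φ : ℝ → E → E) (J : ℝ → E → E →L[ℝ] E) : Prop where
  initial : ∀ x, Φ t₀ x = x
  isIntegralCurveOn : ∀ x, IsIntegralCurveOn (fun t => Φ t x) v (Icc a b)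
  initial_deriv : ∀ x, J t₀ x = ContinuousLinearMap.id ℝ E
  isIntegralCurveOn_deriv : ∀ x,
    IsIntegralCurveOn (fun t => J t x) (fun t J => (A t (Φ t x)).comp J) (Icc a b)

theorem exists_isFlowOn [FiniteDimensional ℝ E] (h : IsC1Field a b v A l) {t₀ : ℝ}
    (ht₀ : t₀ ∈ Icc a b) : ∃ Φ J, IsFlowOn a b t₀ v A Φ J := by
  choose Φ hΦ0 hΦ using h.exists_isIntegralCurveOn ht₀
  choose J hJ0 hJ using fun x => (h.linearization (hΦ x).continuousOn).exists_isIntegralCurveOn ht₀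
    (ContinuousLinearMap.id ℝ E)
  exact ⟨fun t x => Φ x t, fun t x => J x t, hΦ0, hΦ, hJ0, hJ⟩

namespace IsFlowOn
variable {t₀ : ℝ} {Φ : ℝ → E → E} {J : ℝ → E → E →L[ℝ] E} [FiniteDimensional ℝ E]

theorem norm_sub_le (hΦ : IsFlowOn a b t₀ v A Φ J) (h : IsC1Field a b v A l)
    (ht₀ : t₀ ∈ Icc a b) {t : ℝ} (ht : t ∈ Icc a b) (x y : E) :
    ‖Φ t x - Φ t y‖ ≤ Real.exp (∫ s in a..b, l s) * ‖x - y‖ := by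
  have : CompleteSpace E := FiniteDimensional.complete ℝ E
  simpa [hΦ.initial] using
    h.norm_sub_le_of_isIntegralCurveOn (hΦ.isIntegralCurveOn x) (hΦ.isIntegralCurveOn y) ht₀ ht

theorem norm_deriv_le (hΦ : IsFlowOn a b t₀ v A Φ J) (h : IsC1Field a b v A l)
    (ht₀ : t₀ ∈ Icc a b) {t : ℝ} (ht : t ∈ Icc a b) (x : E) :
    ‖J t x‖ ≤ Real.exp (∫ s in a..b, l s) * ‖ContinuousLinearMap.id ℝ E‖ := by
  have : CompleteSpace E := FiniteDimensional.complete ℝ E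
  have h0 : IsIntegralCurveOn (fun _ => (0 : E →L[ℝ] E)) (fun t J => (A t (Φ t x)).comp J)
      (Icc a b) := fun t _ => by
    simpa using hasDerivWithinAt_const t (Icc a b) (0 : E →L[ℝ] E)
  simpa [hΦ.initial_deriv] using
    (h.linearization (hΦ.isIntegralCurveOn x).continuousOn).norm_sub_le_of_isIntegralCurveOn
      (hΦ.isIntegralCurveOn_deriv x) h0 ht₀ ht

/-- The error `Φ t y - Φ t x - J t x (y - x)` vanishes at `t₀` and solves the linearized equation up
to a remainder of size `ε * K * ‖y - x‖`, so Grönwall makes it `o(‖y - x‖)`. -/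
theorem hasFDerivAt (hΦ : IsFlowOn a b t₀ v A Φ J) (h : IsC1Field a b v A l)
    (ht₀ : t₀ ∈ Icc a b) {t : ℝ} (ht : t ∈ Icc a b) (x : E) : HasFDerivAt (Φ t) (J t x) x := by
  have : CompleteSpace E := FiniteDimensional.complete ℝ E
  have hab : a ≤ b := ht₀.1.trans ht₀.2
  set K := Real.exp (∫ s in a..b, l s) with hK
  have hK0 : 0 < K := Real.exp_pos _
  have hxc := (hΦ.isIntegralCurveOn x).continuousOn
  rw [hasFDerivAt_iff_isLittleO, Asymptotics.isLittleO_iff]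
  intro c hc
  -- Grönwall will multiply `ε` by `K * (b - a) * K`; the added `1` keeps the denominator of `ε`
  -- positive when `a = b`.
  have hden : 0 < K * (b - a) * K + 1 := by have := sub_nonneg.2 hab; positivity
  obtain ⟨η, hη, hA⟩ := h.eventually_norm_deriv_sub_le hxc
    (div_pos hc hden)
  set ε := c / (K * (b - a) * K + 1) with hε
  have hε0 : 0 ≤ ε := (div_pos hc hden).le
  filter_upwards [Metric.closedBall_mem_nhds x (div_pos hη hK0)] with y hy
  rw [mem_closedBall_iff_norm] at hy
  have hKy : K * ‖y - x‖ ≤ η := by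
    calc K * ‖y - x‖ ≤ K * (η / K) := mul_le_mul_of_nonneg_left hy hK0.le
      _ = η := mul_div_cancel₀ _ hK0.ne'
  have hyc := (hΦ.isIntegralCurveOn y).continuousOn
  have hJc := (hΦ.isIntegralCurveOn_deriv x).continuousOn
  have := norm_le_mul_exp_of_norm_deriv_le (f := fun t => Φ t y - Φ t x - J t x (y - x))
    (f' := fun t => v t (Φ t y) - v t (Φ t x) - ((A t (Φ t x)).comp (J t x)) (y - x))
    (e := ε * (K * ‖y - x‖)) (l := l)
    (fun t ht => ((hΦ.isIntegralCurveOn y t ht).sub (hΦ.isIntegralCurveOn x t ht)).sub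
      ((ContinuousLinearMap.apply ℝ E (y - x)).hasFDerivAt.comp_hasDerivWithinAt t
        (hΦ.isIntegralCurveOn_deriv x t ht)))
    (((h.continuousOn_comp hyc).sub (h.continuousOn_comp hxc)).sub
      (((h.continuousOn_deriv_comp hxc).clm_comp hJc).clm_apply continuousOn_const))
    h.integrable h.coeff_nonneg (by positivity)
    (fun t ht => by
      have hd := hΦ.norm_sub_le h ht₀ ht y x
      have h1 : ‖v t (Φ t y) - v t (Φ t x) - A t (Φ t x) (Φ t y - Φ t x)‖ ≤
          ε * ‖Φ t y - Φ t x‖ := by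
        refine (convex_closedBall (Φ t x) η).norm_image_sub_le_of_norm_hasFDerivWithin_le'
          (fun z _ => (h.hasFDerivAt t ht z).hasFDerivWithinAt)
          (fun z hz => hA t ht z (mem_closedBall_iff_norm.1 hz))
          (Metric.mem_closedBall_self hη.le) (mem_closedBall_iff_norm.2 (hd.trans hKy))
      have h2 : v t (Φ t y) - v t (Φ t x) - ((A t (Φ t x)).comp (J t x)) (y - x) =
          A t (Φ t x) (Φ t y - Φ t x - J t x (y - x)) +
          (v t (Φ t y) - v t (Φ t x) - A t (Φ t x) (Φ t y - Φ t x)) := by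
        simp only [ContinuousLinearMap.comp_apply, map_sub]; abel
      rw [h2]
      refine (norm_add_le _ _).trans (add_le_add ?_ ?_)
      · exact ((A t (Φ t x)).le_opNorm _).trans
          (mul_le_mul_of_nonneg_right (h.norm_deriv_le t ht _) (norm_nonneg _))
      · exact h1.trans (mul_le_mul_of_nonneg_left hd hε0)) ht₀ ht
  simp only [hΦ.initial, hΦ.initial_deriv, ContinuousLinearMap.id_apply, sub_self, norm_zero,
    zero_add] at this
  refine this.trans ?_
  have h3 : ε * (K * (b - a) * K) ≤ c := by
    rw [hε, div_mul_eq_mul_div, div_le_iff₀ hden]; nlinarith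
  calc ε * (K * ‖y - x‖) * (b - a) * K = ε * (K * (b - a) * K) * ‖y - x‖ := by ring
    _ ≤ c * ‖y - x‖ := mul_le_mul_of_nonneg_right h3 (norm_nonneg _)

/-- `J t y - J t x` vanishes at `t₀` and solves the linearized equation along the curve from `x`,
with forcing `(A t (Φ t y) - A t (Φ t x)) ∘ J t y`, which is uniformly small for `y` near `x`. -/
theorem continuous_deriv (hΦ : IsFlowOn a b t₀ v A Φ J) (h : IsC1Field a b v A l)
    (ht₀ : t₀ ∈ Icc a b) {t : ℝ} (ht : t ∈ Icc a b) : Continuous (J t) := by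
  have : CompleteSpace E := FiniteDimensional.complete ℝ E
  have hab : a ≤ b := ht₀.1.trans ht₀.2
  set K := Real.exp (∫ s in a..b, l s) with hK
  have hK0 : 0 < K := Real.exp_pos _
  set I := ‖ContinuousLinearMap.id ℝ E‖ with hI
  refine continuous_iff_continuousAt.2 fun x => Metric.continuousAt_iff'.2 fun c hc => ?_
  have hxc := (hΦ.isIntegralCurveOn x).continuousOn
  have hden : 0 < K * I * (b - a) * K + 1 := by have := sub_nonneg.2 hab; positivity
  obtain ⟨η, hη, hA⟩ := h.eventually_norm_deriv_sub_le hxc (div_pos hc hden)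
  set ε := c / (K * I * (b - a) * K + 1) with hε
  have hε0 : 0 ≤ ε := (div_pos hc hden).le
  filter_upwards [Metric.closedBall_mem_nhds x (div_pos hη hK0)] with y hy
  rw [mem_closedBall_iff_norm] at hy
  have hKy : K * ‖y - x‖ ≤ η := by
    calc K * ‖y - x‖ ≤ K * (η / K) := mul_le_mul_of_nonneg_left hy hK0.le
      _ = η := mul_div_cancel₀ _ hK0.ne'
  have hyc := (hΦ.isIntegralCurveOn y).continuousOn
  have := norm_le_mul_exp_of_norm_deriv_le (f := fun t => J t y - J t x)
    (f' := fun t => (A t (Φ t y)).comp (J t y) - (A t (Φ t x)).comp (J t x))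
    (e := ε * (K * I)) (l := l)
    (fun t ht => (hΦ.isIntegralCurveOn_deriv y t ht).sub (hΦ.isIntegralCurveOn_deriv x t ht))
    (((h.continuousOn_deriv_comp hyc).clm_comp (hΦ.isIntegralCurveOn_deriv y).continuousOn).sub
      ((h.continuousOn_deriv_comp hxc).clm_comp (hΦ.isIntegralCurveOn_deriv x).continuousOn))
    h.integrable h.coeff_nonneg (by positivity)
    (fun t ht => by
      have hd := hΦ.norm_sub_le h ht₀ ht y x
      have h2 : (A t (Φ t y)).comp (J t y) - (A t (Φ t x)).comp (J t x) =
          (A t (Φ t x)).comp (J t y - J t x) + (A t (Φ t y) - A t (Φ t x)).comp (J t y) := by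
        simp only [ContinuousLinearMap.comp_sub, ContinuousLinearMap.sub_comp]; abel
      rw [h2]
      refine (norm_add_le _ _).trans (add_le_add ?_ ?_)
      · exact (ContinuousLinearMap.opNorm_comp_le _ _).trans
          (mul_le_mul_of_nonneg_right (h.norm_deriv_le t ht _) (norm_nonneg _))
      · exact (ContinuousLinearMap.opNorm_comp_le _ _).trans
          (mul_le_mul (hA t ht _ (hd.trans hKy)) (hΦ.norm_deriv_le h ht₀ ht y) (norm_nonneg _)
            hε0)) ht₀ ht
  simp only [hΦ.initial_deriv, sub_self, norm_zero, zero_add] at this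
  rw [dist_eq_norm]
  refine this.trans_lt ?_
  have h3 : ε * (K * I * (b - a) * K) < c := by
    rw [hε, div_mul_eq_mul_div, div_lt_iff₀ hden]; nlinarith
  calc ε * (K * I) * (b - a) * K = ε * (K * I * (b - a) * K) := by ring
    _ < c := h3

theorem contDiff (hΦ : IsFlowOn a b t₀ v A Φ J) (h : IsC1Field a b v A l)
    (ht₀ : t₀ ∈ Icc a b) {t : ℝ} (ht : t ∈ Icc a b) : ContDiff ℝ 1 (Φ t) :=
  contDiff_one_iff_hasFDerivAt.2
    ⟨J t, hΦ.continuous_deriv h ht₀ ht, hΦ.hasFDerivAt h ht₀ ht⟩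

theorem lipschitzWith (hΦ : IsFlowOn a b t₀ v A Φ J) (h : IsC1Field a b v A l)
    (ht₀ : t₀ ∈ Icc a b) {t : ℝ} (ht : t ∈ Icc a b) :
    LipschitzWith (Real.exp (∫ s in a..b, l s)).toNNReal (Φ t) :=
  LipschitzWith.of_dist_le_mul fun x y => by
    rw [Real.coe_toNNReal _ (Real.exp_pos _).le, dist_eq_norm, dist_eq_norm]
    exact hΦ.norm_sub_le h ht₀ ht x y

/-- The curves through `Φ t₁ x` at time `t₁` given by the two flows coincide by uniqueness. The
inverse of a flow map is thus a flow map started at the other endpoint, and inherits its regularity.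
-/
theorem leftInverse (hΦ : IsFlowOn a b t₀ v A Φ J) {t₁ : ℝ} {Ψ : ℝ → E → E}
    {J' : ℝ → E → E →L[ℝ] E} (hΨ : IsFlowOn a b t₁ v A Ψ J') (h : IsC1Field a b v A l)
    (ht₀ : t₀ ∈ Icc a b) (ht₁ : t₁ ∈ Icc a b) : Function.LeftInverse (Ψ t₀) (Φ t₁) := fun x => by
  have : CompleteSpace E := FiniteDimensional.complete ℝ E
  have := h.norm_sub_le_of_isIntegralCurveOn (hΨ.isIntegralCurveOn (Φ t₁ x))
    (hΦ.isIntegralCurveOn x) ht₁ ht₀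
  rw [hΨ.initial, hΦ.initial, sub_self, norm_zero, mul_zero, norm_le_zero_iff, sub_eq_zero] at this
  exact this

end IsFlowOn
end IsC1Field

end

/-! ### Liouville's formula for the Jacobian determinant -/

section
variable {E : Type*} [NormedAddCommGroup E] [NormedSpace ℝ E] [FiniteDimensional ℝ E]

theorem differentiable_det : Differentiable ℝ (ContinuousLinearMap.det : (E →L[ℝ] E) → ℝ) := by
  have hb := Module.finBasis ℝ E
  have : (ContinuousLinearMap.det : (E →L[ℝ] E) → ℝ) = fun f =>
      ∑ σ : Equiv.Perm (Fin (Module.finrank ℝ E)), ((Equiv.Perm.sign σ : ℤ) : ℝ) *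
        ∏ i, hb.repr (f (hb i)) (σ i) := by
    ext f
    rw [ContinuousLinearMap.det, ← LinearMap.det_toMatrix hb, Matrix.det_apply']
    simp [LinearMap.toMatrix_apply]
  rw [this]
  have hd : ∀ i j, ContDiff ℝ 1 fun f : E →L[ℝ] E => hb.repr (f (hb i)) j := fun i j =>
    ((LinearMap.toContinuousLinearMap (hb.coord j)).comp
      (ContinuousLinearMap.apply ℝ E (hb i))).contDiff
  refine Differentiable.fun_sum fun σ _ => (differentiable_const _).mul ?_
  exact (contDiff_prod fun i _ => hd i (σ i)).differentiable one_ne_zero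

/-- `det (1 + r M)` is a polynomial in `r` with constant term `1` and linear coefficient `tr M`; the
rest is divisible by `r ^ 2`. -/
theorem hasDerivAt_det_id_add_smul (B : E →L[ℝ] E) :
    HasDerivAt (fun r : ℝ => (ContinuousLinearMap.id ℝ E + r • B).det)
      (LinearMap.trace ℝ E B) 0 := by
  have hb := Module.finBasis ℝ E
  set M := LinearMap.toMatrix hb hb (B : E →ₗ[ℝ] E) with hM
  set q : Polynomial ℝ :=
    (Matrix.det (1 + (Polynomial.X : Polynomial ℝ) • M.map Polynomial.C)).divX.divX with hq
  have : (fun r : ℝ => (ContinuousLinearMap.id ℝ E + r • B).det) =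
      fun r => 1 + M.trace * r + q.eval r * r ^ 2 := by
    ext r
    rw [ContinuousLinearMap.det, ← LinearMap.det_toMatrix hb, ← Matrix.det_one_add_smul]
    simp [hM]
  rw [this, LinearMap.trace_eq_matrix_trace ℝ hb, ← hM]
  have h1 := (((hasDerivAt_id (0 : ℝ)).const_mul M.trace).const_add 1).add
    ((q.hasDerivAt 0).mul ((hasDerivAt_id (0 : ℝ)).pow 2))
  refine (h1.congr_deriv ?_).congr_of_eventuallyEq (Eventually.of_forall fun r => ?_) <;> simp

/-- **Liouville's formula**: the determinant of a solution of `J' = B J` has logarithmic derivative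
`tr B`. -/
theorem hasDerivWithinAt_det {J : ℝ → E →L[ℝ] E} {B : E →L[ℝ] E} {s : Set ℝ} {t : ℝ}
    (hJ : HasDerivWithinAt J (B.comp (J t)) s t) :
    HasDerivWithinAt (fun t => (J t).det) (LinearMap.trace ℝ E B * (J t).det) s t := by
  have hD := (differentiable_det (E := E) (J t)).hasFDerivAt
  refine (hD.comp_hasDerivWithinAt t hJ).congr_deriv ?_
  -- The derivative of `det` at `J t` in the direction `B ∘ J t` is computed along the line `J t + r
  -- • B ∘ J t = (1 + r B) ∘ J t`. Multiplicativity of the determinant reduces it to the identity,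
  -- without invertibility of `J t`.
  have hc : HasDerivAt (fun r : ℝ => J t + r • B.comp (J t)) (B.comp (J t)) 0 := by
    simpa using ((hasDerivAt_id (0 : ℝ)).smul_const (B.comp (J t))).const_add (J t)
  have h2 : HasDerivAt (fun r : ℝ => (J t + r • B.comp (J t)).det)
      (fderiv ℝ ContinuousLinearMap.det (J t) (B.comp (J t))) 0 := by
    have hD' : HasFDerivAt (ContinuousLinearMap.det : (E →L[ℝ] E) → ℝ)
        (fderiv ℝ ContinuousLinearMap.det (J t)) (J t + (0 : ℝ) • B.comp (J t)) := by simpa using hD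
    exact hD'.comp_hasDerivAt (0 : ℝ) hc
  have h3 : (fun r : ℝ => (J t + r • B.comp (J t)).det) =
      fun r => (ContinuousLinearMap.id ℝ E + r • B).det * (J t).det := by
    ext r
    simp only [ContinuousLinearMap.det]
    rw [← LinearMap.det_comp]
    congr 1
  rw [h3] at h2
  exact h2.unique ((hasDerivAt_det_id_add_smul B).mul_const _)
end

/-! ### Exponential moments of a density -/

section
variable {E : Type*} [NormedAddCommGroup E] [InnerProductSpace ℝ E]
  {F : Type*} [NormedAddCommGroup F] [NormedSpace ℝ F]

/-- A continuous function of at most polynomial growth. -/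
structure HasPolynomialGrowth (G : E → F) : Prop where
  continuous : Continuous G
  exists_bound : ∃ (C : ℝ) (k : ℕ), ∀ y, ‖G y‖ ≤ C * (1 + ‖y‖) ^ k

/-- The linear form `(α, ξ) ↦ -α ‖y‖² + ⟪ξ, y⟫`. -/
def quadForm (y : E) : ℝ × E →L[ℝ] ℝ :=
  (-‖y‖ ^ 2) • ContinuousLinearMap.fst ℝ ℝ E +
    (innerSL ℝ y).comp (ContinuousLinearMap.snd ℝ ℝ E)

theorem quadForm_apply (y : E) (θ : ℝ × E) : quadForm y θ = -θ.1 * ‖y‖ ^ 2 + ⟪θ.2, y⟫ := by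
  simp [quadForm, real_inner_comm]; ring

theorem norm_quadForm_le (y : E) : ‖quadForm y‖ ≤ (1 + ‖y‖) ^ 2 := by
  refine ContinuousLinearMap.opNorm_le_bound _ (by positivity) fun θ => ?_
  rw [quadForm_apply]
  have h1 : |⟪θ.2, y⟫| ≤ ‖θ.2‖ * ‖y‖ := abs_real_inner_le_norm _ _
  have h2 : |θ.1| ≤ ‖θ‖ := norm_fst_le θ
  have h3 : ‖θ.2‖ ≤ ‖θ‖ := norm_snd_le θ
  have hy := norm_nonneg y
  calc ‖-θ.1 * ‖y‖ ^ 2 + ⟪θ.2, y⟫‖ ≤ |θ.1| * ‖y‖ ^ 2 + ‖θ.2‖ * ‖y‖ := by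
        refine (norm_add_le _ _).trans (add_le_add ?_ h1)
        rw [norm_mul, norm_neg, Real.norm_eq_abs, norm_pow, norm_norm]
    _ ≤ ‖θ‖ * ‖y‖ ^ 2 + ‖θ‖ * ‖y‖ := by gcongr
    _ ≤ (1 + ‖y‖) ^ 2 * ‖θ‖ := by nlinarith [norm_nonneg θ, mul_nonneg (norm_nonneg θ) hy]

theorem continuous_quadForm : Continuous (quadForm : E → ℝ × E →L[ℝ] ℝ) := by
  unfold quadForm
  refine Continuous.add (by fun_prop) ?_
  exact ((ContinuousLinearMap.compL ℝ (ℝ × E) E ℝ).flip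
    (ContinuousLinearMap.snd ℝ ℝ E)).continuous.comp (innerSL ℝ).continuous

theorem HasPolynomialGrowth.const (c : F) : HasPolynomialGrowth (fun _ : E => c) :=
  ⟨continuous_const, ‖c‖, 0, fun y => by simp⟩

theorem HasPolynomialGrowth.id : HasPolynomialGrowth (fun y : E => y) :=
  ⟨continuous_id, 1, 1, fun y => by simp⟩

/-- Differentiation of an exponential moment in `θ` multiplies `G` by `quadForm y`; polynomial
growth is stable under this, so one lemma gives both the derivative and its continuity. -/
theorem HasPolynomialGrowth.smulRight {G : E → F} (hG : HasPolynomialGrowth G) :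
    HasPolynomialGrowth fun y => (quadForm y).smulRight (G y) := by
  obtain ⟨C, k, h⟩ := hG.exists_bound
  refine ⟨?_, C, k + 2, fun y => ?_⟩
  · exact ((ContinuousLinearMap.smulRightL ℝ (ℝ × E) F).continuous.comp
      continuous_quadForm).clm_apply hG.continuous
  · rw [ContinuousLinearMap.norm_smulRight_apply]
    calc ‖quadForm y‖ * ‖G y‖ ≤ (1 + ‖y‖) ^ 2 * (C * (1 + ‖y‖) ^ k) :=
          mul_le_mul (norm_quadForm_le y) (h y) (norm_nonneg _) (by positivity)
      _ = C * (1 + ‖y‖) ^ (k + 2) := by ring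

/-- With `s = ‖y‖`, `(1 + s) ^ k ≤ exp (k s)` leaves the exponent `-α s² + (R + k) s`, whose maximum
is `(R + k)² / (4 α)` after completing the square. -/
theorem exists_exp_quadForm_mul_le {α R : ℝ} (hα : 0 < α) (k : ℕ) :
    ∃ K, 0 ≤ K ∧ ∀ θ : ℝ × E, α ≤ θ.1 → ‖θ.2‖ ≤ R → ∀ y : E,
      Real.exp (quadForm y θ) * (1 + ‖y‖) ^ k ≤ K := by
  refine ⟨Real.exp ((R + k) ^ 2 / (4 * α)), (Real.exp_pos _).le, fun θ h1 h2 y => ?_⟩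
  have h3 : (1 + ‖y‖) ^ k ≤ Real.exp (k * ‖y‖) := by
    rw [Real.exp_nat_mul]
    exact pow_le_pow_left₀ (by positivity) (by rw [add_comm]; exact Real.add_one_le_exp _) k
  refine (mul_le_mul_of_nonneg_left h3 (Real.exp_pos _).le).trans ?_
  rw [← Real.exp_add, Real.exp_le_exp, quadForm_apply, le_div_iff₀ (by positivity)]
  have h4 : ⟪θ.2, y⟫ ≤ R * ‖y‖ :=
    (real_inner_le_norm _ _).trans (mul_le_mul_of_nonneg_right h2 (norm_nonneg _))
  have h5 : α * ‖y‖ ^ 2 ≤ θ.1 * ‖y‖ ^ 2 := mul_le_mul_of_nonneg_right h1 (by positivity)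
  nlinarith [sq_nonneg (2 * α * ‖y‖ - (R + k))]
end

section
variable {E : Type*} [NormedAddCommGroup E] [InnerProductSpace ℝ E] [FiniteDimensional ℝ E]
  [MeasurableSpace E] [BorelSpace E]
  {F : Type*} [NormedAddCommGroup F] [NormedSpace ℝ F] {p : E → ℝ}

/-- The exponential moment `∫ p(y) exp(-α ‖y‖² + ⟪ξ, y⟫) G(y) dy`, as a function of
`θ = (α, ξ)`. -/
def expMoment (p : E → ℝ) (G : E → F) (θ : ℝ × E) : F :=
  ∫ y, (p y * Real.exp (quadForm y θ)) • G y

theorem aestronglyMeasurable_expMoment (hp : Integrable p) {G : E → F}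
    (hG : HasPolynomialGrowth G) (θ : ℝ × E) :
    AEStronglyMeasurable (fun y => (p y * Real.exp (quadForm y θ)) • G y) volume := by
  refine (hp.aestronglyMeasurable.mul ?_).smul hG.continuous.aestronglyMeasurable
  exact (Real.continuous_exp.comp
    (continuous_quadForm.clm_apply continuous_const)).aestronglyMeasurable

theorem exists_norm_expMoment_le {G : E → F} (hG : HasPolynomialGrowth G) {α R : ℝ}
    (hα : 0 < α) : ∃ K, ∀ θ : ℝ × E, α ≤ θ.1 → ‖θ.2‖ ≤ R → ∀ y : E,
      ‖(p y * Real.exp (quadForm y θ)) • G y‖ ≤ K * ‖p y‖ := by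
  obtain ⟨C, k, h⟩ := hG.exists_bound
  obtain ⟨K, hK0, hK⟩ := exists_exp_quadForm_mul_le (E := E) (R := R) hα k
  refine ⟨|C| * K, fun θ h1 h2 y => ?_⟩
  rw [norm_smul, norm_mul, Real.norm_of_nonneg (Real.exp_pos _).le]
  have h3 : ‖G y‖ ≤ |C| * (1 + ‖y‖) ^ k :=
    (h y).trans (mul_le_mul_of_nonneg_right (le_abs_self C) (by positivity))
  calc ‖p y‖ * Real.exp (quadForm y θ) * ‖G y‖
      ≤ ‖p y‖ * Real.exp (quadForm y θ) * (|C| * (1 + ‖y‖) ^ k) := by gcongr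
    _ = |C| * (Real.exp (quadForm y θ) * (1 + ‖y‖) ^ k) * ‖p y‖ := by ring
    _ ≤ |C| * K * ‖p y‖ := by gcongr; exact hK θ h1 h2 y

theorem integrable_expMoment (hp : Integrable p) {G : E → F}
    (hG : HasPolynomialGrowth G) {θ : ℝ × E} (hθ : 0 < θ.1) :
    Integrable (fun y => (p y * Real.exp (quadForm y θ)) • G y) := by
  obtain ⟨K, hK⟩ := exists_norm_expMoment_le (p := p) hG hθ (R := ‖θ.2‖)
  exact (hp.norm.const_mul K).mono' (aestronglyMeasurable_expMoment hp hG θ)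
    (Eventually.of_forall (hK θ le_rfl le_rfl))

theorem hasFDerivAt_expMoment [CompleteSpace F] (hp : Integrable p) {G : E → F}
    (hG : HasPolynomialGrowth G) {θ : ℝ × E} (hθ : 0 < θ.1) :
    HasFDerivAt (expMoment p G) (expMoment p (fun y => (quadForm y).smulRight (G y)) θ) θ := by
  obtain ⟨K, hK⟩ := exists_norm_expMoment_le (p := p) hG.smulRight (half_pos hθ)
    (R := ‖θ.2‖ + 1)
  -- On this neighbourhood the first parameter stays above `θ.1 / 2 > 0` and the second stays
  -- bounded, so the derivatives of the integrand share one dominating multiple of `‖p‖`.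
  have hs : {η : ℝ × E | θ.1 / 2 < η.1 ∧ ‖η.2‖ < ‖θ.2‖ + 1} ∈ 𝓝 θ := by
    refine (IsOpen.inter ?_ ?_).mem_nhds ⟨half_lt_self hθ, ?_⟩
    · exact isOpen_lt continuous_const continuous_fst
    · exact isOpen_lt continuous_snd.norm continuous_const
    · exact lt_add_one ‖θ.2‖
  refine hasFDerivAt_integral_of_dominated_of_fderiv_le hs
    (Eventually.of_forall fun η => aestronglyMeasurable_expMoment hp hG η)
    (integrable_expMoment hp hG hθ) (aestronglyMeasurable_expMoment hp hG.smulRight θ)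
    (Eventually.of_forall fun y η hη => hK η hη.1.le hη.2.le y) (hp.norm.const_mul K)
    (Eventually.of_forall fun y η _ => ?_)
  have h1 : HasFDerivAt (fun η => p y * Real.exp (quadForm y η))
      (p y • Real.exp (quadForm y η) • quadForm y) η :=
    ((quadForm y).hasFDerivAt.exp).const_mul (p y)
  refine (h1.smul_const (G y)).congr_fderiv ?_
  ext <;> simp [smul_smul, mul_assoc]

theorem continuousOn_expMoment [CompleteSpace F] (hp : Integrable p) {G : E → F}
    (hG : HasPolynomialGrowth G) : ContinuousOn (expMoment p G) {θ | 0 < θ.1} := fun _ hθ =>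
  (hasFDerivAt_expMoment hp hG hθ).continuousAt.continuousWithinAt

theorem contDiffOn_expMoment [CompleteSpace F] (hp : Integrable p) {G : E → F}
    (hG : HasPolynomialGrowth G) : ContDiffOn ℝ 1 (expMoment p G) {θ | 0 < θ.1} := by
  rw [← zero_add (1 : WithTop ℕ∞),
    contDiffOn_succ_iff_fderiv_of_isOpen (isOpen_lt continuous_const continuous_fst)]
  refine ⟨fun θ hθ => (hasFDerivAt_expMoment hp hG hθ).differentiableAt.differentiableWithinAt,
    by simp, contDiffOn_zero.2 ?_⟩
  exact (continuousOn_expMoment hp hG.smulRight).congr fun θ hθ =>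
    (hasFDerivAt_expMoment hp hG hθ).fderiv
end

section
variable {E : Type*} [NormedAddCommGroup E] [InnerProductSpace ℝ E] [FiniteDimensional ℝ E]
  [MeasurableSpace E] [BorelSpace E] {p : E → ℝ}

theorem HasPolynomialGrowth.norm_sq : HasPolynomialGrowth (fun y : E => ‖y‖ ^ 2) :=
  ⟨by fun_prop, 1, 2, fun y => by
    rw [Real.norm_of_nonneg (by positivity), one_mul]
    exact pow_le_pow_left₀ (norm_nonneg _) (by linarith) 2⟩

theorem map_expMoment {F F' : Type*} [NormedAddCommGroup F] [NormedSpace ℝ F] [CompleteSpace F]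
    [NormedAddCommGroup F'] [NormedSpace ℝ F'] [CompleteSpace F'] (hp : Integrable p) {G : E → F}
    (hG : HasPolynomialGrowth G) {θ : ℝ × E} (hθ : 0 < θ.1) (T : F →L[ℝ] F') :
    T (expMoment p G θ) = expMoment p (fun y => T (G y)) θ := by
  rw [expMoment, ← T.integral_comp_comm (integrable_expMoment hp hG hθ)]
  simp [expMoment]

theorem fderiv_expMoment_one_apply (hp : Integrable p) {θ : ℝ × E} (hθ : 0 < θ.1)
    (η : ℝ × E) :
    expMoment p (fun y => (quadForm y).smulRight (1 : ℝ)) θ η =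
      -η.1 * expMoment p (fun y => ‖y‖ ^ 2) θ + ⟪η.2, expMoment p (fun y => y) θ⟫ := by
  have h1 := map_expMoment hp (HasPolynomialGrowth.const (1 : ℝ)).smulRight hθ
    (ContinuousLinearMap.apply ℝ ℝ η)
  have h2 := map_expMoment hp HasPolynomialGrowth.id hθ (innerSL ℝ η.2)
  simp only [ContinuousLinearMap.apply_apply, ContinuousLinearMap.smulRight_apply,
    quadForm_apply, innerSL_apply_apply] at h1 h2
  rw [h1, h2, expMoment, expMoment, expMoment, ← integral_const_mul, ← integral_add]
  · congr 1; ext y; simp only [smul_eq_mul]; ring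
  · exact (integrable_expMoment hp HasPolynomialGrowth.norm_sq hθ).const_mul _
  · simpa only [map_smul, innerSL_apply_apply] using
      (innerSL ℝ η.2).integrable_comp (integrable_expMoment hp HasPolynomialGrowth.id hθ)

/-- The `ξ`-derivative of the first moment is the moment of `y ⊗ y`, whose trace is `‖y‖²`; the
trace, being linear, passes under the integral. -/
theorem trace_fderiv_expMoment_id (hp : Integrable p) {θ : ℝ × E} (hθ : 0 < θ.1) :
    LinearMap.trace ℝ E ((expMoment p (fun y => (quadForm y).smulRight y) θ).comp
      (ContinuousLinearMap.inr ℝ ℝ E)) = expMoment p (fun y => ‖y‖ ^ 2) θ := by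
  set T : ((ℝ × E) →L[ℝ] E) →ₗ[ℝ] ℝ := LinearMap.trace ℝ E ∘ₗ ContinuousLinearMap.coeLM ℝ ∘ₗ
    ((ContinuousLinearMap.compL ℝ E (ℝ × E) E).flip (ContinuousLinearMap.inr ℝ ℝ E) :
      ((ℝ × E) →L[ℝ] E) →ₗ[ℝ] (E →L[ℝ] E)) with hT
  have h1 := map_expMoment hp HasPolynomialGrowth.id.smulRight hθ (LinearMap.toContinuousLinearMap T)
  have h2 : ∀ y : E, T ((quadForm y).smulRight y) = ‖y‖ ^ 2 := fun y => by
    have : (((quadForm y).smulRight y).comp (ContinuousLinearMap.inr ℝ ℝ E) : E →ₗ[ℝ] E) =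
        (innerSL ℝ y : E →ₗ[ℝ] ℝ).smulRight y := by
      ext z; simp [quadForm_apply, real_inner_comm]
    change LinearMap.trace ℝ E (((quadForm y).smulRight y).comp (ContinuousLinearMap.inr ℝ ℝ E) :
      E →ₗ[ℝ] E) = _
    rw [this, LinearMap.trace_smulRight]
    simp
  simp only [LinearMap.coe_toContinuousLinearMap', h2] at h1
  exact h1

theorem expMoment_one_pos (hp : Integrable p) (hp0 : ∀ x, 0 ≤ p x) (hp1 : ∫ x, p x = 1)
    {θ : ℝ × E} (hθ : 0 < θ.1) : 0 < expMoment p (fun _ => (1 : ℝ)) θ := by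
  have hint := integrable_expMoment hp (HasPolynomialGrowth.const (1 : ℝ)) hθ
  rw [expMoment, integral_pos_iff_support_of_nonneg
    (fun y => by have := hp0 y; positivity) hint]
  have h1 : (Function.support fun y => (p y * Real.exp (quadForm y θ)) • (1 : ℝ)) =
      Function.support p := by
    ext y; simp [Real.exp_ne_zero]
  rw [h1, ← integral_pos_iff_support_of_nonneg hp0 hp, hp1]
  exact one_pos
end

/-! ### Marginal, score and velocity through exponential moments -/

variable {n : ℕ} {pH : EuclideanSpace ℝ (Fin n) → ℝ}

theorem sigmaSq_pos {t : ℝ} (ht : 0 < t) : 0 < sigmaSq t := by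
  simp only [sigmaSq, sub_pos, Real.exp_lt_one_iff]; linarith

theorem coeffA_pos (t : ℝ) : 0 < coeffA t := Real.exp_pos _

theorem coeffA_sq (t : ℝ) : coeffA t ^ 2 = 1 - sigmaSq t := by
  rw [coeffA, sigmaSq, ← Real.exp_nat_mul]; push_cast; ring_nf

theorem hasDerivAt_coeffA (t : ℝ) : HasDerivAt coeffA (-coeffA t / 2) t := by
  have := ((hasDerivAt_id t).neg.div_const 2).exp
  refine this.congr_deriv ?_
  simp [coeffA]; ring

theorem hasDerivAt_sigmaSq (t : ℝ) : HasDerivAt sigmaSq (1 - sigmaSq t) t := by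
  have := ((hasDerivAt_id t).neg.exp).const_sub 1
  refine this.congr_deriv ?_
  simp [sigmaSq]

/-- The coefficient `a² / (2 σ²)`. -/
def quadCoeff (t : ℝ) : ℝ := coeffA t ^ 2 / (2 * sigmaSq t)

/-- The coefficient `a / σ²`. -/
def linCoeff (t : ℝ) : ℝ := coeffA t / sigmaSq t

theorem quadCoeff_pos {t : ℝ} (ht : 0 < t) : 0 < quadCoeff t := by
  have := sigmaSq_pos ht
  have := coeffA_pos t
  unfold quadCoeff; positivity

theorem hasDerivAt_linCoeff {t : ℝ} (ht : 0 < t) :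
    HasDerivAt linCoeff (linCoeff t * (1 / 2 - 1 / sigmaSq t)) t := by
  have hs := (sigmaSq_pos ht).ne'
  refine ((hasDerivAt_coeffA t).div (hasDerivAt_sigmaSq t) hs).congr_deriv ?_
  unfold linCoeff; field_simp; ring

theorem hasDerivAt_quadCoeff {t : ℝ} (ht : 0 < t) :
    HasDerivAt quadCoeff (-linCoeff t ^ 2 / 2) t := by
  have hs := (sigmaSq_pos ht).ne'
  refine (((hasDerivAt_coeffA t).pow 2).div ((hasDerivAt_sigmaSq t).const_mul 2)
    (by positivity)).congr_deriv ?_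
  have := coeffA_sq t
  have h2 : sigmaSq t = 1 - coeffA t ^ 2 := by linarith
  unfold linCoeff; field_simp
  simp
  rw [h2]; ring

/-- Expanding `‖x - a y‖²` separates a factor free of `y` from an exponential linear in `θ = (a² /
2v, a x / v)`. All dependence of `marginal` on `t` and `x` thus passes through explicit factors and
an `expMoment`. -/
theorem gaussianDensity_eq (v a : ℝ) (hv : 0 < v) (x y : EuclideanSpace ℝ (Fin n)) :
    gaussianDensity v (a • y) x = (2 * Real.pi * v) ^ (-(n : ℝ) / 2) *
      Real.exp (-‖x‖ ^ 2 / (2 * v)) * Real.exp (quadForm y (a ^ 2 / (2 * v), (a / v) • x)) := by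
  rw [gaussianDensity, mul_assoc (_ ^ _), ← Real.exp_add, quadForm_apply, norm_sub_sq_real, norm_smul,
    real_inner_smul_left, real_inner_smul_right, mul_pow, Real.norm_eq_abs, sq_abs]
  congr 2
  field_simp
  ring

theorem marginal_eq {t : ℝ} (ht : 0 < t) (x : EuclideanSpace ℝ (Fin n)) :
    marginal pH t x = (2 * Real.pi * sigmaSq t) ^ (-(n : ℝ) / 2) *
      Real.exp (-‖x‖ ^ 2 / (2 * sigmaSq t)) *
      expMoment pH (fun _ => (1 : ℝ)) (quadCoeff t, linCoeff t • x) := by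
  rw [marginal, expMoment, ← integral_const_mul]
  congr 1; ext y
  rw [gaussianDensity_eq _ _ (sigmaSq_pos ht)]
  simp only [quadCoeff, linCoeff, smul_eq_mul]; ring

theorem marginal_pos (hp : Integrable pH) (hp0 : ∀ x, 0 ≤ pH x) (hp1 : ∫ x, pH x = 1)
    {t : ℝ} (ht : 0 < t) (x : EuclideanSpace ℝ (Fin n)) : 0 < marginal pH t x := by
  have h1 := expMoment_one_pos hp hp0 hp1 (θ := (quadCoeff t, linCoeff t • x)) (quadCoeff_pos ht)
  have h2 := sigmaSq_pos ht
  rw [marginal_eq ht]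
  positivity

theorem log_marginal_eq (hp : Integrable pH) (hp0 : ∀ x, 0 ≤ pH x) (hp1 : ∫ x, pH x = 1)
    {t : ℝ} (ht : 0 < t) (x : EuclideanSpace ℝ (Fin n)) :
    Real.log (marginal pH t x) = -(n : ℝ) / 2 * Real.log (2 * Real.pi * sigmaSq t) -
      ‖x‖ ^ 2 / (2 * sigmaSq t) +
      Real.log (expMoment pH (fun _ => (1 : ℝ)) (quadCoeff t, linCoeff t • x)) := by
  have h1 := expMoment_one_pos hp hp0 hp1 (θ := (quadCoeff t, linCoeff t • x)) (quadCoeff_pos ht)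
  have h2 := sigmaSq_pos ht
  rw [marginal_eq ht, Real.log_mul (by positivity) h1.ne', Real.log_mul (by positivity)
    (by positivity), Real.log_rpow (by positivity), Real.log_exp]
  ring

/-- The derivative of `log p_τ(γ τ)` along a differentiable curve `γ`. -/
theorem hasDerivWithinAt_log_marginal_comp (hp : Integrable pH) (hp0 : ∀ x, 0 ≤ pH x)
    (hp1 : ∫ x, pH x = 1) {t : ℝ} (ht : 0 < t) {s : Set ℝ} (hs : ∀ τ ∈ s, 0 < τ)
    {γ : ℝ → EuclideanSpace ℝ (Fin n)} {w : EuclideanSpace ℝ (Fin n)}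
    (hγ : HasDerivWithinAt γ w s t) :
    HasDerivWithinAt (fun τ => Real.log (marginal pH τ (γ τ)))
      (-(n : ℝ) / 2 * ((1 - sigmaSq t) / sigmaSq t) - (⟪γ t, w⟫ / sigmaSq t -
        ‖γ t‖ ^ 2 * (1 - sigmaSq t) / (2 * sigmaSq t ^ 2)) +
      (linCoeff t ^ 2 / 2 * expMoment pH (fun y => ‖y‖ ^ 2) (quadCoeff t, linCoeff t • γ t) +
        ⟪(linCoeff t * (1 / 2 - 1 / sigmaSq t)) • γ t + linCoeff t • w,
          expMoment pH (fun y => y) (quadCoeff t, linCoeff t • γ t)⟫) /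
        expMoment pH (fun _ => (1 : ℝ)) (quadCoeff t, linCoeff t • γ t)) s t := by
  have hσ := sigmaSq_pos ht
  have hM := expMoment_one_pos hp hp0 hp1 (θ := (quadCoeff t, linCoeff t • γ t)) (quadCoeff_pos ht)
  have h1 : HasDerivWithinAt (fun τ => -(n : ℝ) / 2 * Real.log (2 * Real.pi * sigmaSq τ))
      (-(n : ℝ) / 2 * ((1 - sigmaSq t) / sigmaSq t)) s t := by
    have := ((((hasDerivAt_sigmaSq t).const_mul (2 * Real.pi)).log (by positivity)).const_mul
      (-(n : ℝ) / 2)).hasDerivWithinAt (s := s)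
    refine this.congr_deriv ?_
    field_simp
  have h2 : HasDerivWithinAt (fun τ => ‖γ τ‖ ^ 2 / (2 * sigmaSq τ))
      (⟪γ t, w⟫ / sigmaSq t - ‖γ t‖ ^ 2 * (1 - sigmaSq t) / (2 * sigmaSq t ^ 2)) s t := by
    have := hγ.norm_sq.div ((hasDerivAt_sigmaSq t).const_mul 2).hasDerivWithinAt (by positivity)
    refine this.congr_deriv ?_
    field_simp
  have h3 : HasDerivWithinAt (fun τ => (quadCoeff τ, linCoeff τ • γ τ))
      (-linCoeff t ^ 2 / 2, linCoeff t • w + (linCoeff t * (1 / 2 - 1 / sigmaSq t)) • γ t) s t :=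
    (hasDerivAt_quadCoeff ht).hasDerivWithinAt.prodMk
      ((hasDerivAt_linCoeff ht).hasDerivWithinAt.smul hγ)
  have h4 := (hasFDerivAt_expMoment hp (HasPolynomialGrowth.const (1 : ℝ))
    (θ := (quadCoeff t, linCoeff t • γ t)) (quadCoeff_pos ht)).comp_hasDerivWithinAt t h3
  rw [Function.comp_def] at h4
  refine (((h1.sub h2).add (h4.log hM.ne')).congr_deriv ?_).congr_of_eventuallyEq ?_ ?_
  · rw [fderiv_expMoment_one_apply hp (quadCoeff_pos ht)]
    rw [add_comm (linCoeff t • w)]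
    ring_nf
  · filter_upwards [self_mem_nhdsWithin] with τ hτ
    exact log_marginal_eq hp hp0 hp1 (hs τ hτ) _
  · exact log_marginal_eq hp hp0 hp1 ht _

/-- Tweedie's formula: the first moment divided by the zeroth is the posterior mean of `X_0` given
`X_t = x`. -/
theorem score_eq (hp : Integrable pH) (hp0 : ∀ x, 0 ≤ pH x) (hp1 : ∫ x, pH x = 1)
    {t : ℝ} (ht : 0 < t) (x : EuclideanSpace ℝ (Fin n)) :
    score pH t x = (linCoeff t / expMoment pH (fun _ => (1 : ℝ)) (quadCoeff t, linCoeff t • x)) •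
      expMoment pH (fun y => y) (quadCoeff t, linCoeff t • x) - (1 / sigmaSq t) • x := by
  have hσ := sigmaSq_pos ht
  have hM := expMoment_one_pos hp hp0 hp1 (θ := (quadCoeff t, linCoeff t • x)) (quadCoeff_pos ht)
  have h3 : HasFDerivAt (fun z : EuclideanSpace ℝ (Fin n) => (quadCoeff t, linCoeff t • z))
      ((0 : EuclideanSpace ℝ (Fin n) →L[ℝ] ℝ).prod
        (linCoeff t • ContinuousLinearMap.id ℝ (EuclideanSpace ℝ (Fin n)))) x :=
    (hasFDerivAt_const _ _).prodMk
      (linCoeff t • ContinuousLinearMap.id ℝ (EuclideanSpace ℝ (Fin n))).hasFDerivAt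
  have h4 := (hasFDerivAt_expMoment hp (HasPolynomialGrowth.const (1 : ℝ))
    (θ := (quadCoeff t, linCoeff t • x)) (quadCoeff_pos ht)).comp x h3
  rw [Function.comp_def] at h4
  have h5 := ((((hasFDerivAt_id x).norm_sq.const_mul (1 / (2 * sigmaSq t))).const_sub
    (-(n : ℝ) / 2 * Real.log (2 * Real.pi * sigmaSq t))).add (h4.log hM.ne'))
  have h6 := h5.congr_of_eventuallyEq (f₁ := fun z => Real.log (marginal pH t z))
    (Eventually.of_forall fun z => by
      simp only [log_marginal_eq hp hp0 hp1 ht z, Pi.add_apply, id]; ring)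
  refine HasGradientAt.gradient (h6.congr_fderiv ?_)
  ext z
  simp only [add_apply,
    neg_apply, smul_apply, ContinuousLinearMap.comp_apply,
    ContinuousLinearMap.prod_apply, ContinuousLinearMap.id_apply, innerSL_apply_apply,
    InnerProductSpace.toDual_apply_apply, inner_sub_left, real_inner_smul_left, smul_eq_mul,
    zero_apply, nsmul_eq_mul, id]
  rw [fderiv_expMoment_one_apply hp (quadCoeff_pos ht), real_inner_comm z (expMoment _ _ _)]
  simp only [real_inner_smul_left]
  field_simp
  push_cast
  ring

/-- The velocity, expressed through exponential moments of `p_H`. -/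
theorem velocity_eq (hp : Integrable pH) (hp0 : ∀ x, 0 ≤ pH x) (hp1 : ∫ x, pH x = 1)
    {t : ℝ} (ht : 0 < t) (x : EuclideanSpace ℝ (Fin n)) :
    velocity pH t x = ((1 / sigmaSq t - 1) / 2) • x -
      (linCoeff t / 2 * (expMoment pH (fun _ => (1 : ℝ)) (quadCoeff t, linCoeff t • x))⁻¹) •
        expMoment pH (fun y => y) (quadCoeff t, linCoeff t • x) := by
  rw [velocity, score_eq hp hp0 hp1 ht]
  module

/-- Joint regularity in `(t, x)` is needed because the spatial derivative must be continuous in both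
variables for the variational equation. -/
theorem contDiffOn_uncurry_velocity (hp : Integrable pH) (hp0 : ∀ x, 0 ≤ pH x)
    (hp1 : ∫ x, pH x = 1) : ContDiffOn ℝ 1 (Function.uncurry (velocity pH)) (Ioi 0 ×ˢ univ) := by
  have hσ : ContDiff ℝ 1 sigmaSq := by unfold sigmaSq; fun_prop
  have ha : ContDiff ℝ 1 coeffA := by unfold coeffA; fun_prop
  have hσ' : ContDiffOn ℝ 1 (fun q : ℝ × EuclideanSpace ℝ (Fin n) => (sigmaSq q.1)⁻¹)
      (Ioi 0 ×ˢ univ) :=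
    (hσ.comp contDiff_fst).contDiffOn.inv fun q hq => (sigmaSq_pos hq.1).ne'
  have hβ : ContDiffOn ℝ 1 (fun q : ℝ × EuclideanSpace ℝ (Fin n) => linCoeff q.1)
      (Ioi 0 ×ˢ univ) := by
    simp only [linCoeff, div_eq_mul_inv]
    exact (ha.comp contDiff_fst).contDiffOn.mul hσ'
  have hα : ContDiffOn ℝ 1 (fun q : ℝ × EuclideanSpace ℝ (Fin n) => quadCoeff q.1)
      (Ioi 0 ×ˢ univ) := by
    simp only [quadCoeff, div_eq_mul_inv, mul_inv]
    exact ((ha.comp contDiff_fst).contDiffOn.pow 2).mul (contDiffOn_const.mul hσ')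
  have hθ : ContDiffOn ℝ 1 (fun q : ℝ × EuclideanSpace ℝ (Fin n) =>
      (quadCoeff q.1, linCoeff q.1 • q.2)) (Ioi 0 ×ˢ univ) :=
    hα.prodMk (hβ.smul contDiffOn_snd)
  have hmaps : MapsTo (fun q : ℝ × EuclideanSpace ℝ (Fin n) =>
      (quadCoeff q.1, linCoeff q.1 • q.2)) (Ioi 0 ×ˢ univ) {θ | 0 < θ.1} :=
    fun q hq => quadCoeff_pos hq.1
  have hM := (contDiffOn_expMoment hp (HasPolynomialGrowth.const (1 : ℝ))).comp hθ hmaps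
  have hB := (contDiffOn_expMoment hp HasPolynomialGrowth.id).comp hθ hmaps
  have h1 := (((hσ'.sub (contDiffOn_const (c := (1 : ℝ)))).div_const 2).smul contDiffOn_snd).sub
    (((hβ.div_const 2).mul (hM.inv fun q hq =>
      (expMoment_one_pos hp hp0 hp1 (hmaps hq)).ne')).smul hB)
  refine h1.congr fun q hq => ?_
  rw [Function.uncurry, velocity_eq hp hp0 hp1 hq.1]
  simp [Function.comp_def]

theorem hasFDerivAt_velocity (hp : Integrable pH) (hp0 : ∀ x, 0 ≤ pH x)
    (hp1 : ∫ x, pH x = 1) {t : ℝ} (ht : 0 < t) (x : EuclideanSpace ℝ (Fin n)) :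
    HasFDerivAt (velocity pH t) ((fderiv ℝ (Function.uncurry (velocity pH)) (t, x)).comp
      (ContinuousLinearMap.inr ℝ ℝ (EuclideanSpace ℝ (Fin n)))) x := by
  have hopen : IsOpen (Ioi (0 : ℝ) ×ˢ (univ : Set (EuclideanSpace ℝ (Fin n)))) :=
    isOpen_Ioi.prod isOpen_univ
  have h1 := (((contDiffOn_uncurry_velocity hp hp0 hp1).differentiableOn one_ne_zero).differentiableAt
    (hopen.mem_nhds (x := (t, x)) ⟨ht, mem_univ x⟩)).hasFDerivAt
  have h2 : HasFDerivAt (fun z : EuclideanSpace ℝ (Fin n) => (t, z))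
      (ContinuousLinearMap.inr ℝ ℝ (EuclideanSpace ℝ (Fin n))) x := hasFDerivAt_prodMk_right t x
  exact h1.comp x h2

theorem norm_fderiv_velocity_le (hp : Integrable pH) (hp0 : ∀ x, 0 ≤ pH x)
    (hp1 : ∫ x, pH x = 1) {t : ℝ} (ht : 0 < t) (x : EuclideanSpace ℝ (Fin n)) :
    ‖fderiv ℝ (velocity pH t) x‖ ≤ (1 / 2 : ℝ) + (1 / 2 : ℝ) * ‖fderiv ℝ (score pH t) x‖ := by
  have hv := (hasFDerivAt_velocity hp hp0 hp1 ht x).differentiableAt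
  have hs : DifferentiableAt ℝ (score pH t) x := by
    have : score pH t = fun z => -z - (2 : ℝ) • velocity pH t z := by
      ext1 z; rw [velocity]; module
    rw [this]
    exact differentiableAt_id.neg.sub (hv.const_smul (2 : ℝ))
  have h1 : HasFDerivAt (velocity pH t)
      (-((1 / 2 : ℝ) • ContinuousLinearMap.id ℝ (EuclideanSpace ℝ (Fin n))) -
        (1 / 2 : ℝ) • fderiv ℝ (score pH t) x) x :=
    ((hasFDerivAt_id x).const_smul (1 / 2 : ℝ)).neg.sub (hs.hasFDerivAt.const_smul (1 / 2 : ℝ))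
  rw [h1.fderiv]
  refine (norm_sub_le _ _).trans (add_le_add ?_ ?_)
  · rw [norm_neg, norm_smul, Real.norm_of_nonneg (by norm_num)]
    exact mul_le_of_le_one_right (by norm_num) ContinuousLinearMap.norm_id_le
  · rw [norm_smul, Real.norm_of_nonneg (by norm_num)]

theorem isC1Field_velocity (hp : Integrable pH) (hp0 : ∀ x, 0 ≤ pH x) (hp1 : ∫ x, pH x = 1)
    {L : ℝ → ℝ} (hL : ∀ t : ℝ, 0 < t → ∀ x, ‖fderiv ℝ (score pH t) x‖ ≤ L t)
    {a b : ℝ} (ha : 0 < a) (hint : IntervalIntegrable (fun t => 1 + L t) volume a b) :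
    IsC1Field a b (velocity pH) (fun t x => fderiv ℝ (velocity pH t) x)
      (fun t => (1 / 2 : ℝ) * (1 + L t)) where
  continuousOn := (contDiffOn_uncurry_velocity hp hp0 hp1).continuousOn.mono
    (prod_mono_left fun t ht => ha.trans_le ht.1)
  hasFDerivAt t ht x :=
    (hasFDerivAt_velocity hp hp0 hp1 (ha.trans_le ht.1) x).differentiableAt.hasFDerivAt
  continuousOn_deriv := by
    have hopen : IsOpen (Ioi (0 : ℝ) ×ˢ (univ : Set (EuclideanSpace ℝ (Fin n)))) :=
      isOpen_Ioi.prod isOpen_univ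
    have h1 := (contDiffOn_uncurry_velocity hp hp0 hp1).continuousOn_fderiv_of_isOpen hopen le_rfl
    have h2 := (h1.clm_comp (continuousOn_const
      (c := ContinuousLinearMap.inr ℝ ℝ (EuclideanSpace ℝ (Fin n))))).mono
      (prod_mono_left fun t (ht : t ∈ Icc a b) => ha.trans_le ht.1)
    exact h2.congr fun q hq => (hasFDerivAt_velocity hp hp0 hp1 (ha.trans_le hq.1.1) q.2).fderiv
  norm_deriv_le t ht x := by
    have h1 := norm_fderiv_velocity_le hp hp0 hp1 (ha.trans_le ht.1) x
    have h2 := hL t (ha.trans_le ht.1) x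
    linarith
  integrable := hint.const_mul _

/-- The bracket is the trace of the posterior covariance of `X_0`, which arises by differentiating
the posterior mean in Tweedie's formula. -/
theorem trace_fderiv_velocity (hp : Integrable pH) (hp0 : ∀ x, 0 ≤ pH x) (hp1 : ∫ x, pH x = 1)
    {t : ℝ} (ht : 0 < t) (x : EuclideanSpace ℝ (Fin n)) :
    LinearMap.trace ℝ (EuclideanSpace ℝ (Fin n)) (fderiv ℝ (velocity pH t) x) =
      (1 / sigmaSq t - 1) / 2 * n - linCoeff t ^ 2 / 2 *
        (expMoment pH (fun y => ‖y‖ ^ 2) (quadCoeff t, linCoeff t • x) /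
          expMoment pH (fun _ => (1 : ℝ)) (quadCoeff t, linCoeff t • x) -
        ‖expMoment pH (fun y => y) (quadCoeff t, linCoeff t • x)‖ ^ 2 /
          expMoment pH (fun _ => (1 : ℝ)) (quadCoeff t, linCoeff t • x) ^ 2) := by
  have hθ := quadCoeff_pos ht
  set θ := (quadCoeff t, linCoeff t • x) with hθdef
  have hM : 0 < expMoment pH (fun _ => (1 : ℝ)) θ := expMoment_one_pos hp hp0 hp1 hθ
  have h3 : HasFDerivAt (fun z : EuclideanSpace ℝ (Fin n) => (quadCoeff t, linCoeff t • z))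
      (linCoeff t • ContinuousLinearMap.inr ℝ ℝ (EuclideanSpace ℝ (Fin n))) x := by
    refine ((hasFDerivAt_const _ _).prodMk
      (linCoeff t • ContinuousLinearMap.id ℝ (EuclideanSpace ℝ (Fin n))).hasFDerivAt).congr_fderiv ?_
    ext z <;> simp
  have h4 := (hasFDerivAt_expMoment hp (HasPolynomialGrowth.const (1 : ℝ)) (θ := θ) hθ).comp x h3
  have h5 := (hasFDerivAt_expMoment hp HasPolynomialGrowth.id (θ := θ) hθ).comp x h3
  rw [Function.comp_def] at h4 h5
  have h6 := ((((1 / sigmaSq t - 1) / 2) • ContinuousLinearMap.id ℝ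
    (EuclideanSpace ℝ (Fin n))).hasFDerivAt (x := x)).sub
      ((((hasDerivAt_inv hM.ne').comp_hasFDerivAt x h4).const_mul (linCoeff t / 2)).smul h5)
  have h7 := h6.congr_of_eventuallyEq (f₁ := velocity pH t)
    (Eventually.of_forall fun z => velocity_eq hp hp0 hp1 ht z)
  rw [h7.fderiv]
  simp only [ContinuousLinearMap.toLinearMap_sub, ContinuousLinearMap.toLinearMap_add,
    ContinuousLinearMap.toLinearMap_smul, map_sub, map_add, map_smul]
  have e1 := trace_fderiv_expMoment_id hp hθ (θ := θ)
  have e2 : ∀ (c : EuclideanSpace ℝ (Fin n) →L[ℝ] ℝ) (z : EuclideanSpace ℝ (Fin n)),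
      LinearMap.trace ℝ (EuclideanSpace ℝ (Fin n)) (c.smulRight z) = c z := fun c z =>
    LinearMap.trace_smulRight (c : EuclideanSpace ℝ (Fin n) →ₗ[ℝ] ℝ) z
  rw [ContinuousLinearMap.comp_smul, ContinuousLinearMap.toLinearMap_smul, map_smul, e1, e2,
    ContinuousLinearMap.coe_id, LinearMap.trace_id]
  simp only [smul_apply, ContinuousLinearMap.comp_apply, ContinuousLinearMap.inr_apply, smul_eq_mul,
    finrank_euclideanSpace_fin, Function.comp_apply, Prod.smul_mk, ← hθdef]
  rw [fderiv_expMoment_one_apply hp hθ]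
  simp only [real_inner_smul_left, real_inner_self_eq_norm_sq]
  field_simp
  ring

/-! ### Conservation of mass along the flow -/

/-- The continuity equation along an integral curve of the probability-flow ODE. -/
theorem hasDerivWithinAt_log_marginal (hp : Integrable pH) (hp0 : ∀ x, 0 ≤ pH x)
    (hp1 : ∫ x, pH x = 1) {t : ℝ} (ht : 0 < t) {s : Set ℝ} (hs : ∀ τ ∈ s, 0 < τ)
    {γ : ℝ → EuclideanSpace ℝ (Fin n)}
    (hγ : HasDerivWithinAt γ (velocity pH t (γ t)) s t) :
    HasDerivWithinAt (fun τ => Real.log (marginal pH τ (γ τ)))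
      (-LinearMap.trace ℝ (EuclideanSpace ℝ (Fin n)) (fderiv ℝ (velocity pH t) (γ t))) s t := by
  refine (hasDerivWithinAt_log_marginal_comp hp hp0 hp1 ht hs hγ).congr_deriv ?_
  have hθ := quadCoeff_pos ht
  rw [trace_fderiv_velocity hp hp0 hp1 ht, velocity_eq hp hp0 hp1 ht]
  have hM := expMoment_one_pos hp hp0 hp1 (θ := (quadCoeff t, linCoeff t • γ t)) hθ
  have hσ := sigmaSq_pos ht
  set M := expMoment pH (fun _ => (1 : ℝ)) (quadCoeff t, linCoeff t • γ t)
  set B := expMoment pH (fun y => y) (quadCoeff t, linCoeff t • γ t)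
  set D := expMoment pH (fun y => ‖y‖ ^ 2) (quadCoeff t, linCoeff t • γ t)
  simp only [inner_sub_right, inner_add_left, real_inner_smul_left, real_inner_smul_right,
    inner_sub_left, real_inner_self_eq_norm_sq]
  field_simp
  ring

/-- Conservation of mass: the density times the Jacobian determinant is constant along the flow. -/
theorem marginal_mul_det_eq (hp : Integrable pH) (hp0 : ∀ x, 0 ≤ pH x) (hp1 : ∫ x, pH x = 1)
    {a b : ℝ} (ha : 0 < a) {Φ : ℝ → EuclideanSpace ℝ (Fin n) → EuclideanSpace ℝ (Fin n)}
    {J : ℝ → EuclideanSpace ℝ (Fin n) → EuclideanSpace ℝ (Fin n) →L[ℝ] EuclideanSpace ℝ (Fin n)}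
    (hΦ : IsC1Field.IsFlowOn a b a (velocity pH) (fun t x => fderiv ℝ (velocity pH t) x) Φ J)
    (hab : a ≤ b) (x : EuclideanSpace ℝ (Fin n)) :
    marginal pH b (Φ b x) * (J b x).det = marginal pH a x := by
  have hpos : ∀ t ∈ Icc a b, 0 < t := fun t ht => ha.trans_le ht.1
  have hexp : ∀ t ∈ Icc a b, Real.exp (Real.log (marginal pH t (Φ t x))) = marginal pH t (Φ t x) :=
    fun t ht => Real.exp_log (marginal_pos hp hp0 hp1 (hpos t ht) _)
  -- The logarithmic derivatives of density and determinant are `-tr` and `+tr` of the same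
  -- operator, so the product has zero derivative.
  have hd : ∀ t ∈ Icc a b, HasDerivWithinAt
      (fun τ => Real.exp (Real.log (marginal pH τ (Φ τ x))) * (J τ x).det) 0 (Icc a b) t := by
    intro t ht
    have h1 := (hasDerivWithinAt_log_marginal hp hp0 hp1 (hpos t ht) hpos
      (hΦ.isIntegralCurveOn x t ht)).exp
    have h2 := hasDerivWithinAt_det (hΦ.isIntegralCurveOn_deriv x t ht)
    refine (h1.mul h2).congr_deriv ?_
    ring
  have hc := constant_of_has_deriv_right_zero (fun t ht => (hd t ht).continuousWithinAt)
    (fun t ht => (hd t (Ico_subset_Icc_self ht)).mono_of_mem_nhdsWithin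
      (Icc_mem_nhdsGE_of_mem ht)) b (right_mem_Icc.2 hab)
  simp only [hexp b (right_mem_Icc.2 hab), hΦ.initial, hΦ.initial_deriv] at hc
  rw [hc, Real.exp_log (marginal_pos hp hp0 hp1 ha x), ContinuousLinearMap.det,
    ContinuousLinearMap.coe_id, LinearMap.det_id, mul_one]

/-! ### Gaussian laws and the marginal law as a Gaussian mixture -/

theorem gaussianDensity_nonneg {v : ℝ} (hv : 0 < v) (μ x : EuclideanSpace ℝ (Fin n)) :
    0 ≤ gaussianDensity v μ x := by
  unfold gaussianDensity; positivity

theorem gaussianDensity_pos {v : ℝ} (hv : 0 < v) (μ x : EuclideanSpace ℝ (Fin n)) :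
    0 < gaussianDensity v μ x := by
  unfold gaussianDensity; positivity

theorem gaussianDensity_le {v : ℝ} (hv : 0 < v) (μ x : EuclideanSpace ℝ (Fin n)) :
    gaussianDensity v μ x ≤ (2 * Real.pi * v) ^ (-(n : ℝ) / 2) := by
  refine mul_le_of_le_one_right (by positivity) (Real.exp_le_one_iff.2 ?_)
  rw [neg_div]
  exact neg_nonpos.2 (by positivity)

theorem continuous_gaussianDensity (v : ℝ) :
    Continuous fun q : EuclideanSpace ℝ (Fin n) × EuclideanSpace ℝ (Fin n) =>
      gaussianDensity v q.1 q.2 := by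
  unfold gaussianDensity; fun_prop

theorem continuous_gaussianDensity_right (v : ℝ) (μ : EuclideanSpace ℝ (Fin n)) :
    Continuous (gaussianDensity v μ) := by
  unfold gaussianDensity; fun_prop

theorem gaussianDensity_eq_sub (v : ℝ) (μ x : EuclideanSpace ℝ (Fin n)) :
    gaussianDensity v μ x = gaussianDensity v 0 (x - μ) := by
  simp [gaussianDensity]

theorem charFun_densityMeasure_gaussianDensity {v : ℝ} (hv : 0 < v)
    (u : EuclideanSpace ℝ (Fin n)) :
    charFun (densityMeasure (gaussianDensity v 0)) u = Complex.exp (-(v * ‖u‖ ^ 2 / 2 : ℝ)) := by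
  rw [charFun_apply, densityMeasure, integral_withDensity_eq_integral_toReal_smul
    (continuous_gaussianDensity_right v 0).measurable.ennreal_ofReal (by simp)]
  have hb : 0 < ((1 / (2 * v) : ℝ) : ℂ).re := by
    rw [Complex.ofReal_re]; positivity
  have h1 := GaussianFourier.integral_cexp_neg_mul_sq_norm_add hb Complex.I u
  have h2 : ∀ x : EuclideanSpace ℝ (Fin n),
      (ENNReal.ofReal (gaussianDensity v 0 x)).toReal • Complex.exp (⟪x, u⟫ * Complex.I) =
      ((2 * Real.pi * v : ℝ) ^ (-(n : ℝ) / 2) : ℝ) *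
        Complex.exp (-((1 / (2 * v) : ℝ) : ℂ) * ‖x‖ ^ 2 + Complex.I * ⟪u, x⟫) := by
    intro x
    rw [ENNReal.toReal_ofReal (gaussianDensity_nonneg hv _ _), gaussianDensity, sub_zero,
      Complex.real_smul, Complex.ofReal_mul, Complex.ofReal_exp, mul_assoc, ← Complex.exp_add,
      real_inner_comm]
    congr 2
    push_cast
    ring
  simp_rw [h2]
  rw [integral_const_mul, h1]
  have h3 : (Real.pi / ((1 / (2 * v) : ℝ) : ℂ)) = ((2 * Real.pi * v : ℝ) : ℂ) := by
    push_cast; field_simp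
  have h4 : ((Module.finrank ℝ (EuclideanSpace ℝ (Fin n)) : ℂ) / 2) = ((n / 2 : ℝ) : ℂ) := by
    simp
  rw [h3, h4, ← Complex.ofReal_cpow (by positivity), ← mul_assoc, ← Complex.ofReal_mul,
    ← Real.rpow_add (by positivity), show -(n : ℝ) / 2 + n / 2 = 0 by ring, Real.rpow_zero,
    Complex.ofReal_one, one_mul]
  congr 1
  push_cast
  have : (v : ℂ) ≠ 0 := by exact_mod_cast hv.ne'
  field_simp
  rw [Complex.I_sq]
  ring

theorem isProbabilityMeasure_densityMeasure_gaussianDensity {v : ℝ} (hv : 0 < v)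
    (μ : EuclideanSpace ℝ (Fin n)) :
    IsProbabilityMeasure (densityMeasure (gaussianDensity v μ)) := by
  -- The total mass is the characteristic function at `0`; translation invariance then treats a
  -- general mean.
  have h0 : (densityMeasure (gaussianDensity v (0 : EuclideanSpace ℝ (Fin n)))) univ = 1 := by
    have h1 := charFun_densityMeasure_gaussianDensity (n := n) hv 0
    rw [charFun_zero] at h1
    simp only [norm_zero, ne_eq, OfNat.ofNat_ne_zero, not_false_eq_true, zero_pow, mul_zero,
      zero_div, Complex.ofReal_zero, neg_zero, Complex.exp_zero, Complex.ofReal_eq_one] at h1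
    exact (ENNReal.toReal_eq_one_iff _).1 h1
  refine ⟨?_⟩
  rw [← h0]
  simp only [densityMeasure, withDensity_apply _ MeasurableSet.univ, Measure.restrict_univ]
  simp_rw [gaussianDensity_eq_sub v μ]
  exact lintegral_sub_right_eq_self (fun x => ENNReal.ofReal (gaussianDensity v 0 x)) μ

theorem stdGaussian_eq_densityMeasure :
    stdGaussian (EuclideanSpace ℝ (Fin n)) = densityMeasure (gaussianDensity 1 0) := by
  have := isProbabilityMeasure_densityMeasure_gaussianDensity (n := n) one_pos 0
  refine Measure.ext_of_charFun ?_
  ext u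
  rw [charFun_stdGaussian, charFun_densityMeasure_gaussianDensity one_pos]
  congr 1; push_cast; ring

theorem integral_gaussianDensity {v : ℝ} (hv : 0 < v) (μ : EuclideanSpace ℝ (Fin n)) :
    Integrable (gaussianDensity v μ) ∧ ∫ x, gaussianDensity v μ x = 1 := by
  have h1 := (isProbabilityMeasure_densityMeasure_gaussianDensity hv μ).measure_univ
  rw [densityMeasure, withDensity_apply _ MeasurableSet.univ, Measure.restrict_univ] at h1
  have hm := (continuous_gaussianDensity_right v μ).aestronglyMeasurable (μ := volume)
  have h0 := Eventually.of_forall (f := ae volume) (gaussianDensity_nonneg hv μ)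
  refine ⟨⟨hm, ?_⟩, ?_⟩
  · rw [hasFiniteIntegral_iff_ofReal h0, h1]; exact ENNReal.one_lt_top
  · rw [integral_eq_lintegral_of_nonneg_ae h0 hm, h1, ENNReal.toReal_one]

theorem isProbabilityMeasure_densityMeasure (hp : Integrable pH) (hp0 : ∀ x, 0 ≤ pH x)
    (hp1 : ∫ x, pH x = 1) : IsProbabilityMeasure (densityMeasure pH) := ⟨by
  rw [densityMeasure, withDensity_apply _ MeasurableSet.univ, Measure.restrict_univ,
    ← ofReal_integral_eq_lintegral_ofReal hp (Eventually.of_forall hp0), hp1, ENNReal.ofReal_one]⟩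

theorem integrable_mul_gaussianDensity (hp : Integrable pH) {t : ℝ} (ht : 0 < t)
    (x : EuclideanSpace ℝ (Fin n)) :
    Integrable fun y => pH y * gaussianDensity (sigmaSq t) (coeffA t • y) x := by
  refine hp.mul_bdd (c := (2 * Real.pi * sigmaSq t) ^ (-(n : ℝ) / 2)) ?_ (Eventually.of_forall fun y => ?_)
  · exact ((continuous_gaussianDensity (sigmaSq t)).comp
      ((continuous_const_smul _).prodMk continuous_const)).aestronglyMeasurable
  · rw [Real.norm_of_nonneg (gaussianDensity_nonneg (sigmaSq_pos ht) _ _)]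
    exact gaussianDensity_le (sigmaSq_pos ht) _ _

theorem ofReal_marginal (hp : Integrable pH) (hp0 : ∀ x, 0 ≤ pH x) {t : ℝ} (ht : 0 < t)
    (x : EuclideanSpace ℝ (Fin n)) :
    ENNReal.ofReal (marginal pH t x) = ∫⁻ y, ENNReal.ofReal (pH y) *
      ENNReal.ofReal (gaussianDensity (sigmaSq t) (coeffA t • y) x) := by
  rw [marginal, ofReal_integral_eq_lintegral_ofReal (integrable_mul_gaussianDensity hp ht x)
    (Eventually.of_forall fun y => mul_nonneg (hp0 y) (gaussianDensity_nonneg (sigmaSq_pos ht) _ _))]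
  simp_rw [ENNReal.ofReal_mul (hp0 _)]

/-- The marginal law as a mixture of Gaussian laws. -/
theorem lintegral_densityMeasure_marginal (hp : Integrable pH) (hp0 : ∀ x, 0 ≤ pH x) {t : ℝ}
    (ht : 0 < t) {f : EuclideanSpace ℝ (Fin n) → ℝ≥0∞} (hf : Measurable f) :
    ∫⁻ x, ENNReal.ofReal (marginal pH t x) * f x =
      ∫⁻ y, ENNReal.ofReal (pH y) *
        ∫⁻ x, ENNReal.ofReal (gaussianDensity (sigmaSq t) (coeffA t • y) x) * f x := by
  have hk1 : ∀ x : EuclideanSpace ℝ (Fin n), Measurable fun y =>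
      ENNReal.ofReal (gaussianDensity (sigmaSq t) (coeffA t • y) x) := fun x =>
    (Continuous.measurable (by unfold gaussianDensity; fun_prop)).ennreal_ofReal
  have hk2 : ∀ y : EuclideanSpace ℝ (Fin n), Measurable fun x =>
      ENNReal.ofReal (gaussianDensity (sigmaSq t) (coeffA t • y) x) := fun y =>
    (continuous_gaussianDensity_right _ _).measurable.ennreal_ofReal
  have hpm : AEMeasurable (fun y => ENNReal.ofReal (pH y)) volume :=
    hp.aestronglyMeasurable.aemeasurable.ennreal_ofReal
  simp_rw [ofReal_marginal hp hp0 ht]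
  have h1 : ∀ x, (∫⁻ y, ENNReal.ofReal (pH y) *
      ENNReal.ofReal (gaussianDensity (sigmaSq t) (coeffA t • y) x)) * f x =
      ∫⁻ y, ENNReal.ofReal (pH y) *
      ENNReal.ofReal (gaussianDensity (sigmaSq t) (coeffA t • y) x) * f x := fun x =>
    (lintegral_mul_const'' (f x) (hpm.mul (hk1 x).aemeasurable)).symm
  have h2 : ∀ y, ENNReal.ofReal (pH y) *
      ∫⁻ x, ENNReal.ofReal (gaussianDensity (sigmaSq t) (coeffA t • y) x) * f x =
      ∫⁻ x, ENNReal.ofReal (pH y) *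
        ENNReal.ofReal (gaussianDensity (sigmaSq t) (coeffA t • y) x) * f x := fun y => by
    simp_rw [mul_assoc]
    exact (lintegral_const_mul _ ((hk2 y).mul hf)).symm
  have hswap : AEMeasurable (fun q : EuclideanSpace ℝ (Fin n) × EuclideanSpace ℝ (Fin n) =>
      ENNReal.ofReal (pH q.2)) (volume.prod volume) := hpm.comp_snd
  have hk' : Measurable fun q : EuclideanSpace ℝ (Fin n) × EuclideanSpace ℝ (Fin n) =>
      ENNReal.ofReal (gaussianDensity (sigmaSq t) (coeffA t • q.2) q.1) :=
    (Continuous.measurable (by unfold gaussianDensity; fun_prop)).ennreal_ofReal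
  have hf' : Measurable fun q : EuclideanSpace ℝ (Fin n) × EuclideanSpace ℝ (Fin n) => f q.1 :=
    hf.comp measurable_fst
  simp only [h1, h2]
  exact lintegral_lintegral_swap ((hswap.mul hk'.aemeasurable).mul hf'.aemeasurable)

theorem measurable_marginal (hp : Integrable pH) {t : ℝ} (ht : 0 < t) : Measurable (marginal pH t) := by
  have h1 : Continuous (marginal pH t) := by
    have h2 : Continuous fun x : EuclideanSpace ℝ (Fin n) => (quadCoeff t, linCoeff t • x) := by
      fun_prop
    have h3 := (continuousOn_expMoment hp (HasPolynomialGrowth.const (1 : ℝ))).comp_continuous h2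
      fun x => quadCoeff_pos ht
    rw [show marginal pH t = _ from funext fun x => marginal_eq ht x]
    exact (continuous_const.mul (by fun_prop)).mul h3
  exact h1.measurable

theorem marginal_nonneg (hp0 : ∀ x, 0 ≤ pH x) {t : ℝ} (ht : 0 < t)
    (x : EuclideanSpace ℝ (Fin n)) : 0 ≤ marginal pH t x :=
  integral_nonneg fun y => mul_nonneg (hp0 y) (gaussianDensity_nonneg (sigmaSq_pos ht) _ _)

theorem integral_marginal (hp : Integrable pH) (hp0 : ∀ x, 0 ≤ pH x) {t : ℝ} (ht : 0 < t) :
    Integrable (marginal pH t) ∧ ∫ x, marginal pH t x = ∫ x, pH x := by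
  have h1 := lintegral_densityMeasure_marginal hp hp0 ht (f := fun _ => 1) measurable_const
  have h2 : ∀ y : EuclideanSpace ℝ (Fin n),
      ∫⁻ x, ENNReal.ofReal (gaussianDensity (sigmaSq t) (coeffA t • y) x) = 1 := fun y => by
    obtain ⟨h3, h4⟩ := integral_gaussianDensity (sigmaSq_pos ht) (coeffA t • y)
    rw [← ofReal_integral_eq_lintegral_ofReal h3
      (Eventually.of_forall (gaussianDensity_nonneg (sigmaSq_pos ht) _)), h4, ENNReal.ofReal_one]
  simp only [mul_one, h2] at h1
  have hp0' := Eventually.of_forall (f := ae volume) hp0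
  have hm := (measurable_marginal hp ht).aestronglyMeasurable (μ := volume)
  have h0 := Eventually.of_forall (f := ae volume) fun x => marginal_nonneg hp0 ht x
  refine ⟨⟨hm, ?_⟩, ?_⟩
  · rw [hasFiniteIntegral_iff_ofReal h0, h1]
    exact (hasFiniteIntegral_iff_ofReal hp0').1 hp.2
  · rw [integral_eq_lintegral_of_nonneg_ae h0 hm, h1,
      integral_eq_lintegral_of_nonneg_ae hp0' hp.aestronglyMeasurable]

/-- The law with density `p_t` is the convolution of the image of `pH` under scaling by `a(t)` with
a centred Gaussian of variance `σ²(t)`. -/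
theorem charFun_densityMeasure_marginal (hp : Integrable pH) (hp0 : ∀ x, 0 ≤ pH x)
    (hp1 : ∫ x, pH x = 1) {t : ℝ} (ht : 0 < t) (u : EuclideanSpace ℝ (Fin n)) :
    charFun (densityMeasure (marginal pH t)) u =
      charFun (densityMeasure pH) (coeffA t • u) *
        Complex.exp (-(sigmaSq t * ‖u‖ ^ 2 / 2 : ℝ)) := by
  have i1 := isProbabilityMeasure_densityMeasure hp hp0 hp1
  have i2 := isProbabilityMeasure_densityMeasure_gaussianDensity (n := n) (sigmaSq_pos ht) 0
  have i3 := Measure.isProbabilityMeasure_map (μ := densityMeasure pH)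
    (f := fun x => coeffA t • x) (by fun_prop)
  have h : densityMeasure (marginal pH t) =
      ((densityMeasure pH).map (fun x => coeffA t • x)).conv
        (densityMeasure (gaussianDensity (sigmaSq t) 0)) := by
    refine Measure.ext_of_lintegral _ fun f hf => ?_
    rw [Measure.lintegral_conv hf, densityMeasure, lintegral_withDensity_eq_lintegral_mul _
      (measurable_marginal hp ht).ennreal_ofReal hf]
    simp only [Pi.mul_apply]
    rw [lintegral_densityMeasure_marginal hp hp0 ht hf, lintegral_map _ (by fun_prop)]
    · rw [densityMeasure, lintegral_withDensity_eq_lintegral_mul₀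
        hp.aestronglyMeasurable.aemeasurable.ennreal_ofReal]
      · congr 1
        ext y
        simp only [Pi.mul_apply, densityMeasure]
        congr 1
        rw [lintegral_withDensity_eq_lintegral_mul _
          (continuous_gaussianDensity_right _ _).measurable.ennreal_ofReal (by fun_prop)]
        simp only [Pi.mul_apply]
        rw [← lintegral_sub_right_eq_self (fun z => ENNReal.ofReal
          (gaussianDensity (sigmaSq t) 0 z) * f (coeffA t • y + z)) (coeffA t • y)]
        simp [gaussianDensity_eq_sub _ (coeffA t • y)]
      · exact (Measurable.lintegral_prod_right' (f := fun q : EuclideanSpace ℝ (Fin n) ×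
          EuclideanSpace ℝ (Fin n) => f (coeffA t • q.1 + q.2)) (by fun_prop)).aemeasurable
    · exact Measurable.lintegral_prod_right' (f := fun q : EuclideanSpace ℝ (Fin n) ×
          EuclideanSpace ℝ (Fin n) => f (q.1 + q.2)) (by fun_prop)
  rw [h, charFun_conv, charFun_map_smul, charFun_densityMeasure_gaussianDensity (sigmaSq_pos ht)]

/-! ### The law of the variance-preserving process -/

/-- Along a path solving `X t = X 0 - ½ ∫ X + W t`, the Riemann–Stieltjes sums of `∫ e^{s/2} dW_s`
converge to `e^{t/2} X t - X 0`. -/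
theorem tendsto_sum_exp_smul_increments {E : Type*} [NormedAddCommGroup E] [NormedSpace ℝ E]
    [CompleteSpace E] {X W : ℝ≥0 → E} (hX : Continuous X)
    (h : ∀ t : ℝ≥0, X t = X 0 - (1 / 2 : ℝ) • (∫ s in (0 : ℝ)..t, X s.toNNReal) + W t) (t : ℝ≥0) :
    Tendsto (fun k : ℕ => ∑ j ∈ Finset.range k, Real.exp ((j * (t / k) : ℝ≥0) / 2) •
      (W ((j + 1 : ℕ) * (t / k)) - W (j * (t / k)))) atTop
      (𝓝 (Real.exp (t / 2) • X t - X 0)) := by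
  set x : ℝ → E := fun s => X s.toNNReal with hx
  have hxc : Continuous x := hX.comp continuous_real_toNNReal
  have hcoe : ∀ s : ℝ≥0, x s = X s := fun s => by simp [hx]
  have hF : Continuous fun q : ℝ × ℝ => Real.exp (q.1 / 2) • x q.2 := by fun_prop
  have hu := ((isCompact_Icc (a := (0 : ℝ)) (b := t)).prod
    (isCompact_Icc (a := (0 : ℝ)) (b := t))).uniformContinuousOn_of_continuous hF.continuousOn
  rw [Metric.uniformContinuousOn_iff] at hu
  refine Metric.tendsto_atTop'.2 fun ε hε => ?_
  obtain ⟨δ, hδ, hδ'⟩ := hu (ε / (t + 1)) (by positivity)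
  obtain ⟨N, hN⟩ := exists_nat_gt ((t : ℝ) / δ)
  refine ⟨N, fun k hk => ?_⟩
  have hk0 : (0 : ℝ) < k := by exact_mod_cast (Nat.zero_le N).trans_lt hk
  have hk1 : (t : ℝ) / k < δ := by
    rw [div_lt_iff₀ hk0]
    rw [div_lt_iff₀ hδ] at hN
    have : (N : ℝ) < k := by exact_mod_cast hk
    nlinarith
  set D : ℝ≥0 := t / k with hD
  have hDr : (D : ℝ) = t / k := by simp [hD]
  have hkD : (k : ℝ≥0) * D = t := mul_div_cancel₀ _ (by exact_mod_cast hk0.ne')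
  have htel : Real.exp (t / 2) • X t - X 0 = ∑ j ∈ Finset.range k,
      (Real.exp (((j + 1 : ℕ) * D : ℝ≥0) / 2) • X ((j + 1 : ℕ) * D) -
        Real.exp ((j * D : ℝ≥0) / 2) • X (j * D)) := by
    rw [Finset.sum_range_sub (fun j : ℕ => Real.exp ((j * D : ℝ≥0) / 2) • X (j * D)), hkD]
    simp
  rw [dist_eq_norm, htel, ← Finset.sum_sub_distrib]
  have hterm : ∀ j ∈ Finset.range k,
      ‖Real.exp ((j * D : ℝ≥0) / 2) • (W ((j + 1 : ℕ) * D) - W (j * D)) -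
      (Real.exp (((j + 1 : ℕ) * D : ℝ≥0) / 2) • X ((j + 1 : ℕ) * D) -
        Real.exp ((j * D : ℝ≥0) / 2) • X (j * D))‖ ≤ 1 / 2 * (ε / (t + 1)) * D := by
    intro j hj
    set a : ℝ := j * D with ha
    set b : ℝ := (j + 1) * D with hb
    have hab : a ≤ b := by
      rw [ha, hb]; exact mul_le_mul_of_nonneg_right (by linarith) D.2
    have hba : b - a = D := by rw [ha, hb]; ring
    have hbt : b ≤ t := by
      rw [← hkD, hb]
      push_cast
      refine mul_le_mul_of_nonneg_right ?_ D.2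
      exact_mod_cast Finset.mem_range.1 hj
    have ha0 : 0 ≤ a := by rw [ha]; positivity
    have haI : a ∈ Icc (0 : ℝ) t := ⟨ha0, hab.trans hbt⟩
    have hbI : b ∈ Icc (0 : ℝ) t := ⟨ha0.trans hab, hbt⟩
    have hac : ((j * D : ℝ≥0) : ℝ) = a := by push_cast; rfl
    have hbc : (((j + 1 : ℕ) * D : ℝ≥0) : ℝ) = b := by push_cast; rfl
    have hi : ∀ c d : ℝ, IntervalIntegrable x volume c d := fun c d => hxc.intervalIntegrable c d
    have hW : W ((j + 1 : ℕ) * D) - W (j * D) = x b - x a + (1 / 2 : ℝ) • ∫ s in a..b, x s := by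
      have h1 := h (j * D)
      have h2 := h ((j + 1 : ℕ) * D)
      rw [hac, ← hcoe (j * D), hac] at h1
      rw [hbc, ← hcoe ((j + 1 : ℕ) * D), hbc] at h2
      rw [← intervalIntegral.integral_interval_sub_left (hi 0 b) (hi 0 a), smul_sub, h1, h2]
      abel
    have hexp : ∫ r in a..b, (1 / 2 : ℝ) • (Real.exp (r / 2) • x b) =
        (Real.exp (b / 2) - Real.exp (a / 2)) • x b := by
      simp_rw [smul_smul]
      rw [intervalIntegral.integral_smul_const]
      congr 1
      refine intervalIntegral.integral_eq_sub_of_hasDerivAt (f := fun r => Real.exp (r / 2))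
        (fun r _ => ?_) (Continuous.intervalIntegrable (by fun_prop) _ _)
      refine ((hasDerivAt_id r).div_const 2).exp.congr_deriv ?_
      simp; ring
    -- A pathwise integration by parts on `[a, b]`: the `dW` term minus the increment of `e^{s/2}
    -- X_s` is an ordinary integral of `½ (e^{a/2} x_r - e^{r/2} x_b)`. Uniform continuity makes the
    -- integrand small, and the total length `t` bounds the sum.
    have hdiff : Real.exp ((j * D : ℝ≥0) / 2) • (W ((j + 1 : ℕ) * D) - W (j * D)) -
        (Real.exp (((j + 1 : ℕ) * D : ℝ≥0) / 2) • X ((j + 1 : ℕ) * D) -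
        Real.exp ((j * D : ℝ≥0) / 2) • X (j * D)) =
        ∫ r in a..b, ((1 / 2 : ℝ) • (Real.exp (a / 2) • x r) -
          (1 / 2 : ℝ) • (Real.exp (r / 2) • x b)) := by
      rw [intervalIntegral.integral_sub (Continuous.intervalIntegrable (by fun_prop) _ _)
        (Continuous.intervalIntegrable (by fun_prop) _ _), hexp, intervalIntegral.integral_smul,
        intervalIntegral.integral_smul, hW, ← hcoe, ← hcoe, hac, hbc]
      module
    rw [hdiff]
    refine (intervalIntegral.norm_integral_le_of_norm_le_const (C := 1 / 2 * (ε / (t + 1)))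
      fun r hr => ?_).trans (by rw [hba, NNReal.abs_eq])
    rw [uIoc_of_le hab] at hr
    rw [← smul_sub, norm_smul, Real.norm_of_nonneg (by norm_num : (0 : ℝ) ≤ 1 / 2)]
    refine mul_le_mul_of_nonneg_left ?_ (by norm_num)
    have hrI : r ∈ Icc (0 : ℝ) t := ⟨ha0.trans hr.1.le, hr.2.trans hbt⟩
    have := hδ' (a, r) ⟨haI, hrI⟩ (r, b) ⟨hrI, hbI⟩ (by
      rw [Prod.dist_eq, Real.dist_eq, Real.dist_eq, max_lt_iff, abs_lt, abs_lt]
      constructor <;> constructor <;> linarith [hr.1, hr.2])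
    rw [dist_eq_norm] at this
    exact this.le
  refine (norm_sum_le_of_le _ hterm).trans_lt ?_
  rw [Finset.sum_const, Finset.card_range, nsmul_eq_mul]
  have hkDr : (k : ℝ) * D = t := by exact_mod_cast hkD
  calc (k : ℝ) * (1 / 2 * (ε / (t + 1)) * D) = 1 / 2 * (ε / (t + 1)) * (k * D) := by ring
    _ = ε * (1 / 2 * (t / (t + 1))) := by rw [hkDr]; ring
    _ < ε * 1 := by
      refine mul_lt_mul_of_pos_left ?_ hε
      have : (t : ℝ) / (t + 1) ≤ 1 := (div_le_one (by positivity)).2 (by linarith)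
      linarith
    _ = ε := mul_one ε

theorem charFun_map_sum_increments_coord {Ω : Type*} [MeasurableSpace Ω] {P : Measure Ω}
    [IsProbabilityMeasure P] {B : ℝ≥0 → Ω → ℝ} (hB : IsBrownianReal B P) (c : ℕ → ℝ) {s : ℕ → ℝ≥0}
    (hs : Monotone s) (k : ℕ) (z : ℝ) :
    charFun (P.map fun ω => ∑ j ∈ Finset.range k, c j * (B (s (j + 1)) ω - B (s j) ω)) z =
      Complex.exp (-((∑ j ∈ Finset.range k, c j ^ 2 * (s (j + 1) - s j : ℝ)) * z ^ 2 / 2 : ℝ)) := by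
  have hind := (hB.toIsPreBrownianReal.hasIndepIncrements.nat hs).comp (fun j x => c j * x)
    (fun j => measurable_const_mul (c j))
  have hm : ∀ j, AEMeasurable (fun ω => B (s (j + 1)) ω - B (s j) ω) P := fun j =>
    (hB.aemeasurable _).sub (hB.aemeasurable _)
  have h1 := iIndepFun.charFun_map_fun_finsetSum_eq_prod (s := Finset.range k)
    (fun j _ => (hm j).const_mul (c j)) (hind.restrict _)
  rw [h1, Finset.prod_apply]
  have h2 : ∀ j ∈ Finset.range k,
      charFun (P.map fun ω => c j * (B (s (j + 1)) ω - B (s j) ω)) z =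
      Complex.exp (-(c j ^ 2 * (s (j + 1) - s j : ℝ) * z ^ 2 / 2 : ℝ)) := by
    intro j _
    rw [charFun_map_mul_comp (hm j)]
    have hl := (hB.toIsPreBrownianReal.hasLaw_sub (s (j + 1)) (s j)).map_eq
    have hl' : P.map (fun ω => B (s (j + 1)) ω - B (s j) ω) = _ := hl
    rw [hl', charFun_gaussianReal]
    have hd : ((nndist (s (j + 1)).1 (s j).1 : ℝ≥0) : ℝ) = s (j + 1) - s j := by
      rw [coe_nndist, Real.dist_eq]
      exact abs_of_nonneg (sub_nonneg.2 (NNReal.coe_le_coe.2 (hs (Nat.le_succ j))))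
    congr 1
    rw [show ((nndist (s (j + 1)).1 (s j).1 : ℝ≥0) : ℂ) = ((s (j + 1) - s j : ℝ) : ℂ) by
      rw [← hd]]
    push_cast
    ring
  rw [Finset.prod_congr rfl h2, ← Complex.exp_sum]
  congr 1
  push_cast
  rw [Finset.sum_neg_distrib, Finset.sum_mul, Finset.sum_div]

/-- Independence of the coordinates factors the characteristic function, and the squares of the
coordinates of `u` add up to `‖u‖²`. -/
theorem charFun_map_sum_increments {Ω : Type*} [MeasurableSpace Ω] {P : Measure Ω}
    [IsProbabilityMeasure P] {W : ℝ≥0 → Ω → EuclideanSpace ℝ (Fin n)} (hW : IsBrownianMotion W P)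
    (c : ℕ → ℝ) {s : ℕ → ℝ≥0} (hs : Monotone s) (k : ℕ) (u : EuclideanSpace ℝ (Fin n)) :
    charFun (P.map fun ω => ∑ j ∈ Finset.range k, c j • (W (s (j + 1)) ω - W (s j) ω)) u =
      Complex.exp (-((∑ j ∈ Finset.range k, c j ^ 2 * (s (j + 1) - s j : ℝ)) * ‖u‖ ^ 2 / 2 : ℝ)) := by
  have hind := hW.indep.comp
    (fun _ (f : ℝ≥0 → ℝ) => ∑ j ∈ Finset.range k, c j * (f (s (j + 1)) - f (s j)))
    (fun _ => by fun_prop)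
  have hm : ∀ i : Fin n, AEMeasurable
      (fun ω => ∑ j ∈ Finset.range k, c j * (W (s (j + 1)) ω i - W (s j) ω i)) P := fun i => by
    refine Finset.aemeasurable_fun_sum _ fun j _ => ?_
    exact (((hW.isBrownianReal i).aemeasurable _).sub
      ((hW.isBrownianReal i).aemeasurable _)).const_mul _
  have h1 := (iIndepFun_iff_charFun_pi hm).1 hind u
  have h2 : (fun ω => ∑ j ∈ Finset.range k, c j • (W (s (j + 1)) ω - W (s j) ω)) =
      fun ω => WithLp.toLp 2 fun i =>
        ∑ j ∈ Finset.range k, c j * (W (s (j + 1)) ω i - W (s j) ω i) := by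
    ext ω i; simp
  rw [h2, h1]
  simp_rw [charFun_map_sum_increments_coord (hW.isBrownianReal _) c hs k]
  rw [← Complex.exp_sum, EuclideanSpace.real_norm_sq_eq]
  congr 1
  push_cast
  rw [Finset.sum_neg_distrib, Finset.mul_sum, Finset.sum_div]

/-- The variance of the weighted increments is a geometric sum: with `h = t / k` it equals `(e^t -
1) h / (e^h - 1)`, and `h / (e^h - 1) → 1`. -/
theorem tendsto_sum_exp_mul (t : ℝ≥0) (ht : 0 < t) :
    Tendsto (fun k : ℕ => ∑ j ∈ Finset.range k, Real.exp ((j * (t / k) : ℝ≥0) / 2) ^ 2 *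
      (((j + 1 : ℕ) * (t / k) : ℝ≥0) - (j * (t / k) : ℝ≥0) : ℝ)) atTop
      (𝓝 (Real.exp t - 1)) := by
  have ht' : (0 : ℝ) < t := ht
  have hd : Tendsto (fun h : ℝ => h⁻¹ * (Real.exp h - 1)) (𝓝[≠] 0) (𝓝 1) := by
    simpa [Real.exp_zero] using (Real.hasDerivAt_exp 0).tendsto_slope_zero
  have hseq : Tendsto (fun k : ℕ => (t : ℝ) / k) atTop (𝓝[≠] 0) := by
    refine tendsto_nhdsWithin_iff.2 ⟨tendsto_const_div_atTop_nhds_zero_nat _, ?_⟩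
    filter_upwards [eventually_gt_atTop 0] with k hk
    have : (0 : ℝ) < k := by exact_mod_cast hk
    exact (div_pos ht' this).ne'
  have h1 := ((hd.comp hseq).inv₀ one_ne_zero).const_mul (Real.exp t - 1)
  rw [inv_one, mul_one] at h1
  refine h1.congr' ?_
  filter_upwards [eventually_gt_atTop 0] with k hk
  have hk0 : (0 : ℝ) < k := by exact_mod_cast hk
  have hD : 0 < (t : ℝ) / k := div_pos ht' hk0
  have hne : Real.exp (t / k) ≠ 1 := by rw [Ne, Real.exp_eq_one_iff]; exact hD.ne'
  have h2 : ∀ j ∈ Finset.range k, Real.exp ((j * (t / k) : ℝ≥0) / 2) ^ 2 *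
      (((j + 1 : ℕ) * (t / k) : ℝ≥0) - (j * (t / k) : ℝ≥0) : ℝ) =
      Real.exp (t / k) ^ j * (t / k) := fun j _ => by
    rw [← Real.exp_nat_mul, ← Real.exp_nat_mul]
    push_cast
    ring_nf
  rw [Finset.sum_congr rfl h2, ← Finset.sum_mul, geom_sum_eq hne, ← Real.exp_nat_mul,
    mul_div_cancel₀ _ hk0.ne']
  simp only [Function.comp_apply]
  have : Real.exp (t / k) - 1 ≠ 0 := sub_ne_zero.2 hne
  field_simp

/-- The time-`t` marginal of the variance-preserving process has density `p_t`. -/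
theorem IsVPProcess.map_eq {pH : EuclideanSpace ℝ (Fin n) → ℝ} (hp : Integrable pH)
    (hp0 : ∀ x, 0 ≤ pH x) (hp1 : ∫ x, pH x = 1) {Ω : Type*} [MeasurableSpace Ω] {P : Measure Ω}
    [IsProbabilityMeasure P] {W X : ℝ≥0 → Ω → EuclideanSpace ℝ (Fin n)}
    (h : IsVPProcess pH W X P) {t : ℝ≥0} (ht : 0 < t) :
    P.map (X t) = densityMeasure (marginal pH t) := by
  have ht' : (0 : ℝ) < t := ht
  have i1 := Measure.isProbabilityMeasure_map (μ := P) (h.measurable t).aemeasurable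
  obtain ⟨hm1, hm2⟩ := integral_marginal hp hp0 ht'
  have i2 := isProbabilityMeasure_densityMeasure hm1
    (marginal_nonneg hp0 ht') (hm2.trans hp1)
  refine Measure.ext_of_charFun (funext fun u => ?_)
  set r := coeffA t with hr
  set c : ℕ → ℕ → ℝ := fun k j => Real.exp ((j * (t / k) : ℝ≥0) / 2) with hc
  set S : ℕ → Ω → EuclideanSpace ℝ (Fin n) := fun k ω => ∑ j ∈ Finset.range k, c k j •
    (W ((j + 1 : ℕ) * (t / k)) ω - W (j * (t / k)) ω) with hS
  have hSm : ∀ k, Measurable (S k) := fun k => Finset.measurable_fun_sum _ fun j _ =>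
    ((h.brownian.measurable _).sub (h.brownian.measurable _)).const_smul (c k j)
  have hXS : ∀ k, Measurable fun ω => X 0 ω + S k ω := fun k => (h.measurable 0).add (hSm k)
  have hrXS : ∀ k, Measurable fun ω => r • (X 0 ω + S k ω) := fun k => (hXS k).const_smul r
  have hcont : Continuous fun x : EuclideanSpace ℝ (Fin n) =>
      Complex.exp (⟪x, u⟫ * Complex.I) := by fun_prop
  have hmono : ∀ k : ℕ, Monotone fun j : ℕ => (j : ℝ≥0) * (t / k) := fun k i j hij =>
    mul_le_mul_left (by exact_mod_cast hij) _
  -- Almost sure convergence of the approximants gives convergence of characteristic functions by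
  -- domination. Those of the approximants factor because `X 0` is independent of the whole path of
  -- `W`.
  have hlim : ∀ᵐ ω ∂P, Tendsto (fun k => r • (X 0 ω + S k ω)) atTop (𝓝 (X t ω)) := by
    filter_upwards [h.continuous_paths, h.sde] with ω h1 h2
    have h3 := ((tendsto_sum_exp_smul_increments h1 h2 t).const_add (X 0 ω)).const_smul r
    have h4 : r • (X 0 ω + (Real.exp (t / 2) • X t ω - X 0 ω)) = X t ω := by
      rw [add_sub_cancel, smul_smul, hr, coeffA, ← Real.exp_add]
      simp [neg_div]
    rwa [h4] at h3
  have hchar : ∀ k, charFun (P.map fun ω => r • (X 0 ω + S k ω)) u =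
      charFun (densityMeasure pH) (r • u) * Complex.exp (-((∑ j ∈ Finset.range k, c k j ^ 2 *
        (((j + 1 : ℕ) * (t / k) : ℝ≥0) - (j * (t / k) : ℝ≥0) : ℝ)) * ‖r • u‖ ^ 2 / 2 : ℝ)) := by
    intro k
    have hind : IndepFun (X 0) (S k) P := by
      have := h.indep.comp (φ := id) (ψ := fun f : ℝ≥0 → EuclideanSpace ℝ (Fin n) =>
        ∑ j ∈ Finset.range k, c k j • (f ((j + 1 : ℕ) * (t / k)) - f (j * (t / k))))
        measurable_id (by fun_prop)
      exact this
    rw [charFun_map_smul_comp (hXS k).aemeasurable,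
      hind.charFun_map_fun_add_eq_mul (h.measurable 0).aemeasurable (hSm k).aemeasurable,
      Pi.mul_apply, h.initial,
      charFun_map_sum_increments h.brownian (c k) (hmono k) k]
  have hconv : Tendsto (fun k => charFun (P.map fun ω => r • (X 0 ω + S k ω)) u) atTop
      (𝓝 (charFun (P.map (X t)) u)) := by
    simp only [charFun_apply]
    rw [integral_map (h.measurable t).aemeasurable (by fun_prop)]
    have h5 : ∀ k, ∫ x, Complex.exp (⟪x, u⟫ * Complex.I) ∂(P.map fun ω => r • (X 0 ω + S k ω)) =
        ∫ ω, Complex.exp (⟪r • (X 0 ω + S k ω), u⟫ * Complex.I) ∂P := fun k =>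
      integral_map (hrXS k).aemeasurable (by fun_prop)
    simp_rw [h5]
    refine tendsto_integral_of_dominated_convergence (fun _ => 1) (fun k => ?_)
      (integrable_const _) (fun k => Eventually.of_forall fun ω => ?_) ?_
    · exact (hcont.measurable.comp (hrXS k)).aestronglyMeasurable
    · exact (Complex.norm_exp_ofReal_mul_I _).le
    · filter_upwards [hlim] with ω hω
      exact (hcont.tendsto _).comp hω
  refine tendsto_nhds_unique hconv ?_
  simp_rw [hchar]
  rw [charFun_densityMeasure_marginal hp hp0 hp1 ht']
  refine Tendsto.const_mul _ ?_
  -- The limiting variance `e^t - 1`, rescaled by `a(t)² = e^{-t}`, is `σ²(t)`.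
  have h6 : sigmaSq t * ‖u‖ ^ 2 = (Real.exp t - 1) * ‖r • u‖ ^ 2 := by
    have : r ^ 2 * Real.exp t = 1 := by
      rw [hr, coeffA, ← Real.exp_nat_mul, ← Real.exp_add]
      push_cast; ring_nf; exact Real.exp_zero
    have h7 := coeffA_sq t
    rw [← hr] at h7
    rw [norm_smul, mul_pow, Real.norm_eq_abs, sq_abs]
    linear_combination ‖u‖ ^ 2 * h7 - ‖u‖ ^ 2 * this
  rw [h6]
  exact (Complex.continuous_exp.tendsto _).comp ((Complex.continuous_ofReal.tendsto _).comp
    ((((tendsto_sum_exp_mul t ht).mul_const _).div_const 2))).neg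

/-! ### Convergence of the marginals in `L¹`, at infinity and at zero -/

/-- **Scheffé's lemma**: nonnegative integrable functions with a fixed integral which converge
almost everywhere converge in `L¹`. -/
theorem tendsto_eLpNorm_one_sub_of_tendsto_ae {α ι : Type*} [MeasurableSpace α] {μ : Measure α}
    {l : Filter ι} [l.IsCountablyGenerated] {f : ι → α → ℝ} {g : α → ℝ}
    (hf : ∀ᶠ i in l, Integrable (f i) μ) (hf0 : ∀ᶠ i in l, ∀ x, 0 ≤ f i x) (hg : Integrable g μ)
    (hg0 : ∀ x, 0 ≤ g x) (heq : ∀ᶠ i in l, ∫ x, f i x ∂μ = ∫ x, g x ∂μ)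
    (hlim : ∀ᵐ x ∂μ, Tendsto (fun i => f i x) l (𝓝 (g x))) :
    Tendsto (fun i => eLpNorm (fun x => f i x - g x) 1 μ) l (𝓝 0) := by
  -- The positive part of `g - f i` is dominated by `g`. Since the integrals of `f i` and `g` agree,
  -- the `L¹` distance is twice the integral of this positive part.
  have h1 : Tendsto (fun i => ∫ x, max (g x - f i x) 0 ∂μ) l (𝓝 (∫ _, (0 : ℝ) ∂μ)) := by
    refine tendsto_integral_filter_of_dominated_convergence g ?_ ?_ hg ?_
    · filter_upwards [hf] with i hi
      exact (hg.sub hi).pos_part.aestronglyMeasurable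
    · filter_upwards [hf0] with i hi
      refine Eventually.of_forall fun x => ?_
      rw [Real.norm_of_nonneg (le_max_right _ _)]
      exact max_le (by linarith [hi x]) (hg0 x)
    · filter_upwards [hlim] with x hx
      have := (tendsto_const_nhds (x := g x)).sub hx |>.max (tendsto_const_nhds (x := (0 : ℝ)))
      simpa using this
  rw [integral_zero] at h1
  have h2 := ENNReal.tendsto_ofReal (h1.const_mul 2)
  rw [mul_zero, ENNReal.ofReal_zero] at h2
  refine h2.congr' ?_
  filter_upwards [hf, heq] with i hi hie
  have h4 := ofReal_integral_norm_eq_lintegral_enorm (hi.sub hg)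
  simp only [Pi.sub_apply] at h4
  rw [eLpNorm_one_eq_lintegral_enorm, ← h4]
  congr 1
  have h3 : ∀ x, ‖f i x - g x‖ = (f i x - g x) + 2 * max (g x - f i x) 0 := fun x => by
    rw [Real.norm_eq_abs]
    rcases le_total (f i x) (g x) with h | h
    · rw [abs_of_nonpos (by linarith), max_eq_left (by linarith)]; ring
    · rw [abs_of_nonneg (by linarith), max_eq_right (by linarith)]; ring
  simp_rw [h3]
  have h5 : Integrable (fun x => max (g x - f i x) 0) μ := (hg.sub hi).pos_part
  have h6 : Integrable (fun x => f i x - g x) μ := hi.sub hg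
  rw [integral_add h6 (h5.const_mul 2), integral_sub hi hg, hie, sub_self, zero_add,
    integral_const_mul]

theorem tendsto_sigmaSq_atTop : Tendsto sigmaSq atTop (𝓝 1) := by
  have : Tendsto (fun t : ℝ => Real.exp (-t)) atTop (𝓝 0) := Real.tendsto_exp_neg_atTop_nhds_zero
  have h := this.const_sub 1
  rw [sub_zero] at h
  exact h

theorem tendsto_coeffA_atTop : Tendsto coeffA atTop (𝓝 0) := by
  have h : Tendsto (fun t : ℝ => t / 2) atTop atTop := tendsto_id.atTop_div_const two_pos
  refine (Real.tendsto_exp_neg_atTop_nhds_zero.comp h).congr fun t => ?_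
  simp [coeffA, neg_div]

theorem continuousAt_gaussianDensity {v : ℝ} (hv : 0 < v) (μ x : EuclideanSpace ℝ (Fin n)) :
    ContinuousAt (fun q : ℝ × EuclideanSpace ℝ (Fin n) => gaussianDensity q.1 q.2 x) (v, μ) := by
  have h1 : ContinuousAt (fun q : ℝ × EuclideanSpace ℝ (Fin n) => 2 * Real.pi * q.1) (v, μ) := by
    fun_prop
  refine ContinuousAt.mul (h1.rpow_const (Or.inl (by positivity))) ?_
  refine Real.continuous_exp.continuousAt.comp (ContinuousAt.div (by fun_prop) (by fun_prop) ?_)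
  simp [hv.ne']

/-- The kernel forgets `y` as `a → 0` and `σ² → 1`; once `σ² > 1/2` its peak value is bounded
uniformly in `t`. -/
theorem tendsto_marginal_atTop (hp : Integrable pH) (hp1 : ∫ x, pH x = 1)
    (x : EuclideanSpace ℝ (Fin n)) :
    Tendsto (fun t => marginal pH t x) atTop (𝓝 (gaussianDensity 1 0 x)) := by
  have h0 : gaussianDensity 1 0 x = ∫ y, pH y * gaussianDensity 1 0 x := by
    rw [integral_mul_const, hp1, one_mul]
  have hpos : ∀ᶠ t : ℝ in atTop, 1 / 2 < sigmaSq t :=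
    tendsto_sigmaSq_atTop.eventually_const_lt (by norm_num)
  rw [h0]
  refine tendsto_integral_filter_of_dominated_convergence
    (fun y => ‖pH y‖ * (2 * Real.pi * (1 / 2)) ^ (-(n : ℝ) / 2)) ?_ ?_ (hp.norm.mul_const _) ?_
  · filter_upwards [eventually_gt_atTop 0] with t ht
    exact (integrable_mul_gaussianDensity hp ht x).aestronglyMeasurable
  · filter_upwards [hpos] with t ht
    refine Eventually.of_forall fun y => ?_
    have ht0 : 0 < sigmaSq t := by linarith
    rw [norm_mul, Real.norm_of_nonneg (gaussianDensity_nonneg ht0 _ _)]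
    refine mul_le_mul_of_nonneg_left ((gaussianDensity_le ht0 _ _).trans ?_) (norm_nonneg _)
    refine Real.rpow_le_rpow_of_nonpos (by positivity) (by gcongr) ?_
    rw [neg_div]; exact neg_nonpos.2 (by positivity)
  · refine Eventually.of_forall fun y => Tendsto.const_mul _ ?_
    have h1 : Tendsto (fun t => coeffA t • y) atTop (𝓝 0) := by
      simpa using tendsto_coeffA_atTop.smul_const y
    have h2 : Tendsto (fun t => (sigmaSq t, coeffA t • y)) atTop
        (𝓝 ((1 : ℝ), (0 : EuclideanSpace ℝ (Fin n)))) := tendsto_sigmaSq_atTop.prodMk_nhds h1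
    have h3 : Tendsto (fun q : ℝ × EuclideanSpace ℝ (Fin n) => gaussianDensity q.1 q.2 x)
        (𝓝 ((1 : ℝ), (0 : EuclideanSpace ℝ (Fin n)))) (𝓝 (gaussianDensity 1 0 x)) :=
      continuousAt_gaussianDensity one_pos 0 x
    have h4 : Tendsto (fun t => gaussianDensity (sigmaSq t) (coeffA t • y) x) atTop
        (𝓝 (gaussianDensity 1 0 x)) := by
      simpa only [Function.comp_def] using h3.comp h2
    exact h4

theorem tendsto_eLpNorm_marginal_sub_gaussianDensity (hp : Integrable pH) (hp0 : ∀ x, 0 ≤ pH x)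
    (hp1 : ∫ x, pH x = 1) :
    Tendsto (fun t => eLpNorm (fun x => marginal pH t x - gaussianDensity 1 0 x) 1 volume)
      atTop (𝓝 0) := by
  obtain ⟨h1, h2⟩ := integral_gaussianDensity (n := n) one_pos 0
  refine tendsto_eLpNorm_one_sub_of_tendsto_ae ?_ ?_ h1 (gaussianDensity_nonneg one_pos 0) ?_
    (Eventually.of_forall (tendsto_marginal_atTop hp hp1))
  all_goals filter_upwards [eventually_gt_atTop 0] with t ht
  · exact (integral_marginal hp hp0 ht).1
  · exact marginal_nonneg hp0 ht
  · rw [(integral_marginal hp hp0 ht).2, hp1, h2]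

/-- The operator `p ↦ p_t` is positive and preserves mass, hence contracts `L¹`: `|p_t - q_t| ≤ |p -
q|_t`. -/
theorem eLpNorm_marginal_sub_le {p q : EuclideanSpace ℝ (Fin n) → ℝ} (hp : Integrable p)
    (hq : Integrable q) {t : ℝ} (ht : 0 < t) :
    eLpNorm (fun x => marginal p t x - marginal q t x) 1 volume ≤
      eLpNorm (fun x => p x - q x) 1 volume := by
  have hpq : Integrable fun x => ‖p x - q x‖ := (hp.sub hq).norm
  obtain ⟨h1, h2⟩ := integral_marginal hpq (fun x => norm_nonneg _) ht
  have h3 : ∀ x, ‖marginal p t x - marginal q t x‖ ≤ marginal (fun x => ‖p x - q x‖) t x := by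
    intro x
    rw [marginal, marginal, ← integral_sub (integrable_mul_gaussianDensity hp ht x)
      (integrable_mul_gaussianDensity hq ht x)]
    refine (norm_integral_le_integral_norm _).trans_eq ?_
    rw [marginal]
    congr 1; ext y
    rw [← sub_mul, norm_mul, Real.norm_of_nonneg (gaussianDensity_nonneg (sigmaSq_pos ht) _ _)]
  calc eLpNorm (fun x => marginal p t x - marginal q t x) 1 volume
      ≤ eLpNorm (marginal (fun x => ‖p x - q x‖) t) 1 volume := eLpNorm_mono_real h3
    _ = eLpNorm (fun x => ‖p x - q x‖) 1 volume := by
        rw [eLpNorm_one_eq_lintegral_enorm, eLpNorm_one_eq_lintegral_enorm,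
          ← ofReal_integral_norm_eq_lintegral_enorm h1,
          ← ofReal_integral_norm_eq_lintegral_enorm hpq]
        simp_rw [norm_norm, Real.norm_of_nonneg (marginal_nonneg (fun x => norm_nonneg _) ht _), h2]
    _ = eLpNorm (fun x => p x - q x) 1 volume := eLpNorm_norm _

/-- The substitution `y = (x - σ z) / a` moves the dependence on `t` from the kernel, which
degenerates as `t → 0`, to the argument of `p`. -/
theorem marginal_eq_integral_comp {p : EuclideanSpace ℝ (Fin n) → ℝ} {t : ℝ} (ht : 0 < t)
    (x : EuclideanSpace ℝ (Fin n)) :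
    marginal p t x = ∫ z, (coeffA t)⁻¹ ^ n * (gaussianDensity 1 0 z *
      p ((coeffA t)⁻¹ • x - (√(sigmaSq t) / coeffA t) • z)) := by
  have ha := coeffA_pos t
  have hσ := sigmaSq_pos ht
  have hs : 0 < √(sigmaSq t) := Real.sqrt_pos.2 hσ
  set a := coeffA t
  set c := √(sigmaSq t) / a with hc
  have hc0 : 0 < c := div_pos hs ha
  set F : EuclideanSpace ℝ (Fin n) → ℝ := fun y => p y * gaussianDensity (sigmaSq t) (a • y) x
  have h1 := Measure.integral_comp_smul volume (fun y => F (a⁻¹ • x - y)) c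
  rw [integral_sub_left_eq_self F volume (a⁻¹ • x), finrank_euclideanSpace_fin, smul_eq_mul,
    abs_of_nonneg (by positivity)] at h1
  have h2 : marginal p t x = c ^ n * ∫ z, F (a⁻¹ • x - c • z) := by
    rw [h1, ← mul_assoc, mul_inv_cancel₀ (by positivity), one_mul]; rfl
  rw [h2, ← integral_const_mul]
  congr 1; ext z
  have h3 : x - a • (a⁻¹ • x - c • z) = √(sigmaSq t) • z := by
    rw [smul_sub, smul_smul, smul_smul, mul_inv_cancel₀ ha.ne', hc, mul_div_cancel₀ _ ha.ne']
    module
  have h4 : gaussianDensity (sigmaSq t) (a • (a⁻¹ • x - c • z)) x =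
      (√(sigmaSq t))⁻¹ ^ n * gaussianDensity 1 0 z := by
    rw [gaussianDensity, h3, gaussianDensity, norm_smul, mul_pow, Real.norm_of_nonneg hs.le,
      Real.sq_sqrt hσ.le, Real.mul_rpow (by positivity) hσ.le, mul_one, sub_zero]
    have h5 : sigmaSq t ^ (-(n : ℝ) / 2) = (√(sigmaSq t))⁻¹ ^ n := by
      rw [Real.sqrt_eq_rpow, ← Real.rpow_neg hσ.le, ← Real.rpow_natCast, ← Real.rpow_mul hσ.le]
      congr 1; ring
    rw [h5]
    have h6 : -(sigmaSq t * ‖z‖ ^ 2) / (2 * sigmaSq t) = -‖z‖ ^ 2 / (2 * 1) := by field_simp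
    rw [h6]; ring
  simp only [F]
  rw [h4, hc, div_pow, inv_pow, inv_pow]
  have := pow_pos hs n
  generalize p _ = r
  field_simp

theorem tendsto_eLpNorm_marginal_sub_of_hasCompactSupport {f : EuclideanSpace ℝ (Fin n) → ℝ}
    (hf : Continuous f) (hfs : HasCompactSupport f) (hf0 : ∀ x, 0 ≤ f x) :
    Tendsto (fun t => eLpNorm (fun x => marginal f t x - f x) 1 volume) (𝓝[>] 0) (𝓝 0) := by
  have hfi : Integrable f := hf.integrable_of_hasCompactSupport hfs
  obtain ⟨C, hC⟩ := hfs.exists_bound_of_continuous hf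
  obtain ⟨h1, h2⟩ := integral_gaussianDensity (n := n) one_pos 0
  have hca : Continuous coeffA := by unfold coeffA; fun_prop
  have hcσ : Continuous sigmaSq := by unfold sigmaSq; fun_prop
  have ha0 : coeffA 0 = 1 := by simp [coeffA]
  have hσ0 : sigmaSq 0 = 0 := by simp [sigmaSq]
  have hne : ∀ t, coeffA t ≠ 0 := fun t => (coeffA_pos t).ne'
  have hinv : Continuous fun t => (coeffA t)⁻¹ := hca.inv₀ hne
  refine tendsto_eLpNorm_one_sub_of_tendsto_ae ?_ ?_ hfi hf0 ?_ (Eventually.of_forall fun x => ?_)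
  · filter_upwards [self_mem_nhdsWithin] with t ht
    exact (integral_marginal hfi hf0 ht).1
  · filter_upwards [self_mem_nhdsWithin] with t ht
    exact marginal_nonneg hf0 ht
  · filter_upwards [self_mem_nhdsWithin] with t ht
    exact (integral_marginal hfi hf0 ht).2
  · have h3 : f x = ∫ z, gaussianDensity 1 (0 : EuclideanSpace ℝ (Fin n)) z * f x := by
      rw [integral_mul_const, h2, one_mul]
    have hev : ∀ᶠ t in 𝓝[>] (0 : ℝ), (coeffA t)⁻¹ ^ n < 2 :=
      ((hinv.pow n).continuousAt.tendsto.mono_left nhdsWithin_le_nhds).eventually_lt_const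
        (by simp [ha0])
    rw [h3]
    have h4 : Tendsto (fun t => ∫ z, (coeffA t)⁻¹ ^ n * (gaussianDensity 1 0 z *
        f ((coeffA t)⁻¹ • x - (√(sigmaSq t) / coeffA t) • z))) (𝓝[>] 0)
        (𝓝 (∫ z, gaussianDensity 1 (0 : EuclideanSpace ℝ (Fin n)) z * f x)) := by
      refine tendsto_integral_filter_of_dominated_convergence
        (fun z => 2 * (gaussianDensity 1 0 z * C)) ?_ ?_ ((h1.mul_const C).const_mul 2) ?_
      · refine Eventually.of_forall fun t => Continuous.aestronglyMeasurable ?_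
        have := continuous_gaussianDensity_right (n := n) 1 0
        fun_prop
      · filter_upwards [hev] with t ht
        refine Eventually.of_forall fun z => ?_
        have ha := coeffA_pos t
        rw [norm_mul, norm_mul, Real.norm_of_nonneg (by positivity : 0 ≤ (coeffA t)⁻¹ ^ n),
          Real.norm_of_nonneg (gaussianDensity_nonneg one_pos 0 z)]
        have := gaussianDensity_nonneg one_pos 0 z
        gcongr
        exact hC _
      · refine Eventually.of_forall fun z => ?_
        -- For fixed `z` the integrand is continuous in `t` up to `t = 0`, where `a = 1` and `σ² =
        -- 0` leave `gaussianDensity 1 0 z * f x`.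
        have hc : Continuous fun t => (coeffA t)⁻¹ ^ n * (gaussianDensity 1 0 z *
            f ((coeffA t)⁻¹ • x - (√(sigmaSq t) / coeffA t) • z)) := by
          have : Continuous fun t => √(sigmaSq t) / coeffA t := hcσ.sqrt.div hca hne
          fun_prop
        have := (hc.tendsto 0).mono_left (nhdsWithin_le_nhds (s := Ioi 0))
        simpa [ha0, hσ0] using this
    refine h4.congr' ?_
    filter_upwards [self_mem_nhdsWithin] with t ht
    exact (marginal_eq_integral_comp ht x).symm

theorem eLpNorm_one_sub_triangle {α : Type*} [MeasurableSpace α] {μ : Measure α} {f g h : α → ℝ}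
    (hf : AEStronglyMeasurable f μ) (hg : AEStronglyMeasurable g μ)
    (hh : AEStronglyMeasurable h μ) :
    eLpNorm (fun x => f x - h x) 1 μ ≤
      eLpNorm (fun x => f x - g x) 1 μ + eLpNorm (fun x => g x - h x) 1 μ := by
  refine le_trans (le_of_eq ?_) (eLpNorm_add_le (hf.sub hg) (hg.sub hh) le_rfl)
  congr 1; ext x; simp

theorem eLpNorm_one_sub_comm {α : Type*} [MeasurableSpace α] {μ : Measure α} (f g : α → ℝ) :
    eLpNorm (fun x => f x - g x) 1 μ = eLpNorm (fun x => g x - f x) 1 μ :=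
  eLpNorm_sub_comm f g 1 μ

/-- The marginal densities converge to the initial density in `L¹` as `t → 0`. -/
theorem tendsto_eLpNorm_marginal_sub (hp : Integrable pH) (hp0 : ∀ x, 0 ≤ pH x) :
    Tendsto (fun t => eLpNorm (fun x => pH x - marginal pH t x) 1 volume) (𝓝[>] 0) (𝓝 0) := by
  refine ENNReal.tendsto_nhds_zero.2 fun ε hε => ?_
  have hε4 : ε / 4 ≠ 0 := (ENNReal.div_pos hε.ne' (by norm_num)).ne'
  obtain ⟨g, hgs, hg, hgc, hgi⟩ := hp.exists_hasCompactSupport_lintegral_sub_le hε4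
  -- Scheffé's lemma needs a nonnegative density; as `pH ≥ 0`, taking the positive part of `g` does
  -- not increase the distance to `pH`.
  set f : EuclideanSpace ℝ (Fin n) → ℝ := fun x => max (g x) 0 with hf
  have hfc : Continuous f := hgc.max continuous_const
  have hfs : HasCompactSupport f := hgs.comp_left (g := fun r : ℝ => max r 0) (by simp)
  have hfi : Integrable f := hfc.integrable_of_hasCompactSupport hfs
  have hd : eLpNorm (fun x => pH x - f x) 1 volume ≤ ε / 4 := by
    rw [eLpNorm_one_eq_lintegral_enorm]
    refine (lintegral_mono fun x => ?_).trans hg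
    rw [enorm_le_iff_norm_le, Real.norm_eq_abs, Real.norm_eq_abs]
    have := abs_max_sub_max_le_abs (pH x) (g x) 0
    rwa [max_eq_left (hp0 x)] at this
  have hlim := ENNReal.tendsto_nhds_zero.1
    (tendsto_eLpNorm_marginal_sub_of_hasCompactSupport hfc hfs fun x => le_max_right _ _) (ε / 4)
    hε4.bot_lt
  filter_upwards [hlim, self_mem_nhdsWithin] with t ht ht0
  have m1 := (integral_marginal hp hp0 ht0).1.aestronglyMeasurable
  have m2 := (integral_marginal hfi (fun x => le_max_right _ _) ht0).1.aestronglyMeasurable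
  calc eLpNorm (fun x => pH x - marginal pH t x) 1 volume
      ≤ eLpNorm (fun x => pH x - f x) 1 volume +
        eLpNorm (fun x => f x - marginal pH t x) 1 volume :=
        eLpNorm_one_sub_triangle hp.aestronglyMeasurable hfi.aestronglyMeasurable m1
    _ ≤ eLpNorm (fun x => pH x - f x) 1 volume +
        (eLpNorm (fun x => f x - marginal f t x) 1 volume +
        eLpNorm (fun x => marginal f t x - marginal pH t x) 1 volume) := by
        gcongr
        exact eLpNorm_one_sub_triangle hfi.aestronglyMeasurable m2 m1
    _ ≤ ε / 4 + (ε / 4 + ε / 4) := by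
        gcongr
        · rwa [eLpNorm_one_sub_comm]
        · refine (eLpNorm_marginal_sub_le hfi hp ht0).trans ?_
          rwa [eLpNorm_one_sub_comm]
    _ ≤ ε / 4 + (ε / 4 + ε / 4) + ε / 4 := le_self_add
    _ = ε := by
        rw [← ENNReal.add_div, ← ENNReal.add_div, ← ENNReal.add_div]
        rw [show ε + (ε + ε) + ε = ε * 4 by ring, ENNReal.mul_div_cancel_right (by norm_num)
          (by norm_num)]

/-! ### Relative entropy of the marginals -/

/-- An upper bound for the relative entropy from an upper bound for the log-likelihood ratio. -/
theorem klDiv_withDensity_le {α : Type*} [MeasurableSpace α] {ν : Measure α}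
    [IsProbabilityMeasure ν] {r B : α → ℝ} (hr : Measurable r) (hr0 : ∀ x, 0 ≤ r x)
    (hr1 : ∫⁻ x, ENNReal.ofReal (r x) ∂ν = 1) (hB0 : ∀ x, 0 ≤ B x)
    (hB : ∀ x, Real.log (r x) ≤ B x) :
    InformationTheory.klDiv (ν.withDensity fun x => ENNReal.ofReal (r x)) ν ≤
      ∫⁻ x, ENNReal.ofReal (r x * B x) ∂ν := by
  have i1 : IsProbabilityMeasure (ν.withDensity fun x => ENNReal.ofReal (r x)) :=
    ⟨by rw [withDensity_apply _ MeasurableSet.univ, Measure.restrict_univ, hr1]⟩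
  rw [InformationTheory.klDiv_eq_lintegral_klFun_of_ac (withDensity_absolutelyContinuous _ _)]
  have h1 : ∫⁻ x, ENNReal.ofReal (InformationTheory.klFun
      ((ν.withDensity fun x => ENNReal.ofReal (r x)).rnDeriv ν x).toReal) ∂ν =
      ∫⁻ x, ENNReal.ofReal (InformationTheory.klFun (r x)) ∂ν := by
    refine lintegral_congr_ae ?_
    filter_upwards [Measure.rnDeriv_withDensity ν hr.ennreal_ofReal] with x hx
    rw [hx, ENNReal.toReal_ofReal (hr0 x)]
  rw [h1]
  -- Adding `∫ r dν = 1` to both sides avoids subtraction in `ℝ≥0∞`: pointwise `klFun r + r = r log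
  -- r + 1 ≤ r B + 1`.
  refine (ENNReal.add_le_add_iff_right ENNReal.one_ne_top).1 ?_
  nth_rewrite 1 [← hr1]
  rw [← lintegral_add_right _ hr.ennreal_ofReal]
  have h2 : ∫⁻ x, (ENNReal.ofReal (r x * B x) + 1) ∂ν =
      ∫⁻ x, ENNReal.ofReal (r x * B x) ∂ν + 1 := by
    rw [lintegral_add_right _ measurable_const, lintegral_one, measure_univ]
  rw [← h2]
  refine lintegral_mono fun x => ?_
  rw [← ENNReal.ofReal_add (InformationTheory.klFun_nonneg (hr0 x)) (hr0 x), ← ENNReal.ofReal_one,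
    ← ENNReal.ofReal_add (mul_nonneg (hr0 x) (hB0 x)) zero_le_one]
  refine ENNReal.ofReal_le_ofReal ?_
  rw [InformationTheory.klFun_apply]
  linarith [mul_le_mul_of_nonneg_left (hB x) (hr0 x)]

theorem sigmaSq_le_one (t : ℝ) : sigmaSq t ≤ 1 :=
  sub_le_self _ (Real.exp_nonneg _)

theorem log_gaussianDensity {v : ℝ} (hv : 0 < v) (μ x : EuclideanSpace ℝ (Fin n)) :
    Real.log (gaussianDensity v μ x) =
      -(n : ℝ) / 2 * Real.log (2 * Real.pi * v) - ‖x - μ‖ ^ 2 / (2 * v) := by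
  rw [gaussianDensity, Real.log_mul (by positivity) (by positivity), Real.log_exp,
    Real.log_rpow (by positivity)]
  ring

/-- With `w = ‖x - a y‖` and `s = ‖y‖`, `v ≤ 1` gives `(w + a s)² / 2 - w² / (2v) ≤ a w s + a² s² /
2`; then `2 w s ≤ w² + s²` and `a² ≤ a` suffice. The coefficients tend to zero as `a → 0` and `v →
1`. -/
theorem log_gaussianDensity_div_le {v a : ℝ} (hv : 0 < v) (hv1 : v ≤ 1) (ha : 0 ≤ a)
    (ha1 : a ≤ 1) (y x : EuclideanSpace ℝ (Fin n)) :
    Real.log (gaussianDensity v (a • y) x / gaussianDensity 1 0 x) ≤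
      -((n : ℝ) / 2 * Real.log v) + a * ‖y‖ ^ 2 + a / 2 * ‖x - a • y‖ ^ 2 := by
  rw [Real.log_div (gaussianDensity_pos hv _ _).ne' (gaussianDensity_pos one_pos _ _).ne',
    log_gaussianDensity hv, log_gaussianDensity one_pos, Real.log_mul (by positivity) hv.ne',
    mul_one, mul_one, sub_zero]
  have h1 : ‖x‖ ≤ ‖x - a • y‖ + a * ‖y‖ := by
    have := norm_add_le (x - a • y) (a • y)
    rwa [sub_add_cancel, norm_smul, Real.norm_of_nonneg ha] at this
  have h2 : ‖x‖ ^ 2 ≤ (‖x - a • y‖ + a * ‖y‖) ^ 2 := by gcongr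
  have h3 : ‖x - a • y‖ ^ 2 / 2 ≤ ‖x - a • y‖ ^ 2 / (2 * v) := by
    gcongr; linarith
  generalize ‖x - a • y‖ = w at *
  generalize ‖y‖ = s at *
  have h4 : a ^ 2 * s ^ 2 ≤ a * s ^ 2 :=
    mul_le_mul_of_nonneg_right (by nlinarith) (sq_nonneg s)
  nlinarith [mul_nonneg ha (sq_nonneg (w - s))]

theorem gaussianDensity_zero_le {v : ℝ} (hv : 0 < v) (hv1 : v ≤ 1)
    (x : EuclideanSpace ℝ (Fin n)) :
    gaussianDensity v 0 x ≤ v ^ (-(n : ℝ) / 2) * gaussianDensity 1 0 x := by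
  rw [gaussianDensity, gaussianDensity, Real.mul_rpow (by positivity) hv.le, mul_one, mul_one,
    mul_comm ((2 * Real.pi) ^ _), mul_assoc]
  gcongr ?_ * (_ * Real.exp ?_)
  rw [neg_div, neg_div, neg_le_neg_iff]
  gcongr; linarith

theorem lintegral_gaussianDensity {v : ℝ} (hv : 0 < v) (μ : EuclideanSpace ℝ (Fin n)) :
    ∫⁻ x, ENNReal.ofReal (gaussianDensity v μ x) = 1 := by
  obtain ⟨h1, h2⟩ := integral_gaussianDensity hv μ
  rw [← ofReal_integral_eq_lintegral_ofReal h1 (Eventually.of_forall (gaussianDensity_nonneg hv μ)),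
    h2, ENNReal.ofReal_one]

theorem lintegral_densityMeasure {p : EuclideanSpace ℝ (Fin n) → ℝ} (hp : AEMeasurable p)
    (f : EuclideanSpace ℝ (Fin n) → ℝ≥0∞) :
    ∫⁻ x, f x ∂densityMeasure p = ∫⁻ x, ENNReal.ofReal (p x) * f x :=
  lintegral_withDensity_eq_lintegral_mul_non_measurable₀ _ hp.ennreal_ofReal
    (Eventually.of_forall fun _ => ENNReal.ofReal_lt_top) f

theorem lintegral_stdGaussian (f : EuclideanSpace ℝ (Fin n) → ℝ≥0∞) :
    ∫⁻ x, f x ∂stdGaussian (EuclideanSpace ℝ (Fin n)) =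
      ∫⁻ x, ENNReal.ofReal (gaussianDensity 1 0 x) * f x := by
  rw [stdGaussian_eq_densityMeasure, lintegral_densityMeasure
    (continuous_gaussianDensity_right 1 0).measurable.aemeasurable]

theorem lintegral_sq_norm_stdGaussian_lt_top :
    ∫⁻ x, ENNReal.ofReal (‖x‖ ^ 2) ∂stdGaussian (EuclideanSpace ℝ (Fin n)) < ∞ := by
  have h : MemLp id 2 (stdGaussian (EuclideanSpace ℝ (Fin n))) := IsGaussian.memLp_two_id
  have h1 : Integrable (fun x => ‖x‖ ^ 2) (stdGaussian (EuclideanSpace ℝ (Fin n))) :=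
    h.norm.integrable_sq
  have := h1.2
  rwa [hasFiniteIntegral_iff_ofReal (Eventually.of_forall fun x => by positivity)] at this

/-- Comparison with the standard Gaussian replaces the exact variance; the crude factor is harmless,
since this term later carries a coefficient `a / 2 → 0`. -/
theorem lintegral_sq_norm_mul_gaussianDensity_le {v : ℝ} (hv : 0 < v) (hv1 : v ≤ 1)
    (μ : EuclideanSpace ℝ (Fin n)) :
    ∫⁻ x, ENNReal.ofReal (gaussianDensity v μ x) * ENNReal.ofReal (‖x - μ‖ ^ 2) ≤
      ENNReal.ofReal (v ^ (-(n : ℝ) / 2)) *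
        ∫⁻ x, ENNReal.ofReal (‖x‖ ^ 2) ∂stdGaussian (EuclideanSpace ℝ (Fin n)) := by
  have h1 := lintegral_sub_right_eq_self (μ := volume) (fun x : EuclideanSpace ℝ (Fin n) =>
    ENNReal.ofReal (gaussianDensity v 0 x) * ENNReal.ofReal (‖x‖ ^ 2)) μ
  simp_rw [gaussianDensity_eq_sub v μ]
  rw [h1, lintegral_stdGaussian, ← lintegral_const_mul' _ _ ENNReal.ofReal_ne_top]
  refine lintegral_mono fun x => ?_
  rw [← mul_assoc, ← ENNReal.ofReal_mul (by positivity : 0 ≤ v ^ (-(n : ℝ) / 2))]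
  gcongr
  exact gaussianDensity_zero_le hv hv1 x

/-- A Gaussian bound for the relative entropy of the marginal law. -/
theorem klDiv_densityMeasure_marginal_le (hp : Integrable pH) (hp0 : ∀ x, 0 ≤ pH x)
    (hp1 : ∫ x, pH x = 1) {t : ℝ} (ht : 0 < t) :
    InformationTheory.klDiv (densityMeasure (marginal pH t))
        (stdGaussian (EuclideanSpace ℝ (Fin n))) ≤
      ENNReal.ofReal (-((n : ℝ) / 2 * Real.log (sigmaSq t))) +
        ENNReal.ofReal (coeffA t) * ∫⁻ y, ENNReal.ofReal (‖y‖ ^ 2) ∂densityMeasure pH +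
        ENNReal.ofReal (coeffA t / 2) * (ENNReal.ofReal (sigmaSq t ^ (-(n : ℝ) / 2)) *
          ∫⁻ x, ENNReal.ofReal (‖x‖ ^ 2) ∂stdGaussian (EuclideanSpace ℝ (Fin n))) := by
  have i1 := isProbabilityMeasure_densityMeasure hp hp0 hp1
  have ha := coeffA_pos t
  have hσ := sigmaSq_pos ht
  have hσ1 := sigmaSq_le_one t
  have ha1 : coeffA t ≤ 1 := Real.exp_le_one_iff.2 (by linarith)
  set a := coeffA t
  set v := sigmaSq t
  set C := -((n : ℝ) / 2 * Real.log v) with hC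
  have hC0 : 0 ≤ C := by
    have := mul_nonpos_of_nonneg_of_nonpos (by positivity : (0 : ℝ) ≤ n / 2)
      (Real.log_nonpos hσ.le hσ1)
    linarith
  -- The ratio `r` below is the density, relative to `ν`, of the joint law of `(X_0, X_t)`. Its
  -- second projection is the marginal law, so the data processing inequality avoids estimating the
  -- logarithm of a mixture.
  set ν := (densityMeasure pH).prod (stdGaussian (EuclideanSpace ℝ (Fin n)))
  set k : EuclideanSpace ℝ (Fin n) → EuclideanSpace ℝ (Fin n) → ℝ :=
    fun y x => gaussianDensity v (a • y) x with hk
  set g : EuclideanSpace ℝ (Fin n) → ℝ := gaussianDensity 1 0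
  have hg0 : ∀ x, 0 < g x := gaussianDensity_pos one_pos 0
  have hk0 : ∀ y x, 0 ≤ k y x := fun y x => gaussianDensity_nonneg hσ _ _
  have hkm : ∀ y, Measurable (k y) := fun y => (continuous_gaussianDensity_right v _).measurable
  set r : EuclideanSpace ℝ (Fin n) × EuclideanSpace ℝ (Fin n) → ℝ :=
    fun q => k q.1 q.2 / g q.2 with hr
  have hrm : Measurable r := by
    refine Measurable.div ?_ ?_
    · exact Continuous.measurable (by simp only [hk]; unfold gaussianDensity; fun_prop)
    · exact (continuous_gaussianDensity_right 1 0).measurable.comp measurable_snd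
  have hr0 : ∀ q, 0 ≤ r q := fun q => div_nonneg (hk0 _ _) (hg0 _).le
  have key : ∀ f : EuclideanSpace ℝ (Fin n) → EuclideanSpace ℝ (Fin n) → ℝ≥0∞,
      Measurable (Function.uncurry f) →
      ∫⁻ q, ENNReal.ofReal (r q) * f q.1 q.2 ∂ν =
        ∫⁻ y, (∫⁻ x, ENNReal.ofReal (k y x) * f y x) ∂densityMeasure pH := by
    intro f hf
    have hrf : Measurable fun q => ENNReal.ofReal (r q) * f q.1 q.2 := hrm.ennreal_ofReal.mul hf
    rw [lintegral_prod _ hrf.aemeasurable]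
    refine lintegral_congr fun y => ?_
    rw [lintegral_stdGaussian]
    refine lintegral_congr fun x => ?_
    rw [← mul_assoc, ← ENNReal.ofReal_mul (hg0 x).le, mul_div_cancel₀ _ (hg0 x).ne']
  have hr1 : ∫⁻ q, ENNReal.ofReal (r q) ∂ν = 1 := by
    have := key (fun _ _ => 1) measurable_const
    simp only [mul_one] at this
    rw [this]
    simp only [hk, lintegral_gaussianDensity hσ, lintegral_one, measure_univ]
  have hmap1 : (ν.withDensity fun q => ENNReal.ofReal (r q)).map Prod.snd =
      densityMeasure (marginal pH t) := by
    refine Measure.ext_of_lintegral _ fun f hf => ?_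
    have hf2 : Measurable fun q : EuclideanSpace ℝ (Fin n) × EuclideanSpace ℝ (Fin n) => f q.2 :=
      hf.comp measurable_snd
    rw [lintegral_map hf measurable_snd,
      lintegral_withDensity_eq_lintegral_mul _ hrm.ennreal_ofReal hf2,
      lintegral_densityMeasure (measurable_marginal hp ht).aemeasurable]
    refine (key (fun _ x => f x) (hf.comp measurable_snd)).trans ?_
    rw [lintegral_densityMeasure hp.aestronglyMeasurable.aemeasurable]
    exact (lintegral_densityMeasure_marginal hp hp0 ht hf).symm
  have hmap2 : ν.map Prod.snd = stdGaussian (EuclideanSpace ℝ (Fin n)) := by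
    rw [Measure.map_snd_prod, measure_univ, one_smul]
  have hB : ∀ q : EuclideanSpace ℝ (Fin n) × EuclideanSpace ℝ (Fin n), Real.log (r q) ≤
      C + a * ‖q.1‖ ^ 2 + a / 2 * ‖q.2 - a • q.1‖ ^ 2 := fun q =>
    log_gaussianDensity_div_le hσ hσ1 ha.le ha1 q.1 q.2
  have i2 : IsProbabilityMeasure (ν.withDensity fun q => ENNReal.ofReal (r q)) :=
    ⟨by rw [withDensity_apply _ MeasurableSet.univ, Measure.restrict_univ, hr1]⟩
  have hdp := InformationTheory.klDiv_map_le (ν.withDensity fun q => ENNReal.ofReal (r q)) ν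
    measurable_snd
  rw [hmap1, hmap2] at hdp
  refine hdp.trans ((klDiv_withDensity_le hrm hr0 hr1 (fun q => by positivity) hB).trans ?_)
  have hf : Measurable (Function.uncurry fun y x : EuclideanSpace ℝ (Fin n) =>
      ENNReal.ofReal (C + a * ‖y‖ ^ 2 + a / 2 * ‖x - a • y‖ ^ 2)) := by
    unfold Function.uncurry; fun_prop
  have h1 := key _ hf
  refine (lintegral_congr fun q => ENNReal.ofReal_mul (hr0 q)).trans_le ?_
  rw [h1, ← lintegral_const_mul' _ _ ENNReal.ofReal_ne_top]
  have h2 : ∀ y, ∫⁻ x, ENNReal.ofReal (k y x) *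
      ENNReal.ofReal (C + a * ‖y‖ ^ 2 + a / 2 * ‖x - a • y‖ ^ 2) ≤
      ENNReal.ofReal C + ENNReal.ofReal a * ENNReal.ofReal (‖y‖ ^ 2) +
        ENNReal.ofReal (a / 2) * (ENNReal.ofReal (v ^ (-(n : ℝ) / 2)) *
          ∫⁻ x, ENNReal.ofReal (‖x‖ ^ 2) ∂stdGaussian (EuclideanSpace ℝ (Fin n))) := by
    intro y
    have h3 : ∀ x, ENNReal.ofReal (k y x) *
        ENNReal.ofReal (C + a * ‖y‖ ^ 2 + a / 2 * ‖x - a • y‖ ^ 2) =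
        ENNReal.ofReal (k y x) * (ENNReal.ofReal C + ENNReal.ofReal a * ENNReal.ofReal (‖y‖ ^ 2)) +
          ENNReal.ofReal (a / 2) *
            (ENNReal.ofReal (k y x) * ENNReal.ofReal (‖x - a • y‖ ^ 2)) := fun x => by
      rw [ENNReal.ofReal_add (by positivity) (by positivity), ENNReal.ofReal_add hC0 (by positivity),
        ENNReal.ofReal_mul ha.le, ENNReal.ofReal_mul (by positivity)]
      ring
    simp_rw [h3]
    rw [lintegral_add_left ((hkm y).ennreal_ofReal.mul_const _),
      lintegral_mul_const _ (hkm y).ennreal_ofReal, lintegral_gaussianDensity hσ, one_mul,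
      lintegral_const_mul' _ _ ENNReal.ofReal_ne_top]
    gcongr
    exact lintegral_sq_norm_mul_gaussianDensity_le hσ hσ1 _
  refine (lintegral_mono h2).trans_eq ?_
  rw [lintegral_add_right _ measurable_const, lintegral_add_left measurable_const,
    lintegral_const, lintegral_const, measure_univ, mul_one, mul_one]

theorem lintegral_sq_norm_densityMeasure_lt_top (hp : AEMeasurable pH) (hp0 : ∀ x, 0 ≤ pH x)
    (hp2 : Integrable fun x => ‖x‖ ^ 2 * pH x) :
    ∫⁻ y, ENNReal.ofReal (‖y‖ ^ 2) ∂densityMeasure pH < ∞ := by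
  have h := hp2.2
  rw [hasFiniteIntegral_iff_ofReal
    (Eventually.of_forall fun x => mul_nonneg (by positivity) (hp0 x))] at h
  rw [lintegral_densityMeasure hp]
  refine lt_of_eq_of_lt (lintegral_congr fun x => ?_) h
  rw [mul_comm, ENNReal.ofReal_mul (by positivity)]

/-- The marginal laws converge to the standard Gaussian in relative entropy. -/
theorem tendsto_klDiv_densityMeasure_marginal (hp : Integrable pH) (hp0 : ∀ x, 0 ≤ pH x)
    (hp1 : ∫ x, pH x = 1) (hp2 : Integrable fun x => ‖x‖ ^ 2 * pH x) :
    Tendsto (fun t => InformationTheory.klDiv (densityMeasure (marginal pH t))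
      (stdGaussian (EuclideanSpace ℝ (Fin n)))) atTop (𝓝 0) := by
  have hM := (lintegral_sq_norm_densityMeasure_lt_top hp.aestronglyMeasurable.aemeasurable
    hp0 hp2).ne
  have hG := (lintegral_sq_norm_stdGaussian_lt_top (n := n)).ne
  have h1 : Tendsto (fun t => ENNReal.ofReal (-((n : ℝ) / 2 * Real.log (sigmaSq t)))) atTop
      (𝓝 0) := by
    have := ENNReal.tendsto_ofReal
      ((tendsto_sigmaSq_atTop.log one_ne_zero).const_mul ((n : ℝ) / 2)).neg
    simpa using this
  have h2 : Tendsto (fun t => ENNReal.ofReal (coeffA t)) atTop (𝓝 0) := by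
    simpa using ENNReal.tendsto_ofReal tendsto_coeffA_atTop
  have h3 : Tendsto (fun t => ENNReal.ofReal (coeffA t / 2)) atTop (𝓝 0) := by
    simpa using ENNReal.tendsto_ofReal (tendsto_coeffA_atTop.div_const 2)
  have h4 : Tendsto (fun t => ENNReal.ofReal (sigmaSq t ^ (-(n : ℝ) / 2))) atTop (𝓝 1) := by
    simpa using ENNReal.tendsto_ofReal
      (tendsto_sigmaSq_atTop.rpow_const (p := -(n : ℝ) / 2) (Or.inl one_ne_zero))
  have h5 := ENNReal.Tendsto.mul_const h2 (Or.inr hM)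
  have h6 := ENNReal.Tendsto.mul_const h4 (Or.inr hG)
  have h7 := ENNReal.Tendsto.mul h3 (Or.inr (by simpa using hG)) h6 (Or.inr ENNReal.zero_ne_top)
  have h8 := (h1.add h5).add h7
  simp only [zero_mul, add_zero] at h8
  refine tendsto_of_tendsto_of_tendsto_of_le_of_le' tendsto_const_nhds h8
    (Eventually.of_forall fun _ => zero_le) ?_
  filter_upwards [eventually_gt_atTop 0] with t ht
  exact klDiv_densityMeasure_marginal_le hp hp0 hp1 ht

/-! ### Transport of densities by a diffeomorphism -/

section ChangeOfVariables

variable {f : EuclideanSpace ℝ (Fin n) → EuclideanSpace ℝ (Fin n)}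
  {f' : EuclideanSpace ℝ (Fin n) → EuclideanSpace ℝ (Fin n) →L[ℝ] EuclideanSpace ℝ (Fin n)}
  {p q : EuclideanSpace ℝ (Fin n) → ℝ}

theorem lintegral_det_mul_comp (hf : Function.Bijective f) (hf' : ∀ x, HasFDerivAt f (f' x) x)
    (hdet : ∀ x, 0 ≤ (f' x).det) (g : EuclideanSpace ℝ (Fin n) → ℝ≥0∞) :
    ∫⁻ x, ENNReal.ofReal (f' x).det * g (f x) = ∫⁻ x, g x := by
  have h := lintegral_image_eq_lintegral_abs_det_fderiv_mul volume MeasurableSet.univ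
    (fun x _ => (hf' x).hasFDerivWithinAt) hf.1.injOn g
  rw [image_univ, hf.2.range_eq, Measure.restrict_univ] at h
  rw [h]
  simp_rw [abs_of_nonneg (hdet _)]

theorem map_densityMeasure_eq (hf : Function.Bijective f) (hf' : ∀ x, HasFDerivAt f (f' x) x)
    (hdet : ∀ x, 0 ≤ (f' x).det) (hp : AEMeasurable p) (hq : AEMeasurable q)
    (hpq : ∀ x, p (f x) * (f' x).det = q x) :
    (densityMeasure q).map f = densityMeasure p := by
  have hfc : Continuous f := continuous_iff_continuousAt.2 fun x => (hf' x).continuousAt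
  refine Measure.ext_of_lintegral _ fun h hh => ?_
  rw [lintegral_map hh hfc.measurable, lintegral_densityMeasure hq, lintegral_densityMeasure hp,
    ← lintegral_det_mul_comp hf hf' hdet fun x => ENNReal.ofReal (p x) * h x]
  refine lintegral_congr fun x => ?_
  rw [← hpq, ENNReal.ofReal_mul' (hdet x), ← mul_assoc, mul_comm (ENNReal.ofReal (p (f x)))]

theorem eLpNorm_one_mul_det (hf : Function.Bijective f) (hf' : ∀ x, HasFDerivAt f (f' x) x)
    (hdet : ∀ x, 0 ≤ (f' x).det) (p q : EuclideanSpace ℝ (Fin n) → ℝ) :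
    eLpNorm (fun x => p (f x) * (f' x).det - q (f x) * (f' x).det) 1 volume =
      eLpNorm (fun x => p x - q x) 1 volume := by
  rw [eLpNorm_one_eq_lintegral_enorm, eLpNorm_one_eq_lintegral_enorm,
    ← lintegral_det_mul_comp hf hf' hdet fun x => ‖p x - q x‖ₑ]
  refine lintegral_congr fun x => ?_
  rw [← sub_mul, enorm_mul, mul_comm, Real.enorm_of_nonneg (hdet x)]

/-- The inverse need not be differentiated: the Gaussian is the image under `f` of the measure on
the right, and `Function.invFun f` undoes `f`. -/
theorem gaussianPullback_eq_densityMeasure (hf : Function.Bijective f)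
    (hinv : Continuous (Function.invFun f)) (hf' : ∀ x, HasFDerivAt f (f' x) x)
    (hcont : Continuous f') (hdet : ∀ x, 0 ≤ (f' x).det) :
    gaussianPullback f = densityMeasure fun x => gaussianDensity 1 0 (f x) * (f' x).det := by
  have hfc : Continuous f := continuous_iff_continuousAt.2 fun x => (hf' x).continuousAt
  have hg := continuous_gaussianDensity_right (n := n) 1 0
  have hq : Continuous fun x => gaussianDensity 1 0 (f x) * (f' x).det :=
    (hg.comp hfc).mul (ContinuousLinearMap.continuous_det.comp hcont)
  rw [gaussianPullback, stdGaussian_eq_densityMeasure,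
    ← map_densityMeasure_eq hf hf' hdet hg.measurable.aemeasurable hq.measurable.aemeasurable
      (fun _ => rfl), Measure.map_map hinv.measurable hfc.measurable,
    Function.invFun_comp hf.1, Measure.map_id]

theorem l1Dist_densityMeasure (hq : Measurable q) (hq0 : ∀ x, 0 ≤ q x) :
    l1Dist p (densityMeasure q) = eLpNorm (fun x => p x - q x) 1 volume := by
  refine eLpNorm_congr_ae ?_
  filter_upwards [Measure.rnDeriv_withDensity volume hq.ennreal_ofReal] with x hx
  rw [densityMeasure, hx, ENNReal.toReal_ofReal (hq0 x)]

end ChangeOfVariables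

/-! ### Existence and uniqueness of the probability flow -/

theorem IsC1Field.eq_of_isIntegralCurveOn {E : Type*} [NormedAddCommGroup E] [NormedSpace ℝ E]
    [FiniteDimensional ℝ E] {a b : ℝ} {v : ℝ → E → E} {A : ℝ → E → E →L[ℝ] E} {l : ℝ → ℝ}
    (h : IsC1Field a b v A l) {γ₁ γ₂ : ℝ → E} (h₁ : IsIntegralCurveOn γ₁ v (Icc a b))
    (h₂ : IsIntegralCurveOn γ₂ v (Icc a b)) {s t : ℝ} (hs : s ∈ Icc a b) (ht : t ∈ Icc a b)
    (heq : γ₁ s = γ₂ s) : γ₁ t = γ₂ t := by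
  have := h.norm_sub_le_of_isIntegralCurveOn h₁ h₂ hs ht
  rwa [heq, sub_self, norm_zero, mul_zero, norm_le_zero_iff, sub_eq_zero] at this

/-- The probability-flow ODE has a unique flow. It is a `C¹` flow with a `C¹` Lipschitz inverse,
and it transports the marginal densities. -/
theorem exists_isFlow (hp : Integrable pH) (hp0 : ∀ x, 0 ≤ pH x) (hp1 : ∫ x, pH x = 1)
    {L : ℝ → ℝ} (hL : ∀ t : ℝ, 0 < t → ∀ x, ‖fderiv ℝ (score pH t) x‖ ≤ L t)
    (hint : ∀ δ T : ℝ, 0 < δ → δ < T → IntervalIntegrable (fun t => 1 + L t) volume δ T) :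
    ∃ φ : ℝ → ℝ → EuclideanSpace ℝ (Fin n) → EuclideanSpace ℝ (Fin n), IsFlow pH φ ∧
      (∀ ψ : ℝ → ℝ → EuclideanSpace ℝ (Fin n) → EuclideanSpace ℝ (Fin n), IsFlow pH ψ →
        ∀ δ T : ℝ, 0 < δ → δ ≤ T → ψ δ T = φ δ T) ∧
      ∀ δ T : ℝ, 0 < δ → δ ≤ T → IsBiLipschitzDiffeo (φ δ T) ∧
        ∃ J : EuclideanSpace ℝ (Fin n) → EuclideanSpace ℝ (Fin n) →L[ℝ] EuclideanSpace ℝ (Fin n),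
          Continuous J ∧ (∀ x, HasFDerivAt (φ δ T) (J x) x) ∧
          ∀ x, marginal pH T (φ δ T x) * (J x).det = marginal pH δ x := by
  have hfield : ∀ δ T : ℝ, 0 < δ → δ ≤ T → IsC1Field δ T (velocity pH)
      (fun t x => fderiv ℝ (velocity pH t) x) (fun t => (1 / 2 : ℝ) * (1 + L t)) := by
    intro δ T hδ hT
    refine isC1Field_velocity hp hp0 hp1 hL hδ ?_
    rcases hT.eq_or_lt with rfl | hT
    · exact IntervalIntegrable.refl
    · exact hint δ T hδ hT
  -- The flow is built on `[δ, t + 1]` so that the interval is a neighbourhood of `t` within `[δ,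
  -- ∞)`, as the derivative there requires.
  have hex : ∀ δ t : ℝ, ∃ Φ, 0 < δ → δ ≤ t → ∃ J, IsC1Field.IsFlowOn δ (t + 1) δ (velocity pH)
      (fun t x => fderiv ℝ (velocity pH t) x) Φ J := by
    intro δ t
    by_cases h : 0 < δ ∧ δ ≤ t
    · obtain ⟨Φ, J, hΦ⟩ := (hfield δ (t + 1) h.1 (by linarith [h.2])).exists_isFlowOn
        (left_mem_Icc.2 (by linarith [h.2]))
      exact ⟨Φ, fun _ _ => ⟨J, hΦ⟩⟩
    · exact ⟨fun _ x => x, fun h1 h2 => absurd ⟨h1, h2⟩ h⟩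
  choose Φ hΦ using hex
  have huniq : ∀ δ T : ℝ, 0 < δ → δ ≤ T → ∀ (γ : ℝ → EuclideanSpace ℝ (Fin n)) x,
      IsIntegralCurveOn γ (velocity pH) (Icc δ T) → γ δ = x → γ T = Φ δ T T x := by
    intro δ T hδ hT γ x hγ hx
    obtain ⟨J, hJ⟩ := hΦ δ T hδ hT
    refine (hfield δ T hδ hT).eq_of_isIntegralCurveOn hγ
      ((hJ.isIntegralCurveOn x).mono (Icc_subset_Icc_right (by linarith)))
      (left_mem_Icc.2 hT) (right_mem_Icc.2 hT) ?_
    rw [hx, hJ.initial]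
  -- Flows chosen for different final times agree by `huniq`, so the diagonal choice `Φ δ t t` is a
  -- single curve in `t`.
  refine ⟨fun δ t => Φ δ t t, ?_, ?_, ?_⟩
  · intro δ hδ x
    refine ⟨?_, fun t ht => ?_⟩
    · obtain ⟨J, hJ⟩ := hΦ δ δ hδ le_rfl
      exact hJ.initial x
    · obtain ⟨J, hJ⟩ := hΦ δ t hδ ht
      have hmem : Icc δ (t + 1) ∈ 𝓝[Ici δ] t := by
        rw [← Ici_inter_Iic]
        exact inter_mem_nhdsWithin _ (Iic_mem_nhds (by linarith))
      have h1 := (hJ.isIntegralCurveOn x t ⟨ht, by linarith⟩).mono_of_mem_nhdsWithin hmem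
      refine h1.congr_of_eventuallyEq ?_ rfl
      filter_upwards [hmem] with τ hτ
      exact (huniq δ τ hδ hτ.1 _ x
        ((hJ.isIntegralCurveOn x).mono (Icc_subset_Icc_right hτ.2)) (hJ.initial x)).symm
  · intro ψ hψ δ T hδ hT
    ext1 x
    refine huniq δ T hδ hT (fun t => ψ δ t x) x (fun t ht => ?_) (hψ δ hδ x).1
    exact ((hψ δ hδ x).2 t ht.1).mono Icc_subset_Ici_self
  · intro δ T hδ hT
    have hf := hfield δ T hδ hT
    have hl := left_mem_Icc.2 hT
    have hr := right_mem_Icc.2 hT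
    -- `F` starts at `δ` and `G` at `T`; `G δ` is the inverse of `F T`, and is `C¹` and Lipschitz
    -- for the same reason.
    obtain ⟨F, J, hF⟩ := hf.exists_isFlowOn hl
    obtain ⟨G, J', hG⟩ := hf.exists_isFlowOn hr
    have heq : (fun δ t => Φ δ t t) δ T = F T := by
      ext1 x
      exact (huniq δ T hδ hT _ x (hF.isIntegralCurveOn x) (hF.initial x)).symm
    rw [heq]
    exact ⟨⟨G δ, hF.leftInverse hG hf hl hr, hG.leftInverse hF hf hr hl, hF.contDiff hf hl hr,
      hG.contDiff hf hr hl, ⟨_, hF.lipschitzWith hf hl hr⟩, ⟨_, hG.lipschitzWith hf hr hl⟩⟩,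
      J T, hF.continuous_deriv hf hl hr, hF.hasFDerivAt hf hl hr,
      marginal_mul_det_eq hp hp0 hp1 hδ hF hT⟩
end VPFlow

end

/-! ### The main theorem -/

theorem mainTheorem2 (n : ℕ)
    -- a probability density with finite second moment
    (pH : EuclideanSpace ℝ (Fin n) → ℝ)
    (hpH_nonneg : ∀ x, 0 ≤ pH x)
    (hpH_int : Integrable pH)
    (hpH_one : ∫ x, pH x = 1)
    (hpH_moment : Integrable fun x => ‖x‖ ^ 2 * pH x)
    -- the bound on the spatial derivative of the score
    (L : ℝ → ℝ)
    (hL : ∀ t : ℝ, 0 < t → ∀ x, ‖fderiv ℝ (VPFlow.score pH t) x‖ ≤ L t)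
    (hL_int : ∀ δ T : ℝ, 0 < δ → δ < T →
      IntervalIntegrable (fun t => 1 + L t) volume δ T) :
    -- the densities `p_t` are the marginals of the VP process
    (∀ (Ω : Type*) [MeasurableSpace Ω] (P : Measure Ω) [IsProbabilityMeasure P]
      (W X : ℝ≥0 → Ω → EuclideanSpace ℝ (Fin n)), VPFlow.IsVPProcess pH W X P →
      ∀ t : ℝ≥0, 0 < t → P.map (X t) = VPFlow.densityMeasure (VPFlow.marginal pH t)) ∧
    -- the flow exists and is unique
    ∃ φ : ℝ → ℝ → EuclideanSpace ℝ (Fin n) → EuclideanSpace ℝ (Fin n),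
      VPFlow.IsFlow pH φ ∧
      (∀ ψ : ℝ → ℝ → EuclideanSpace ℝ (Fin n) → EuclideanSpace ℝ (Fin n),
        VPFlow.IsFlow pH ψ → ∀ δ T : ℝ, 0 < δ → δ ≤ T → ψ δ T = φ δ T) ∧
      -- I
      (∀ δ T : ℝ, 0 < δ → δ < T → VPFlow.IsBiLipschitzDiffeo (φ δ T)) ∧
      -- II
      (∀ δ : ℝ, 0 < δ →
        Tendsto
          (fun T : ℝ => InformationTheory.klDiv
            ((VPFlow.densityMeasure (VPFlow.marginal pH δ)).map (φ δ T))
            (stdGaussian (EuclideanSpace ℝ (Fin n))))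
          atTop (𝓝 0)) ∧
      -- III: the pullbacks have Lebesgue densities, and the iterated `L¹` limit is zero
      (∀ δ T : ℝ, 0 < δ → δ < T → VPFlow.gaussianPullback (φ δ T) ≪ volume) ∧
      ∃ ℓ : ℝ → ℝ≥0∞,
        (∀ δ : ℝ, 0 < δ →
          Tendsto (fun T : ℝ => VPFlow.l1Dist pH (VPFlow.gaussianPullback (φ δ T)))
            atTop (𝓝 (ℓ δ))) ∧
        Tendsto ℓ (𝓝[>] 0) (𝓝 0) := by
  refine ⟨fun Ω _ P _ W X hX t ht => hX.map_eq hpH_int hpH_nonneg hpH_one ht, ?_⟩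
  obtain ⟨φ, hφ, huniq, hdiff⟩ :=
    VPFlow.exists_isFlow hpH_int hpH_nonneg hpH_one hL hL_int
  have hmm : ∀ t : ℝ, 0 < t → Measurable (VPFlow.marginal pH t) := fun t ht =>
    VPFlow.measurable_marginal hpH_int ht
  have hmi : ∀ t : ℝ, 0 < t → AEStronglyMeasurable (VPFlow.marginal pH t) volume := fun t ht =>
    (hmm t ht).aestronglyMeasurable
  -- Both marginal densities are positive, so conservation of mass forces the Jacobian determinant
  -- to be positive.
  have hdet : ∀ δ T : ℝ, 0 < δ → δ ≤ T →
      ∀ {J : EuclideanSpace ℝ (Fin n) → EuclideanSpace ℝ (Fin n) →L[ℝ] EuclideanSpace ℝ (Fin n)},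
      (∀ x, VPFlow.marginal pH T (φ δ T x) * (J x).det = VPFlow.marginal pH δ x) →
      ∀ x, 0 ≤ (J x).det := by
    intro δ T hδ hT J hJ x
    have h1 := VPFlow.marginal_pos hpH_int hpH_nonneg hpH_one hδ x
    have h2 := VPFlow.marginal_pos hpH_int hpH_nonneg hpH_one (hδ.trans_le hT) (φ δ T x)
    rw [← hJ x] at h1
    exact (pos_of_mul_pos_right h1 h2.le).le
  have hbij : ∀ δ T : ℝ, 0 < δ → δ ≤ T →
      Function.Bijective (φ δ T) ∧ Continuous (Function.invFun (φ δ T)) := by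
    intro δ T hδ hT
    obtain ⟨g, hl, hr, -, hg, -, -⟩ := (hdiff δ T hδ hT).1
    have hinv : Function.invFun (φ δ T) = g :=
      Function.invFun_eq_of_injective_of_rightInverse hl.injective hr
    exact ⟨⟨hl.injective, hr.surjective⟩, hinv ▸ hg.continuous⟩
  have hpull : ∀ δ T : ℝ, 0 < δ → δ ≤ T → ∃ q : EuclideanSpace ℝ (Fin n) → ℝ,
      Measurable q ∧ (∀ x, 0 ≤ q x) ∧
      VPFlow.gaussianPullback (φ δ T) = VPFlow.densityMeasure q ∧
      eLpNorm (fun x => VPFlow.marginal pH δ x - q x) 1 volume =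
        eLpNorm (fun x => VPFlow.marginal pH T x - VPFlow.gaussianDensity 1 0 x) 1 volume := by
    intro δ T hδ hT
    obtain ⟨-, J, hJc, hJ, hJm⟩ := hdiff δ T hδ hT
    obtain ⟨hb, hinv⟩ := hbij δ T hδ hT
    have hd := hdet δ T hδ hT hJm
    refine ⟨_, ?_, fun x => mul_nonneg (VPFlow.gaussianDensity_nonneg one_pos 0 _) (hd x),
      VPFlow.gaussianPullback_eq_densityMeasure hb hinv hJ hJc hd, ?_⟩
    · exact (((VPFlow.continuous_gaussianDensity_right 1 0).comp
        (continuous_iff_continuousAt.2 fun x => (hJ x).continuousAt)).mul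
        (ContinuousLinearMap.continuous_det.comp hJc)).measurable
    -- Pulling `p_T` and the Gaussian density back by the flow keeps their `L¹` distance, and
    -- conservation of mass turns the pullback of `p_T` into `p_δ`.
    · rw [← VPFlow.eLpNorm_one_mul_det hb hJ hd (VPFlow.marginal pH T)]
      simp_rw [hJm]
  refine ⟨φ, hφ, huniq, fun δ T hδ hT => (hdiff δ T hδ hT.le).1, fun δ hδ => ?_,
    fun δ T hδ hT => ?_,
    fun δ => eLpNorm (fun x => pH x - VPFlow.marginal pH δ x) 1 volume, fun δ hδ => ?_,
    VPFlow.tendsto_eLpNorm_marginal_sub hpH_int hpH_nonneg⟩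
  -- The flow sends the law with density `p_δ` exactly to that with density `p_T`, so the entropies
  -- coincide for `T ≥ δ`.
  · refine (VPFlow.tendsto_klDiv_densityMeasure_marginal hpH_int hpH_nonneg hpH_one
      hpH_moment).congr' ?_
    filter_upwards [eventually_ge_atTop δ] with T hT
    obtain ⟨-, J, hJc, hJ, hJm⟩ := hdiff δ T hδ hT
    rw [VPFlow.map_densityMeasure_eq (hbij δ T hδ hT).1 hJ (hdet δ T hδ hT hJm)
      (hmm T (hδ.trans_le hT)).aemeasurable (hmm δ hδ).aemeasurable hJm]
  · obtain ⟨q, -, -, hq, -⟩ := hpull δ T hδ hT.le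
    rw [hq]
    exact withDensity_absolutelyContinuous _ _
  · have hlim := VPFlow.tendsto_eLpNorm_marginal_sub_gaussianDensity hpH_int hpH_nonneg hpH_one
    set ℓ := eLpNorm (fun x => pH x - VPFlow.marginal pH δ x) 1 volume
    -- The triangle inequality squeezes the distance between `ℓ - ‖p_T - p_Z‖` and `ℓ + ‖p_T -
    -- p_Z‖`, which proves that the inner limit exists and equals `ℓ`.
    have hlow := ENNReal.Tendsto.sub (tendsto_const_nhds (x := ℓ)) hlim
      (Or.inr ENNReal.zero_ne_top)
    have hupp := (tendsto_const_nhds (x := ℓ)).add hlim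
    rw [tsub_zero] at hlow
    rw [add_zero] at hupp
    refine tendsto_of_tendsto_of_tendsto_of_le_of_le' hlow hupp ?_ ?_
    all_goals
      filter_upwards [eventually_ge_atTop δ] with T hT
      obtain ⟨q, hqm, hq0, hq, hqe⟩ := hpull δ T hδ hT
      rw [hq, VPFlow.l1Dist_densityMeasure hqm hq0, ← hqe]
    · rw [tsub_le_iff_right, VPFlow.eLpNorm_one_sub_comm (VPFlow.marginal pH δ) q]
      exact VPFlow.eLpNorm_one_sub_triangle hpH_int.aestronglyMeasurable
        hqm.aestronglyMeasurable (hmi δ hδ)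
    · exact VPFlow.eLpNorm_one_sub_triangle hpH_int.aestronglyMeasurable (hmi δ hδ)
        hqm.aestronglyMeasurable
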